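/- **Setting.** A *fully ordered, finite-weighted diagram* $(\mathcal B,w^\pm,\le_{r,s})$ consists of two fully ordered Bratteli diagrams $B^+,B^-$ whose level-$0$ vertex sets are identified, order-preservingly, with one set $\mathcal V_0$ (so $B^\pm$ are the positive and negative halves of a bi-infinite diagram $\mathcal B$), together with a weight function $w^{\pm}$ on each half. Here all levels are finite and nonempty, every vertex is the source of an edge, every vertex of positive level is the range of an edge, edges with a common range (source) are totally ordered by $\le_r$ ($\le_s$), and $\mathcal V_0$ is totally ordered. A weight function assigns positive numbers to the vertices of level $0$ and to the edges, such that (i) the product $w(s(e_1))w(e_1)\cdots w(e_n)$ depends only on the final vertex of the path $(e_1,\dots,e_n)$ from level $0$, (ii) the weights of the edges leaving any vertex sum to $1$, (iii) these products tend to $0$ along every infinite path whose tail equivalence class is infinite. The normalization $\sum_{v\in\mathcal V_0}w^+(v)w^-(v)=1$ is assumed (but not $\sum_v w^+(v)=1$). The *surface* $S(\mathcal B,w^\pm,\le_{r,s})$ is built from rectangles $R_v$ ($v\in\mathcal V_0$) of width $w^+(v)$ and height $w^-(v)$, arranged diagonally in the plane in the order of $\mathcal V_0$. The weighted ordered diagram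 $B^+$ defines by cutting (left to right, in the order $\le_s$ and with relative widths $w^+(e)$) and stacking (bottom to top, in the order $\le_r$) an interval exchange map $T^+$, possibly of infinitely many intervals, on the union of the bases of the rectangles, with the convention that on a periodic component the top level is mapped to the bottom level; $B^-$ defines in the same way a map $T^-$ on the union of the vertical sides. One glues the point of a top edge above $x$ to the point of a bottom edge below $T^+(x)$, and the point of a right edge at height $y$ to the point of a left edge at height $T^-(y)$, whenever $x$ (resp. $y$) is interior to an exchanged interval, and deletes all boundary points not glued in this way. $S$ carries the area measure, and its *vertical flow* moves points upwards at unit speed through the rectangles and across the glued edges; it is only partially defined, since trajectories stop at deleted points. A *measure-preserving flow* $(\varphi_t)_{t\in\mathbb R}$ on a standard Borel probability space $(X,\mu)$ (a unit-measure Lebesgue space) is a jointly measurable action of $\mathbb R$ by measure-preserving maps. It is *isomorphic* to the vertical flow on $S$ if, after discarding null sets (an invariant one in $X$), there is a measure-preserving measurable bijection with measurable inverse that carries $\varphi_t$ to the vertical flow for all $t\in\mathbb R$. Its unitary group $U_tf=f\circ\varphi_t$ on $L^2(X,\mu;\mathbb C)$ *has an eigenfunction with nonzero eigenvalue* if there are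 $\lambda\in\mathbb R\setminus\{0\}$ and $f\neq0$ in $L^2$ with $U_tf=e^{i\lambda t}f$ for all $t$. The flow is *aperiodic* if for almost every $x$ one has $\varphi_t(x)\ne x$ for all $t\neq 0$. **Statement.** Let $(\varphi_t)$ be a measure-preserving flow on a standard Borel probability space $(X,\mu)$. 1. If $(\varphi_t)$ is isomorphic to the vertical flow on $S(\mathcal B,w^\pm,\le_{r,s})$ for some fully ordered, finite-weighted diagram with $|\mathcal V_0|=1$, then its unitary group has an eigenfunction with nonzero eigenvalue. 2. If $(\varphi_t)$ is ergodic and aperiodic, then it is isomorphic to the vertical flow on $S(\mathcal B,w^\pm,\le_{r,s})$ for some fully ordered, finite-weighted diagram with $|\mathcal V_0|=1$ **if and only if** its unitary group has an eigenfunction with nonzero eigenvalue. -/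

import Mathlib

open MeasureTheory Filter Topology

noncomputable section

/-! ## Bratteli diagrams -/

/-- A (singly-infinite) Bratteli diagram: a graph with nonempty finite levels `V 0, V 1, …` of
vertices, where `E n` is the finite set of edges between level `n` and level `n + 1`; every vertex
is the source of some edge, and every vertex of positive level is the range of some edge.
Connectedness is not part of the definition, because the two halves of a bi-infinite diagram need
not be connected; it is automatic when `V 0` has one element. -/
structure BratteliDiagram where
  V : ℕ → Type
  E : ℕ → Type
  fintypeV : ∀ n, Fintype (V n)
  fintypeE : ∀ n, Fintype (E n)
  nonemptyV : ∀ n, Nonempty (V n)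
  src : ∀ n, E n → V n
  rng : ∀ n, E n → V (n + 1)
  src_surjective : ∀ n, Function.Surjective (src n)
  rng_surjective : ∀ n, Function.Surjective (rng n)

attribute [instance] BratteliDiagram.fintypeV BratteliDiagram.fintypeE BratteliDiagram.nonemptyV

/-- A fully ordered Bratteli diagram: `leR` and `leS` are partial orders on the edges under which
two edges are comparable exactly when they have the same range, resp. the same source, and the
vertices of level `0` are totally ordered. -/
structure FullyOrderedBratteli extends BratteliDiagram where
  linearOrderV : LinearOrder (V 0)
  leR : ∀ n, E n → E n → Prop
  leS : ∀ n, E n → E n → Prop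
  isPartialOrder_leR : ∀ n, IsPartialOrder (E n) (leR n)
  isPartialOrder_leS : ∀ n, IsPartialOrder (E n) (leS n)
  comparable_leR : ∀ n e e', (leR n e e' ∨ leR n e' e) ↔ rng n e = rng n e'
  comparable_leS : ∀ n e e', (leS n e e' ∨ leS n e' e) ↔ src n e = src n e'

attribute [instance] FullyOrderedBratteli.linearOrderV

/-- The space of infinite paths starting at level `0`. -/
def BratteliDiagram.PathSpace (B : BratteliDiagram) : Type :=
  {ξ : ∀ n, B.E n // ∀ n, B.rng n (ξ n) = B.src (n + 1) (ξ (n + 1))}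

namespace BratteliDiagram

variable {B : BratteliDiagram}

/-- The `n`-th edge of an infinite path. -/
def PathSpace.edge (ξ : B.PathSpace) (n : ℕ) : B.E n := ξ.1 n

/-- Two paths agree from the `n`-th edge on. -/
def PathSpace.AgreeFrom (n : ℕ) (ξ η : B.PathSpace) : Prop := ∀ k, n ≤ k → ξ.edge k = η.edge k

/-- Tail equivalence of infinite paths. -/
def PathSpace.TailEquiv (ξ η : B.PathSpace) : Prop := ∃ n, PathSpace.AgreeFrom n ξ η

/-- `w(s(e₁)) · w(e₁) ⋯ w(eₙ)` for the first `n` edges `e₁, …, eₙ` of the path `ξ`. -/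
def pathWeight (wV : B.V 0 → ℝ) (wE : ∀ n, B.E n → ℝ) (ξ : B.PathSpace) (n : ℕ) : ℝ :=
  wV (B.src 0 (ξ.edge 0)) * ∏ k ∈ Finset.range n, wE k (ξ.edge k)

open scoped Classical in
/-- A finite weight function on a Bratteli diagram (the sum of the weights of the finitely many
vertices of level `0` is automatically finite). In `weight_eq`, the finite paths of positive length
are written as initial segments of infinite ones; every finite path extends to an infinite one. -/
structure WeightFunction (B : BratteliDiagram) where
  wV : B.V 0 → ℝ
  wE : ∀ n, B.E n → ℝ
  wV_pos : ∀ v, 0 < wV v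
  wE_pos : ∀ n e, 0 < wE n e
  weight_eq : ∀ (n : ℕ) (ξ η : B.PathSpace), B.rng n (ξ.edge n) = B.rng n (η.edge n) →
    pathWeight wV wE ξ (n + 1) = pathWeight wV wE η (n + 1)
  sum_eq_one : ∀ (n : ℕ) (v : B.V n),
    ∑ e ∈ Finset.univ.filter (fun e => B.src n e = v), wE n e = 1
  tendsto_zero : ∀ ξ : B.PathSpace, {η : B.PathSpace | ξ.TailEquiv η}.Infinite →
    Tendsto (fun n => pathWeight wV wE ξ n) atTop (𝓝 0)

end BratteliDiagram

/-! ## The cutting and stacking map of a weighted, fully ordered Bratteli diagram -/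

namespace FullyOrderedBratteli

variable (B : FullyOrderedBratteli) (w : B.WeightFunction)

/-- `e` is the greatest edge among those with its range. -/
def IsMaxEdge (n : ℕ) (e : B.E n) : Prop := ∀ e', B.leR n e e' → e' = e

/-- `e` is the least edge among those with its range. -/
def IsMinEdge (n : ℕ) (e : B.E n) : Prop := ∀ e', B.leR n e' e → e' = e

/-- `e'` is the immediate successor of `e` for `leR`. -/
def IsNextEdge (n : ℕ) (e e' : B.E n) : Prop :=
  B.leR n e e' ∧ e ≠ e' ∧ ∀ e'', B.leR n e e'' → B.leR n e'' e' → e'' = e ∨ e'' = e'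

/-- Left endpoint of the interval of the vertex `v` of level `0`: the vertices are arranged from
left to right in increasing order. -/
def vertexLeft (v : B.V 0) : ℝ := ∑ u ∈ Finset.univ.filter (fun u => u < v), w.wV u

/-- Right endpoint of the interval of the vertex `v` of level `0`. -/
def vertexRight (v : B.V 0) : ℝ := B.vertexLeft w v + w.wV v

open scoped Classical in
/-- The part of (the relative width of) an interval that lies to the left of the subinterval of the
edge `e`, when the interval is cut according to `leS` among the edges with the source of `e`. -/
def edgeOffset (n : ℕ) (e : B.E n) : ℝ :=
  ∑ e' ∈ Finset.univ.filter (fun e' => B.leS n e' e ∧ e' ≠ e), w.wE n e'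

/-- Left endpoint of the level indexed by the first `n` edges of `ξ` in the stage `n` stack. -/
def levelLeft (ξ : B.PathSpace) (n : ℕ) : ℝ :=
  B.vertexLeft w (B.src 0 (ξ.edge 0)) +
    ∑ k ∈ Finset.range n,
      BratteliDiagram.pathWeight w.wV w.wE ξ k * B.edgeOffset w k (ξ.edge k)

/-- The level (an open interval) indexed by the first `n` edges of `ξ` in the stage `n` stack. The
levels over a vertex `v` of level `n` are the finite paths from level `0` to `v`; they are cut out
from left to right according to `leS` and stacked in the lexicographic order given by `leR`. -/
def level (ξ : B.PathSpace) (n : ℕ) : Set ℝ :=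
  Set.Ioo (B.levelLeft w ξ n)
    (B.levelLeft w ξ n + BratteliDiagram.pathWeight w.wV w.wE ξ n)

/-- `ξ'` is the successor of `ξ` for the adic transformation, and `n` is the first place where `ξ`
is not maximal. -/
def IsSuccessorAt (n : ℕ) (ξ ξ' : B.PathSpace) : Prop :=
  (∀ k < n, B.IsMaxEdge k (ξ.edge k) ∧ B.IsMinEdge k (ξ'.edge k)) ∧
    B.IsNextEdge n (ξ.edge n) (ξ'.edge n) ∧
    BratteliDiagram.PathSpace.AgreeFrom (n + 1) ξ ξ'

/-- The graph of the cutting and stacking map `T`: `B.StackMap w x y` means that `T` is defined at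
`x` with value `y`. By the first clause, `T` translates each level that is not a top level of its
column onto the level directly above it. By the second clause, on a periodic component (a maximal
path that is tail equivalent to a minimal path has a finite tail equivalence class) the top interval
is translated onto the bottom one. -/
inductive StackMap : ℝ → ℝ → Prop
  | up (n : ℕ) (ξ ξ' : B.PathSpace) (x : ℝ) (hs : B.IsSuccessorAt n ξ ξ')
      (hx : x ∈ B.level w ξ (n + 1)) :
      StackMap x (x + (B.levelLeft w ξ' (n + 1) - B.levelLeft w ξ (n + 1)))
  | wrap (n : ℕ) (ξ ξ' : B.PathSpace) (x : ℝ)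
      (hmax : ∀ k, B.IsMaxEdge k (ξ.edge k)) (hmin : ∀ k, B.IsMinEdge k (ξ'.edge k))
      (ht : BratteliDiagram.PathSpace.AgreeFrom n ξ ξ') (hx : ∀ k, x ∈ B.level w ξ k) :
      StackMap x (x + (B.levelLeft w ξ' n - B.levelLeft w ξ n))

/-- `x` is an interior point of one of the intervals that are exchanged by the cutting and stacking
map, and `y` is its image. -/
def Exchanges (x y : ℝ) : Prop :=
  ∃ ε > 0, ∀ s : ℝ, |s| < ε → B.StackMap w (x + s) (y + s)

end FullyOrderedBratteli

/-! ## Diagrams and their surfaces -/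

/-- A fully ordered, finite-weighted bi-infinite Bratteli diagram `(ℬ, w⁺, w⁻, ≤_{r,s})`, given as
the welding of its two halves: level `-n` of `ℬ` is level `n` of `neg`, where the arrows and the two
orders are reversed, and the vertices of level `0` of the two halves are identified in an order
preserving way. Both weights are finite, and they are normalized so that the surface has area
`1`. -/
structure FiniteWeightedDiagram where
  pos : FullyOrderedBratteli
  neg : FullyOrderedBratteli
  weld : pos.V 0 ≃o neg.V 0
  wPos : pos.WeightFunction
  wNeg : neg.WeightFunction
  area_eq_one : ∑ v, wPos.wV v * wNeg.wV (weld v) = 1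

namespace FiniteWeightedDiagram

variable (D : FiniteWeightedDiagram)

/-- The common set `𝒱₀` of vertices of level `0`. -/
abbrev V₀ : Type := D.pos.V 0

/-- Left side of the rectangle of `v`. -/
def left (v : D.V₀) : ℝ := D.pos.vertexLeft D.wPos v

/-- Right side of the rectangle of `v`. -/
def right (v : D.V₀) : ℝ := D.pos.vertexRight D.wPos v

/-- Bottom side of the rectangle of `v`. -/
def bottom (v : D.V₀) : ℝ := D.neg.vertexLeft D.wNeg (D.weld v)

/-- Top side of the rectangle of `v`. -/
def top (v : D.V₀) : ℝ := D.neg.vertexRight D.wNeg (D.weld v)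

/-- The interior of the rectangle of `v`; it has width `w⁺(v)` and height `w⁻(v)`, and the
rectangles are arranged diagonally in the plane. -/
def rectInterior (v : D.V₀) : Set (ℝ × ℝ) :=
  Set.Ioo (D.left v) (D.right v) ×ˢ Set.Ioo (D.bottom v) (D.top v)

/-- The edge identifications: the map of the positive half glues points of top edges to points of
bottom edges, and the map of the negative half glues points of right edges to points of left
edges. -/
inductive Glue : ℝ × ℝ → ℝ × ℝ → Prop
  | topBottom (u v : D.V₀) (x x' : ℝ) (hx : x ∈ Set.Ioo (D.left u) (D.right u))
      (hx' : x' ∈ Set.Ioo (D.left v) (D.right v)) (h : D.pos.Exchanges D.wPos x x') :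
      Glue (x, D.top u) (x', D.bottom v)
  | rightLeft (u v : D.V₀) (y y' : ℝ) (hy : y ∈ Set.Ioo (D.bottom u) (D.top u))
      (hy' : y' ∈ Set.Ioo (D.bottom v) (D.top v)) (h : D.neg.Exchanges D.wNeg y y') :
      Glue (D.right u, y) (D.left v, y')

/-- The union of the rectangles without the singular boundary points: all interior points, and those
boundary points that are glued to another boundary point. -/
def carrier : Set (ℝ × ℝ) :=
  {p | (∃ v, p ∈ D.rectInterior v) ∨ ∃ q, D.Glue p q ∨ D.Glue q p}

/-- The surface `S(ℬ, w^±, ≤_{r,s})`. -/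
def Surface : Type := Quot (fun p q : D.carrier => D.Glue p q)

/-- The quotient map onto the surface. -/
def toSurface (p : D.carrier) : D.Surface := Quot.mk _ p

instance : MeasurableSpace D.Surface :=
  inferInstanceAs (MeasurableSpace (Quot (fun p q : D.carrier => D.Glue p q)))

/-- The area measure of the surface. -/
def area : Measure D.Surface := (volume.comap ((↑) : D.carrier → ℝ × ℝ)).map D.toSurface

/-- `D.FlowsUp t a b`: moving for time `t ≥ 0` from `a` vertically upwards with unit speed leads to
`b`, without meeting a singular point. The motion is a concatenation of vertical segments in the
rectangles, continued through the identified edges. -/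
inductive FlowsUp : ℝ → D.Surface → D.Surface → Prop
  | segment (x y t : ℝ) (ht : 0 ≤ t) (h : ∀ s ∈ Set.Icc 0 t, (x, y + s) ∈ D.carrier)
      (h₀ : (x, y) ∈ D.carrier) (h₁ : (x, y + t) ∈ D.carrier) :
      FlowsUp t (D.toSurface ⟨(x, y), h₀⟩) (D.toSurface ⟨(x, y + t), h₁⟩)
  | trans (s t : ℝ) (a b c : D.Surface) (hab : FlowsUp s a b) (hbc : FlowsUp t b c) :
      FlowsUp (s + t) a c

/-- The graph of the vertical flow of the surface, which is only partially defined: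
`D.VerticalFlow t a b` means that the flow is defined at `a` up to time `t` (which may be negative)
and takes `a` to `b`. -/
def VerticalFlow (t : ℝ) (a b : D.Surface) : Prop :=
  (0 ≤ t ∧ D.FlowsUp t a b) ∨ (t ≤ 0 ∧ D.FlowsUp (-t) b a)

end FiniteWeightedDiagram

/-! ## Flows, isomorphism, eigenfunctions

A measure-preserving flow on `(X, μ)` is a jointly measurable, measure-preserving additive action
of `ℝ`; thus `φ_t x = t +ᵥ x`. -/

/-- The flow on `(X, μ)` is measurably isomorphic to the vertical flow on the surface of `D`: after
removing null sets (the one in `X` being invariant), there is a measure-preserving measurable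
bijection with measurable inverse which intertwines the two flows. -/
def IsIsomorphicToVerticalFlow {X : Type*} [MeasurableSpace X] [AddAction ℝ X] (μ : Measure X)
    (D : FiniteWeightedDiagram) : Prop :=
  ∃ (A : Set X) (A' : Set D.Surface) (hA : ∀ (t : ℝ) (x : X), x ∈ A → t +ᵥ x ∈ A) (e : A ≃ᵐ A'),
    MeasurableSet A ∧ MeasurableSet A' ∧ μ Aᶜ = 0 ∧ D.area A'ᶜ = 0 ∧
    MeasurePreserving e (μ.comap (↑)) (D.area.comap (↑)) ∧
    ∀ (t : ℝ) (x : A), D.VerticalFlow t (e x) (e ⟨t +ᵥ (x : X), hA t x x.2⟩)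

/-- The unitary group of the flow: `(U_t f)(x) = f(φ_t x)` on `L²(X, μ; ℂ)`. -/
def koopman {X : Type*} [MeasurableSpace X] [AddAction ℝ X] [MeasurableVAdd₂ ℝ X] (μ : Measure X)
    [VAddInvariantMeasure ℝ X μ] (t : ℝ) : Lp ℂ 2 μ →ₗᵢ[ℂ] Lp ℂ 2 μ :=
  Lp.compMeasurePreservingₗᵢ ℂ (fun x : X => t +ᵥ x) (measurePreserving_vadd t μ)

/-- The unitary group of the flow has an eigenfunction with nonzero eigenvalue. -/
def HasEigenfunctionWithNonzeroEigenvalue {X : Type*} [MeasurableSpace X] [AddAction ℝ X]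
    [MeasurableVAdd₂ ℝ X] (μ : Measure X) [VAddInvariantMeasure ℝ X μ] : Prop :=
  ∃ (lam : ℝ) (f : Lp ℂ 2 μ), lam ≠ 0 ∧ f ≠ 0 ∧
    ∀ t : ℝ, koopman μ t f = Complex.exp (Complex.I * lam * t) • f

/-- Almost every point has a trivial stabilizer. -/
def IsAperiodicFlow {X : Type*} [MeasurableSpace X] [AddAction ℝ X] (μ : Measure X) : Prop :=
  ∀ᵐ x ∂μ, ∀ t : ℝ, t ≠ 0 → t +ᵥ x ≠ x

end

/-!
The vertical flow of a surface that consists of a single rectangle of height `H` has the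
eigenfunction `exp (2πiy/H)`, where `y` is the height in the rectangle: vertical segments rotate it
uniformly, the top and the bottom sides have the same phase, and the vertical sides are null sets
which no vertical segment enters or leaves. An isomorphism transports this eigenfunction.

Conversely, let `f` be an eigenfunction of eigenvalue `λ ≠ 0` of an ergodic and aperiodic flow.
The average of `exp (-iλs) f (φ_s x)` over a piece of the orbit of `x` is a version that satisfies
`F (φ_t x) = exp (iλt) F x` everywhere on an invariant conull set, and `F` is nonzero almost
everywhere by ergodicity. Hence the argument of `F` is a height function, the flow is the
suspension with the constant roof `H = 2π/|λ|` of the return map to a section `Y` of constant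
argument (`exists_flowSection`), and the measure is the product of an invariant measure of the
return map with the length (`FlowSection.map_foot_height`). Only a free action of `ℤ` on a
standard Borel probability space remains, and `exists_intervalModel` realizes it by cutting and
stacking a single interval, as in the theorem of Vershik that free transformations are adic.
Decreasing marker sets with bounded return times, the `n`-th of which never returns in fewer than
`n + 1` steps, provide refining towers that separate points; the towers and their cells give the
vertices and edges of a Bratteli diagram, whose edges are weighted by conditional measures. Marker
sets are used instead of Rokhlin's lemma so that every orbit is exhausted exactly. The path of a
point determines its position in the interval, and almost every position is an interior point of
an exchanged interval (`RefiningTowers.ae_isInterior`).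

The negative half of the diagram is taken to be trivial, with one vertex and one edge in each level,
and total mass `H`. The surface is then one rectangle of width `H⁻¹` and height `H`, over which the
vertical flow is the suspension of the cutting and stacking map with the roof `H`
(`FlowSection.isIsomorphicToVerticalFlow`).
-/

noncomputable section

/-! ### Geometry of the levels of a weighted, fully ordered diagram -/

namespace FullyOrderedBratteli

open BratteliDiagram

variable {B : FullyOrderedBratteli} {w : B.WeightFunction}

lemma edgeOffset_nonneg (n : ℕ) (e : B.E n) : 0 ≤ B.edgeOffset w n e :=
  Finset.sum_nonneg fun e' _ => (w.wE_pos n e').le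

lemma edgeOffset_add_le_edgeOffset {n : ℕ} {e e' : B.E n} (hle : B.leS n e e') (hne : e ≠ e') :
    B.edgeOffset w n e + w.wE n e ≤ B.edgeOffset w n e' := by
  classical
  have := B.isPartialOrder_leS n
  unfold edgeOffset
  rw [add_comm, ← Finset.sum_insert (s := Finset.univ.filter (fun a => B.leS n a e ∧ a ≠ e))
    (by simp)]
  refine Finset.sum_le_sum_of_subset_of_nonneg ?_ fun a _ _ => (w.wE_pos n a).le
  intro a ha
  simp only [Finset.mem_insert, Finset.mem_filter, Finset.mem_univ, true_and] at ha ⊢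
  rcases ha with rfl | ⟨h1, h2⟩
  · exact ⟨hle, hne⟩
  · refine ⟨_root_.trans h1 hle, ?_⟩
    rintro rfl
    exact h2 (antisymm h1 hle)

lemma edgeOffset_add_le_one (n : ℕ) (e : B.E n) : B.edgeOffset w n e + w.wE n e ≤ 1 := by
  classical
  rw [← w.sum_eq_one n (B.src n e)]
  unfold edgeOffset
  rw [add_comm, ← Finset.sum_insert (s := Finset.univ.filter (fun a => B.leS n a e ∧ a ≠ e))
    (by simp)]
  refine Finset.sum_le_sum_of_subset_of_nonneg ?_ fun a _ _ => (w.wE_pos n a).le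
  intro a ha
  simp only [Finset.mem_insert, Finset.mem_filter, Finset.mem_univ, true_and] at ha ⊢
  rcases ha with rfl | ⟨h1, h2⟩
  · rfl
  · exact (B.comparable_leS n a e).1 (Or.inl h1)

lemma pathWeight_pos (ξ : B.PathSpace) (n : ℕ) : 0 < pathWeight w.wV w.wE ξ n :=
  mul_pos (w.wV_pos _) (Finset.prod_pos fun k _ => w.wE_pos k _)

lemma pathWeight_succ (ξ : B.PathSpace) (n : ℕ) :
    pathWeight w.wV w.wE ξ (n + 1) = pathWeight w.wV w.wE ξ n * w.wE n (ξ.edge n) := by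
  simp [pathWeight, Finset.prod_range_succ, mul_assoc]

lemma levelLeft_succ (ξ : B.PathSpace) (n : ℕ) :
    B.levelLeft w ξ (n + 1) =
      B.levelLeft w ξ n + pathWeight w.wV w.wE ξ n * B.edgeOffset w n (ξ.edge n) := by
  simp [levelLeft, Finset.sum_range_succ, add_assoc]

/-- Right endpoint of the level indexed by the first `n` edges of `ξ`. -/
def levelRight (B : FullyOrderedBratteli) (w : B.WeightFunction) (ξ : B.PathSpace) (n : ℕ) : ℝ :=
  B.levelLeft w ξ n + pathWeight w.wV w.wE ξ n

lemma levelLeft_lt_levelRight (ξ : B.PathSpace) (n : ℕ) :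
    B.levelLeft w ξ n < B.levelRight w ξ n :=
  lt_add_of_pos_right _ (pathWeight_pos ξ n)

lemma levelLeft_mono (ξ : B.PathSpace) : Monotone (B.levelLeft w ξ) :=
  monotone_nat_of_le_succ fun n => by
    rw [levelLeft_succ]
    exact le_add_of_nonneg_right (mul_nonneg (pathWeight_pos ξ n).le (edgeOffset_nonneg _ _))

lemma levelRight_anti (ξ : B.PathSpace) : Antitone (B.levelRight w ξ) :=
  antitone_nat_of_succ_le fun n => by
    rw [levelRight, levelRight, levelLeft_succ, pathWeight_succ]
    nlinarith [edgeOffset_add_le_one (w := w) n (ξ.edge n), pathWeight_pos (w := w) ξ n]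

lemma level_anti (ξ : B.PathSpace) : Antitone (B.level w ξ) := fun _ _ h =>
  Set.Ioo_subset_Ioo (levelLeft_mono ξ h) (levelRight_anti ξ h)

/-- The stage `0` data only involve the source vertex; under the hypothesis of a single vertex of
level `0`, the first `n` edges determine the stage `n` level. -/
lemma pathWeight_congr [Subsingleton (B.V 0)] {ξ η : B.PathSpace} {n : ℕ}
    (h : ∀ k < n, ξ.edge k = η.edge k) :
    pathWeight w.wV w.wE ξ n = pathWeight w.wV w.wE η n := by
  unfold pathWeight
  rw [Subsingleton.elim (B.src 0 (ξ.edge 0)) (B.src 0 (η.edge 0))]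
  congr 1
  exact Finset.prod_congr rfl fun k hk => by rw [h k (Finset.mem_range.1 hk)]

lemma levelLeft_congr [Subsingleton (B.V 0)] {ξ η : B.PathSpace} {n : ℕ}
    (h : ∀ k < n, ξ.edge k = η.edge k) :
    B.levelLeft w ξ n = B.levelLeft w η n := by
  unfold levelLeft
  rw [Subsingleton.elim (B.src 0 (ξ.edge 0)) (B.src 0 (η.edge 0))]
  congr 1
  refine Finset.sum_congr rfl fun k hk => ?_
  have hk := Finset.mem_range.1 hk
  rw [h k hk, pathWeight_congr fun j hj => h j (hj.trans hk)]

lemma rng_edge (ξ : B.PathSpace) (n : ℕ) : B.rng n (ξ.edge n) = B.src (n + 1) (ξ.edge (n + 1)) :=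
  ξ.2 n

lemma src_eq_of_agree [Subsingleton (B.V 0)] {ξ η : B.PathSpace} {n : ℕ}
    (h : ∀ k < n, ξ.edge k = η.edge k) : B.src n (ξ.edge n) = B.src n (η.edge n) := by
  cases n with
  | zero => exact Subsingleton.elim _ _
  | succ m => rw [← rng_edge, ← rng_edge, h m m.lt_succ_self]

/-- Levels of one stage that are indexed by different finite paths are disjoint. -/
lemma edge_eq_of_mem_level [Subsingleton (B.V 0)] {ξ η : B.PathSpace} {n : ℕ} {x : ℝ}
    (hξ : x ∈ B.level w ξ n) (hη : x ∈ B.level w η n) : ∀ k < n, ξ.edge k = η.edge k := by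
  induction n with
  | zero => simp
  | succ n ih =>
    have hag := ih (level_anti ξ n.le_succ hξ) (level_anti η n.le_succ hη)
    intro k hk
    rcases Nat.lt_succ_iff_lt_or_eq.1 hk with hk | rfl
    · exact hag k hk
    by_contra hne
    have aux : ∀ {ξ η : B.PathSpace}, x ∈ B.level w ξ (k + 1) → x ∈ B.level w η (k + 1) →
        (∀ j < k, ξ.edge j = η.edge j) → ξ.edge k ≠ η.edge k →
        B.leS k (ξ.edge k) (η.edge k) → False := by
      intro ξ η hξ hη hag hne hle
      have h1 := hξ.2
      have h2 := hη.1
      rw [levelLeft_succ, pathWeight_succ] at h1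
      rw [levelLeft_succ, ← levelLeft_congr hag, ← pathWeight_congr hag] at h2
      nlinarith [edgeOffset_add_le_edgeOffset (w := w) hle hne, pathWeight_pos (w := w) ξ k]
    rcases (B.comparable_leS k (ξ.edge k) (η.edge k)).2 (src_eq_of_agree hag) with h | h
    · exact aux hξ hη hag hne h
    · exact aux hη hξ (fun j hj => (hag j hj).symm) (Ne.symm hne) h

/-! ### The point of the interval that a path points to -/

/-- The point of the interval that lies in the closures of all levels of `ξ` (it is unique if the
weights along `ξ` tend to `0`). -/
def position (B : FullyOrderedBratteli) (w : B.WeightFunction) (ξ : B.PathSpace) : ℝ :=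
  ⨆ n, B.levelLeft w ξ n

lemma levelLeft_le_levelRight (ξ : B.PathSpace) (m n : ℕ) :
    B.levelLeft w ξ m ≤ B.levelRight w ξ n :=
  (levelLeft_mono ξ (le_max_left m n)).trans
    ((levelLeft_lt_levelRight ξ _).le.trans (levelRight_anti ξ (le_max_right m n)))

lemma bddAbove_levelLeft (ξ : B.PathSpace) : BddAbove (Set.range (B.levelLeft w ξ)) :=
  ⟨B.levelRight w ξ 0, by rintro _ ⟨n, rfl⟩; exact levelLeft_le_levelRight ξ n 0⟩

lemma levelLeft_le_position (ξ : B.PathSpace) (n : ℕ) : B.levelLeft w ξ n ≤ B.position w ξ :=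
  le_ciSup (bddAbove_levelLeft ξ) n

lemma position_le_levelRight (ξ : B.PathSpace) (n : ℕ) : B.position w ξ ≤ B.levelRight w ξ n :=
  ciSup_le fun m => levelLeft_le_levelRight ξ m n

lemma tendsto_levelLeft (ξ : B.PathSpace) :
    Tendsto (B.levelLeft w ξ) atTop (𝓝 (B.position w ξ)) :=
  tendsto_atTop_ciSup (levelLeft_mono ξ) (bddAbove_levelLeft ξ)

/-- The path points to an interior point of each of its levels. -/
def IsInterior (B : FullyOrderedBratteli) (w : B.WeightFunction) (ξ : B.PathSpace) : Prop :=
  ∀ n, B.position w ξ ∈ B.level w ξ n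

lemma IsInterior.ext [Subsingleton (B.V 0)] {ξ η : B.PathSpace} (hξ : B.IsInterior w ξ)
    (hη : B.IsInterior w η) (h : B.position w ξ = B.position w η) : ξ = η := by
  refine Subtype.ext (funext fun n => ?_)
  exact edge_eq_of_mem_level (hξ (n + 1)) (h ▸ hη (n + 1)) n n.lt_succ_self

/-! ### The cutting and stacking map along adic orbits -/

lemma levelLeft_sub_levelLeft {n : ℕ} {ξ ξ' : B.PathSpace} (h : PathSpace.AgreeFrom n ξ ξ')
    (hw : pathWeight w.wV w.wE ξ' n = pathWeight w.wV w.wE ξ n) (m : ℕ) :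
    B.levelLeft w ξ' (n + m) - B.levelLeft w ξ (n + m) =
      B.levelLeft w ξ' n - B.levelLeft w ξ n ∧
    pathWeight w.wV w.wE ξ' (n + m) = pathWeight w.wV w.wE ξ (n + m) := by
  induction m with
  | zero => exact ⟨rfl, hw⟩
  | succ m ih =>
    have he := h (n + m) (Nat.le_add_right _ _)
    rw [← add_assoc, levelLeft_succ, levelLeft_succ, pathWeight_succ, pathWeight_succ, ih.2, he]
    exact ⟨by linarith [ih.1], rfl⟩

lemma IsSuccessorAt.rng_eq {n : ℕ} {ξ ξ' : B.PathSpace} (h : B.IsSuccessorAt n ξ ξ') :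
    B.rng n (ξ.edge n) = B.rng n (ξ'.edge n) :=
  (B.comparable_leR n _ _).1 (Or.inl h.2.1.1)

lemma IsSuccessorAt.pathWeight_eq {n : ℕ} {ξ ξ' : B.PathSpace} (h : B.IsSuccessorAt n ξ ξ') :
    pathWeight w.wV w.wE ξ' (n + 1) = pathWeight w.wV w.wE ξ (n + 1) :=
  w.weight_eq n ξ' ξ h.rng_eq.symm

lemma IsSuccessorAt.position_eq {n : ℕ} {ξ ξ' : B.PathSpace} (h : B.IsSuccessorAt n ξ ξ') :
    B.position w ξ' =
      B.position w ξ + (B.levelLeft w ξ' (n + 1) - B.levelLeft w ξ (n + 1)) := by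
  have h1 : Tendsto (fun m => B.levelLeft w ξ' (n + 1 + m)) atTop (𝓝 (B.position w ξ')) :=
    (tendsto_levelLeft ξ').comp (tendsto_add_atTop_nat (n + 1) |>.congr fun m => add_comm _ _)
  have h2 : Tendsto (fun m => B.levelLeft w ξ (n + 1 + m)) atTop (𝓝 (B.position w ξ)) :=
    (tendsto_levelLeft ξ).comp (tendsto_add_atTop_nat (n + 1) |>.congr fun m => add_comm _ _)
  refine tendsto_nhds_unique h1 ((h2.add_const _).congr fun m => ?_)
  have := (levelLeft_sub_levelLeft (w := w) h.2.2 h.pathWeight_eq m).1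
  linarith

lemma IsSuccessorAt.exchanges {n : ℕ} {ξ ξ' : B.PathSpace} (h : B.IsSuccessorAt n ξ ξ')
    (hξ : B.IsInterior w ξ) : B.Exchanges w (B.position w ξ) (B.position w ξ') := by
  obtain ⟨ε, hε, hball⟩ := Metric.isOpen_iff.1 isOpen_Ioo _ (hξ (n + 1))
  refine ⟨ε, hε, fun s hs => ?_⟩
  have := StackMap.up (w := w) n ξ ξ' (B.position w ξ + s) h
    (hball (by simpa [Metric.mem_ball, Real.dist_eq] using hs))
  rw [h.position_eq]
  convert this using 1
  ring

/-- At a path whose first `n` edges are maximal while the `n`-th one is not, the successor is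
determined, through its first `n + 1` edges, by those of the path. -/
lemma IsSuccessorAt.unique {n m : ℕ} {ξ ξ' η η' : B.PathSpace} (h : B.IsSuccessorAt n ξ ξ')
    (h' : B.IsSuccessorAt m η η') (hag : ∀ k < n + 1, ξ.edge k = η.edge k) :
    n = m ∧ ∀ k < n + 1, ξ'.edge k = η'.edge k := by
  have hnm : n = m := by
    rcases lt_trichotomy n m with hlt | heq | hlt
    · refine absurd ((h'.1 n hlt).1 (ξ'.edge n) ?_) ?_
      · rw [← hag n n.lt_succ_self]; exact h.2.1.1
      · rw [← hag n n.lt_succ_self]; exact h.2.1.2.1.symm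
    · exact heq
    · refine absurd ((h.1 m hlt).1 (η'.edge m) ?_) ?_
      · rw [hag m (by omega)]; exact h'.2.1.1
      · rw [hag m (by omega)]; exact h'.2.1.2.1.symm
  subst hnm
  refine ⟨rfl, ?_⟩
  have hn : ξ'.edge n = η'.edge n := by
    have e := hag n n.lt_succ_self
    obtain ⟨a1, a2, a3⟩ := h.2.1
    obtain ⟨b1, b2, b3⟩ := h'.2.1
    rw [← e] at b1 b2 b3
    have hc : B.rng n (ξ'.edge n) = B.rng n (η'.edge n) :=
      ((B.comparable_leR n _ _).1 (Or.inr a1)).trans ((B.comparable_leR n _ _).1 (Or.inl b1))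
    rcases (B.comparable_leR n _ _).2 hc with hc | hc
    · exact (b3 _ a1 hc).resolve_left a2.symm
    · exact ((a3 _ b1 hc).resolve_left b2.symm).symm
  -- below `n`, both successors consist of the minimal edges leading to the vertex just reached
  have key : ∀ j ≤ n, ξ'.edge (n - j) = η'.edge (n - j) := by
    intro j
    induction j with
    | zero => intro _; simpa using hn
    | succ j ih =>
      intro hj
      have hk : n - (j + 1) < n := by omega
      have e := ih (by omega)
      have hs : n - j = n - (j + 1) + 1 := by omega
      have hr : B.rng _ (ξ'.edge (n - (j + 1))) = B.rng _ (η'.edge (n - (j + 1))) := by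
        rw [hs] at e
        rw [rng_edge, rng_edge, e]
      rcases (B.comparable_leR _ _ _).2 hr with hc | hc
      · exact (h'.1 _ hk).2 _ hc
      · exact ((h.1 _ hk).2 _ hc).symm
  intro k hk
  have := key (n - k) (by omega)
  rwa [show n - (n - k) = k by omega] at this

/-- The mirror image of `IsSuccessorAt.unique`. -/
lemma IsSuccessorAt.unique_symm {n m : ℕ} {ξ ξ' η η' : B.PathSpace} (h : B.IsSuccessorAt n ξ ξ')
    (h' : B.IsSuccessorAt m η η') (hag : ∀ k < n + 1, ξ'.edge k = η'.edge k) :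
    n = m ∧ ∀ k < n + 1, ξ.edge k = η.edge k := by
  have hnm : n = m := by
    rcases lt_trichotomy n m with hlt | heq | hlt
    · refine absurd ((h'.1 n hlt).2 (ξ.edge n) ?_) ?_
      · rw [← hag n n.lt_succ_self]; exact h.2.1.1
      · rw [← hag n n.lt_succ_self]; exact h.2.1.2.1
    · exact heq
    · refine absurd ((h.1 m hlt).2 (η.edge m) ?_) ?_
      · rw [hag m (by omega)]; exact h'.2.1.1
      · rw [hag m (by omega)]; exact h'.2.1.2.1
  subst hnm
  refine ⟨rfl, ?_⟩
  have hn : ξ.edge n = η.edge n := by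
    have e := hag n n.lt_succ_self
    obtain ⟨a1, a2, a3⟩ := h.2.1
    obtain ⟨b1, b2, b3⟩ := h'.2.1
    rw [← e] at b1 b2 b3
    have hc : B.rng n (ξ.edge n) = B.rng n (η.edge n) :=
      ((B.comparable_leR n _ _).1 (Or.inl a1)).trans ((B.comparable_leR n _ _).1 (Or.inr b1))
    rcases (B.comparable_leR n _ _).2 hc with hc | hc
    · exact ((a3 _ hc b1).resolve_right b2).symm
    · exact (b3 _ hc a1).resolve_right a2
  have key : ∀ j ≤ n, ξ.edge (n - j) = η.edge (n - j) := by
    intro j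
    induction j with
    | zero => intro _; simpa using hn
    | succ j ih =>
      intro hj
      have hk : n - (j + 1) < n := by omega
      have e := ih (by omega)
      have hs : n - j = n - (j + 1) + 1 := by omega
      have hr : B.rng _ (ξ.edge (n - (j + 1))) = B.rng _ (η.edge (n - (j + 1))) := by
        rw [hs] at e
        rw [rng_edge, rng_edge, e]
      rcases (B.comparable_leR _ _ _).2 hr with hc | hc
      · exact ((h.1 _ hk).1 _ hc).symm
      · exact (h'.1 _ hk).1 _ hc
  intro k hk
  have := key (n - k) (by omega)
  rwa [show n - (n - k) = k by omega] at this

/-- The cutting and stacking map takes the point of an interior path to that of its successor, and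
nowhere else. -/
lemma StackMap.eq_position_of_left [Subsingleton (B.V 0)] {m : ℕ} {η η' : B.PathSpace}
    (hs : B.IsSuccessorAt m η η') (hη : B.IsInterior w η) {x u : ℝ} (hx : x = B.position w η)
    (h : B.StackMap w x u) : u = B.position w η' := by
  cases h with
  | up n ξ ξ' _ hs' hmem =>
    rw [hx] at hmem
    have hag := edge_eq_of_mem_level hmem (hη (n + 1))
    obtain ⟨rfl, hag'⟩ := hs'.unique hs hag
    rw [hs.position_eq, levelLeft_congr hag, levelLeft_congr hag', hx]
  | wrap n ξ ξ' _ hmax _ _ hmem =>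
    rw [hx] at hmem
    have hag := edge_eq_of_mem_level (hmem (m + 1)) (hη (m + 1)) m m.lt_succ_self
    refine absurd (hmax m (η'.edge m) ?_) ?_
    · rw [hag]; exact hs.2.1.1
    · rw [hag]; exact hs.2.1.2.1.symm

/-- The only point that the cutting and stacking map takes to the point of an interior path is that
of its predecessor. -/
lemma StackMap.eq_position_of_right [Subsingleton (B.V 0)] {m : ℕ} {η η' : B.PathSpace}
    (hs : B.IsSuccessorAt m η η') (hη : B.IsInterior w η') {x u : ℝ}
    (hu : u = B.position w η') (h : B.StackMap w x u) : x = B.position w η := by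
  cases h with
  | up n ξ ξ' _ hs' hmem =>
    have hmem' : B.position w η' ∈ B.level w ξ' (n + 1) := by
      have hw := hs'.pathWeight_eq (w := w)
      rw [← hu]
      constructor
      · linarith [hmem.1]
      · rw [hw]; linarith [hmem.2]
    have hag' := edge_eq_of_mem_level hmem' (hη (n + 1))
    obtain ⟨rfl, hag⟩ := hs'.unique_symm hs hag'
    have := hs.position_eq (w := w)
    rw [← levelLeft_congr hag, ← levelLeft_congr hag', ← hu] at this
    linarith
  | wrap n ξ ξ' _ hmax hmin ht hmem =>
    -- the point lies in a level of the minimal path `ξ'` at an arbitrarily late stage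
    set N := max n m with hN
    have hmem' : B.position w η' ∈ B.level w ξ' (N + 1) := by
      have hw : pathWeight w.wV w.wE ξ' n = pathWeight w.wV w.wE ξ n := by
        cases n with
        | zero => exact pathWeight_congr (by simp)
        | succ n => exact w.weight_eq n ξ' ξ (by rw [rng_edge, rng_edge, ht (n + 1) le_rfl])
      obtain ⟨j, hj⟩ := Nat.exists_eq_add_of_le (show n ≤ N + 1 by omega)
      have h1 := levelLeft_sub_levelLeft ht hw j
      rw [← hj] at h1
      have h2 := hmem (N + 1)
      rw [← hu]
      constructor
      · linarith [h2.1, h1.1]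
      · rw [h1.2]; linarith [h2.2, h1.1]
    have hag := edge_eq_of_mem_level hmem' (hη (N + 1)) m (by omega)
    refine absurd (hmin m (η.edge m) ?_) ?_
    · rw [hag]; exact hs.2.1.1
    · rw [hag]; exact hs.2.1.2.1

end FullyOrderedBratteli

/-! ### Refining towers over a measure-preserving bijection -/

/-- A decreasing sequence of bases for towers of bounded height over the bijection `y ↦ 1 +ᵥ y`,
together with finite codes. The stage `n` towers are the sets of points of `base n` with the same
stage `n` code. The code of stage `n + 1` of a point knows, along the orbit segment of length
`gap (n + 1)`, the codes of stage `n`, the visits to the bases of stages `n` and `n + 1`, and the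
visits to the set `sep n`; the latter sets separate the points. -/
structure TowerSystem (Y : Type*) [MeasurableSpace Y] [AddAction ℤ Y] (ν : Measure Y) where
  base : ℕ → Set Y
  gap : ℕ → ℕ
  code : ℕ → Y → ℕ
  sep : ℕ → Set Y
  measurableSet_base : ∀ n, MeasurableSet (base n)
  measurable_code : ∀ n, Measurable (code n)
  finite_range_code : ∀ n, (Set.range (code n)).Finite
  base_zero : base 0 = Set.univ
  code_zero : ∀ y y', code 0 y = code 0 y'
  base_succ_subset : ∀ n, base (n + 1) ⊆ base n
  exists_mem_base : ∀ n y, ∃ k : ℕ, k < gap n ∧ -(k : ℤ) +ᵥ y ∈ base n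
  code_spec : ∀ n y y', code (n + 1) y = code (n + 1) y' → ∀ o : ℕ, o < gap (n + 1) →
    code n ((o : ℤ) +ᵥ y) = code n ((o : ℤ) +ᵥ y') ∧
    ((o : ℤ) +ᵥ y ∈ base n ↔ (o : ℤ) +ᵥ y' ∈ base n) ∧
    ((o : ℤ) +ᵥ y ∈ base (n + 1) ↔ (o : ℤ) +ᵥ y' ∈ base (n + 1)) ∧
    ((o : ℤ) +ᵥ y ∈ sep n ↔ (o : ℤ) +ᵥ y' ∈ sep n)
  separates : ∀ y y', (∀ n, y ∈ sep n ↔ y' ∈ sep n) → y = y'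
  measure_base_le : ∀ n, ν.real (base n) ≤ 1 / (n + 1)

/-- A tower system in which no point lies in all bases and no tower is null. -/
structure RefiningTowers (Y : Type*) [MeasurableSpace Y] [AddAction ℤ Y] (ν : Measure Y) extends
    TowerSystem Y ν where
  escapes : ∀ y, ∃ n, y ∉ base n
  cell_pos : ∀ n, ∀ y ∈ base n, 0 < ν {z | z ∈ base n ∧ code n z = code n y}

namespace RefiningTowers

variable {Y : Type*} [MeasurableSpace Y] [AddAction ℤ Y] {ν : Measure Y} (T : RefiningTowers Y ν)

lemma exists_base (n : ℕ) (y : Y) : ∃ k : ℕ, -(k : ℤ) +ᵥ y ∈ T.base n :=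
  let ⟨k, _, hk⟩ := T.exists_mem_base n y
  ⟨k, hk⟩

open scoped Classical in
/-- The height of `y` above the base in its stage `n` tower. -/
def age (n : ℕ) (y : Y) : ℕ := Nat.find (T.exists_base n y)

/-- The point of the base below `y` in its stage `n` tower. -/
def root (n : ℕ) (y : Y) : Y := -(T.age n y : ℤ) +ᵥ y

lemma root_mem (n : ℕ) (y : Y) : T.root n y ∈ T.base n := by
  classical exact Nat.find_spec (T.exists_base n y)

lemma age_le {n k : ℕ} {y : Y} (h : -(k : ℤ) +ᵥ y ∈ T.base n) : T.age n y ≤ k := by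
  classical exact Nat.find_min' (T.exists_base n y) h

lemma age_eq {n k : ℕ} {y : Y} (h : -(k : ℤ) +ᵥ y ∈ T.base n)
    (h' : ∀ j < k, -(j : ℤ) +ᵥ y ∉ T.base n) : T.age n y = k :=
  le_antisymm (T.age_le h) (not_lt.1 fun hlt => h' _ hlt (T.root_mem n y))

lemma age_lt_gap (n : ℕ) (y : Y) : T.age n y < T.gap n :=
  let ⟨_, hk, hk'⟩ := T.exists_mem_base n y
  (T.age_le hk').trans_lt hk

lemma age_vadd_root (n : ℕ) (y : Y) : (T.age n y : ℤ) +ᵥ T.root n y = y := by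
  simp [root, vadd_vadd]

lemma age_of_mem {n : ℕ} {y : Y} (h : y ∈ T.base n) : T.age n y = 0 :=
  Nat.le_zero.1 (T.age_le (by simpa using h))

lemma root_of_mem {n : ℕ} {y : Y} (h : y ∈ T.base n) : T.root n y = y := by
  simp [root, T.age_of_mem h]

lemma base_anti : Antitone T.base := antitone_nat_of_succ_le T.base_succ_subset

lemma age_le_age_succ (n : ℕ) (y : Y) : T.age n y ≤ T.age (n + 1) y :=
  T.age_le (T.base_succ_subset n (T.root_mem (n + 1) y))

lemma age_succ_root (n : ℕ) (y : Y) :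
    T.age (n + 1) y = T.age n y + T.age (n + 1) (T.root n y) := by
  have h := T.age_le_age_succ n y
  have : T.age (n + 1) (T.root n y) = T.age (n + 1) y - T.age n y := by
    refine T.age_eq ?_ fun j hj hmem => ?_
    · have := T.root_mem (n + 1) y
      rw [root] at this
      rw [root, vadd_vadd]
      convert this using 2
      push_cast [Nat.cast_sub h]; ring
    · rw [root, vadd_vadd, ← neg_add, ← Nat.cast_add] at hmem
      have := T.age_le hmem
      omega
  omega

lemma root_succ_root (n : ℕ) (y : Y) : T.root (n + 1) (T.root n y) = T.root (n + 1) y := by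
  have h := T.age_succ_root n y
  conv_lhs => rw [root]
  conv_rhs => rw [root, h]
  rw [root, vadd_vadd]
  congr 1
  push_cast; ring

lemma sub_age_vadd_root {n k : ℕ} {y : Y} (h : k ≤ T.age n y) :
    ((T.age n y - k : ℕ) : ℤ) +ᵥ T.root n y = -(k : ℤ) +ᵥ y := by
  rw [root, vadd_vadd]
  congr 1
  push_cast [Nat.cast_sub h]; ring

/-- A tower can be entered through any other point of the base with the same code. -/
lemma age_vadd_of_code_eq {n : ℕ} {y b : Y} (hb : b ∈ T.base n)
    (hc : T.code n b = T.code n (T.root n y)) : T.age n ((T.age n y : ℤ) +ᵥ b) = T.age n y := by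
  cases n with
  | zero =>
    have h0 : ∀ z, T.age 0 z = 0 := fun z => T.age_of_mem (by simp [T.base_zero])
    rw [h0, h0]
  | succ n =>
    refine T.age_eq (by simpa [vadd_vadd] using hb) fun j hj hmem => ?_
    have e : -(j : ℤ) +ᵥ (T.age (n + 1) y : ℤ) +ᵥ b
        = ((T.age (n + 1) y - j : ℕ) : ℤ) +ᵥ b := by
      rw [vadd_vadd]
      congr 1
      push_cast [Nat.cast_sub hj.le]; ring
    have hlt := T.age_lt_gap (n + 1) y
    rw [e, (T.code_spec n _ _ hc _ (by omega)).2.2.1, T.sub_age_vadd_root hj.le] at hmem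
    have := T.age_le hmem
    omega

lemma age_code_of_succ {n : ℕ} {y y' : Y} (ha : T.age (n + 1) y = T.age (n + 1) y')
    (hc : T.code (n + 1) (T.root (n + 1) y) = T.code (n + 1) (T.root (n + 1) y')) :
    T.age n y = T.age n y' ∧ T.code n (T.root n y) = T.code n (T.root n y') := by
  have aux : ∀ {y y' : Y}, T.age (n + 1) y = T.age (n + 1) y' →
      T.code (n + 1) (T.root (n + 1) y) = T.code (n + 1) (T.root (n + 1) y') →
      T.age n y' ≤ T.age n y := by
    intro y y' ha hc
    have hle := T.age_le_age_succ n y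
    have hlt := T.age_lt_gap (n + 1) y
    have h := (T.code_spec n _ _ hc (T.age (n + 1) y - T.age n y) (by omega)).2.1
    rw [T.sub_age_vadd_root hle, ha, T.sub_age_vadd_root (ha ▸ hle)] at h
    exact T.age_le (h.1 (T.root_mem n y))
  have hage := le_antisymm (aux ha.symm hc.symm) (aux ha hc)
  refine ⟨hage, ?_⟩
  have hle := T.age_le_age_succ n y
  have hlt := T.age_lt_gap (n + 1) y
  have h := (T.code_spec n _ _ hc (T.age (n + 1) y - T.age n y) (by omega)).1
  rw [T.sub_age_vadd_root hle, ha, hage, T.sub_age_vadd_root (hage ▸ ha ▸ hle)] at h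
  rw [root, root, hage]
  exact h

/-- For a point of the stage `n` base: the code of its stage `n + 1` tower, and its height there. -/
def edgeData (n : ℕ) (y : Y) : ℕ × ℕ := (T.code (n + 1) (T.root (n + 1) y), T.age (n + 1) y)

lemma edgeData_eq_iff {n : ℕ} {y y' : Y} : T.edgeData n y = T.edgeData n y' ↔
    T.age (n + 1) y = T.age (n + 1) y' ∧
      T.code (n + 1) (T.root (n + 1) y) = T.code (n + 1) (T.root (n + 1) y') := by
  rw [edgeData, edgeData, Prod.ext_iff, and_comm]

lemma code_eq_of_edgeData_eq {n : ℕ} {y y' : Y} (hy : y ∈ T.base n) (hy' : y' ∈ T.base n)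
    (h : T.edgeData n y = T.edgeData n y') : T.code n y = T.code n y' := by
  have h := T.edgeData_eq_iff.1 h
  have := (T.age_code_of_succ h.1 h.2).2
  rwa [T.root_of_mem hy, T.root_of_mem hy'] at this

/-- The vertices of level `n`: the codes of the stage `n` towers. -/
abbrev Vertex (n : ℕ) : Type := {v : ℕ // ∃ y ∈ T.base n, T.code n y = v}

/-- The edges from level `n` to level `n + 1`: the passages of the stage `n + 1` towers through
stage `n` towers, recorded by the stage `n + 1` code and the height of the passage. -/
abbrev Edge (n : ℕ) : Type := {p : ℕ × ℕ // ∃ y ∈ T.base n, T.edgeData n y = p}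

instance (n : ℕ) : Finite (T.Vertex n) :=
  ((T.finite_range_code n).subset fun _ ⟨y, _, hy⟩ => ⟨y, hy⟩ :
    {v | ∃ y ∈ T.base n, T.code n y = v}.Finite).to_subtype

instance (n : ℕ) : Finite (T.Edge n) :=
  (((T.finite_range_code (n + 1)).prod (Set.finite_Iio (T.gap (n + 1)))).subset
    fun _ ⟨y, _, hy⟩ => by
      rw [← hy]; exact ⟨⟨_, rfl⟩, T.age_lt_gap _ _⟩ :
    {p | ∃ y ∈ T.base n, T.edgeData n y = p}.Finite).to_subtype

/-- The stage `n` tower that an edge passes through. -/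
def source (n : ℕ) (e : T.Edge n) : T.Vertex n :=
  ⟨T.code n e.2.choose, e.2.choose, e.2.choose_spec.1, rfl⟩

/-- The stage `n + 1` tower to which a passage belongs. -/
def range (n : ℕ) (e : T.Edge n) : T.Vertex (n + 1) :=
  ⟨e.1.1, T.root (n + 1) e.2.choose, T.root_mem _ _, congrArg Prod.fst e.2.choose_spec.2⟩

/-- The vertex of a point of the stage `n` base. -/
def vertexOf (n : ℕ) (y : Y) (hy : y ∈ T.base n) : T.Vertex n := ⟨T.code n y, y, hy, rfl⟩

/-- The edge of a point of the stage `n` base. -/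
def edgeOf (n : ℕ) (y : Y) (hy : y ∈ T.base n) : T.Edge n := ⟨T.edgeData n y, y, hy, rfl⟩

lemma source_edgeOf {n : ℕ} {y : Y} (hy : y ∈ T.base n) :
    T.source n (T.edgeOf n y hy) = T.vertexOf n y hy :=
  Subtype.ext (T.code_eq_of_edgeData_eq (T.edgeOf n y hy).2.choose_spec.1 hy
    (T.edgeOf n y hy).2.choose_spec.2)

lemma range_edgeOf {n : ℕ} {y : Y} (hy : y ∈ T.base n) :
    T.range n (T.edgeOf n y hy) = T.vertexOf (n + 1) (T.root (n + 1) y) (T.root_mem _ _) := rfl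

/-- The Bratteli diagram of the towers: passages are ordered by height, edges with the same source
are ordered in an arbitrary way. -/
def diagram [Nonempty Y] : FullyOrderedBratteli where
  V := T.Vertex
  E := T.Edge
  fintypeV n := Fintype.ofFinite _
  fintypeE n := Fintype.ofFinite _
  nonemptyV n := ⟨T.vertexOf n _ (T.root_mem n (Classical.arbitrary Y))⟩
  src := T.source
  rng := T.range
  src_surjective n := by
    rintro ⟨_, y, hy, rfl⟩
    exact ⟨T.edgeOf n y hy, T.source_edgeOf hy⟩
  rng_surjective n := by
    rintro ⟨_, y, hy, rfl⟩
    refine ⟨T.edgeOf n y (T.base_succ_subset n hy), ?_⟩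
    rw [range_edgeOf]
    simp only [T.root_of_mem hy]
    rfl
  linearOrderV := inferInstanceAs (LinearOrder (T.Vertex 0))
  leR n e e' := e.1.1 = e'.1.1 ∧ e.1.2 ≤ e'.1.2
  leS n e e' := T.source n e = T.source n e' ∧ toLex e.1 ≤ toLex e'.1
  isPartialOrder_leR n :=
    { refl := fun _ => ⟨rfl, le_rfl⟩
      trans := fun _ _ _ h h' => ⟨h.1.trans h'.1, h.2.trans h'.2⟩
      antisymm := fun _ _ h h' => Subtype.ext (Prod.ext h.1 (le_antisymm h.2 h'.2)) }
  isPartialOrder_leS n :=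
    { refl := fun _ => ⟨rfl, le_rfl⟩
      trans := fun _ _ _ h h' => ⟨h.1.trans h'.1, h.2.trans h'.2⟩
      antisymm := fun _ _ h h' => Subtype.ext (toLex.injective (le_antisymm h.2 h'.2)) }
  comparable_leR n e e' := by
    constructor
    · rintro (h | h)
      · exact Subtype.ext h.1
      · exact Subtype.ext h.1.symm
    · intro h
      have h := congrArg Subtype.val h
      exact (le_total e.1.2 e'.1.2).imp (fun h' => ⟨h, h'⟩) fun h' => ⟨h.symm, h'⟩
  comparable_leS n e e' := by
    constructor
    · rintro (h | h)
      · exact h.1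
      · exact h.1.symm
    · intro h
      exact (le_total (toLex e.1) (toLex e'.1)).imp (fun h' => ⟨h, h'⟩) fun h' => ⟨h.symm, h'⟩

instance [Nonempty Y] : Subsingleton (T.diagram.V 0) :=
  ⟨by rintro ⟨_, y, _, rfl⟩ ⟨_, y', _, rfl⟩; exact Subtype.ext (T.code_zero y y')⟩

/-! ### Weights of the towers -/

/-- The measure of the base of the tower with code `v`. -/
def cellMass (n v : ℕ) : ℝ := ν.real {z | z ∈ T.base n ∧ T.code n z = v}

lemma cellMass_pos [IsProbabilityMeasure ν] {n : ℕ} (v : T.Vertex n) : 0 < T.cellMass n v.1 := by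
  obtain ⟨_, y, hy, rfl⟩ := v
  exact ENNReal.toReal_pos (T.cell_pos n y hy).ne' (measure_ne_top _ _)

lemma cellMass_le [IsProbabilityMeasure ν] (n v : ℕ) : T.cellMass n v ≤ 1 / (n + 1) :=
  (measureReal_mono fun _ h => h.1).trans (T.measure_base_le n)

lemma cellMass_zero [IsProbabilityMeasure ν] (v : T.Vertex 0) : T.cellMass 0 v.1 = 1 := by
  obtain ⟨_, y, hy, rfl⟩ := v
  have : {z | z ∈ T.base 0 ∧ T.code 0 z = T.code 0 y} = Set.univ :=
    Set.eq_univ_of_forall fun z => ⟨by simp [T.base_zero], T.code_zero _ _⟩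
  rw [cellMass, this, probReal_univ]

lemma mem_tower_iff {n : ℕ} {y z : Y} :
    (T.age n z = T.age n y ∧ T.code n (T.root n z) = T.code n (T.root n y)) ↔
      -(T.age n y : ℤ) +ᵥ z ∈ T.base n ∧
        T.code n (-(T.age n y : ℤ) +ᵥ z) = T.code n (T.root n y) := by
  constructor
  · rintro ⟨ha, hc⟩
    rw [← ha]
    exact ⟨T.root_mem n z, by rw [← hc]; rfl⟩
  · rintro ⟨hb, hc⟩
    have h := T.age_vadd_of_code_eq hb hc
    rw [vadd_vadd, add_neg_cancel, zero_vadd] at h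
    refine ⟨h, ?_⟩
    rw [root, h, hc]

/-- All levels of a tower have the measure of its base. -/
lemma measureReal_tower [VAddInvariantMeasure ℤ Y ν] (n : ℕ) (y : Y) :
    ν.real {z | T.age n z = T.age n y ∧ T.code n (T.root n z) = T.code n (T.root n y)} =
      T.cellMass n (T.code n (T.root n y)) := by
  have : {z | T.age n z = T.age n y ∧ T.code n (T.root n z) = T.code n (T.root n y)} =
      (fun z => -(T.age n y : ℤ) +ᵥ z) ⁻¹'
        {z | z ∈ T.base n ∧ T.code n z = T.code n (T.root n y)} :=
    Set.ext fun z => T.mem_tower_iff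
  rw [this, measureReal_def, measure_preimage_vadd]
  rfl

lemma measureReal_edge [VAddInvariantMeasure ℤ Y ν] {n : ℕ} {y : Y} (hy : y ∈ T.base n) :
    ν.real {z | z ∈ T.base n ∧ T.edgeData n z = T.edgeData n y} =
      T.cellMass (n + 1) (T.edgeData n y).1 := by
  rw [edgeData, ← measureReal_tower]
  congr 1
  ext z
  refine ⟨fun h => T.edgeData_eq_iff.1 h.2, fun h => ⟨?_, T.edgeData_eq_iff.2 h⟩⟩
  have := (T.age_code_of_succ h.1 h.2).1
  rw [T.age_of_mem hy] at this
  have hr := T.root_mem n z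
  rwa [root, this, Nat.cast_zero, neg_zero, zero_vadd] at hr

variable [MeasurableConstVAdd ℤ Y]

lemma measurable_age (n : ℕ) : Measurable (T.age n) := by
  classical
  exact measurable_find (T.exists_base n) fun k =>
    measurable_const_vadd (-(k : ℤ)) (T.measurableSet_base n)

lemma measurable_root (n : ℕ) : Measurable (T.root n) := by
  have : Measurable fun p : ℕ × Y => -(p.1 : ℤ) +ᵥ p.2 :=
    measurable_from_prod_countable_right fun k => measurable_const_vadd (-(k : ℤ))
  exact this.comp ((T.measurable_age n).prodMk measurable_id)

lemma measurable_edgeData (n : ℕ) : Measurable (T.edgeData n) :=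
  ((T.measurable_code _).comp (T.measurable_root _)).prodMk (T.measurable_age _)

lemma sum_cellMass [VAddInvariantMeasure ℤ Y ν] [IsProbabilityMeasure ν] (n : ℕ)
    [Fintype (T.Edge n)] (v : T.Vertex n)
    [DecidablePred fun e => T.source n e = v] :
    ∑ e ∈ Finset.univ.filter (fun e => T.source n e = v), T.cellMass (n + 1) (T.range n e).1 =
      T.cellMass n v.1 := by
  have h1 : ∀ e : T.Edge n, T.cellMass (n + 1) (T.range n e).1 =
      ν.real {z | z ∈ T.base n ∧ T.edgeData n z = e.1} := by
    rintro ⟨_, y, hy, rfl⟩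
    exact (T.measureReal_edge hy).symm
  rw [Finset.sum_congr rfl fun e _ => h1 e, ← measureReal_biUnion_finset, cellMass]
  · congr 1
    ext z
    simp only [Finset.mem_filter, Finset.mem_univ, true_and, Set.mem_iUnion, Set.mem_ofPred_eq,
      exists_prop]
    constructor
    · rintro ⟨⟨_, y, hy, rfl⟩, rfl, hz, he⟩
      refine ⟨hz, ?_⟩
      rw [T.code_eq_of_edgeData_eq hz hy he]
      exact congrArg Subtype.val (T.source_edgeOf hy).symm
    · rintro ⟨hz, hc⟩
      exact ⟨T.edgeOf n z hz, (T.source_edgeOf hz).trans (Subtype.ext hc), hz, rfl⟩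
  · intro e _ e' _ hne
    refine Set.disjoint_left.2 fun z h h' => hne (Subtype.ext (h.2.symm.trans h'.2))
  · intro e _
    exact (T.measurableSet_base n).inter (T.measurable_edgeData n (measurableSet_singleton _))

/-- The proportion of a stage `n` tower that is occupied by a passage of a stage `n + 1` tower. -/
def edgeWeight (n : ℕ) (e : T.Edge n) : ℝ :=
  T.cellMass (n + 1) (T.range n e).1 / T.cellMass n (T.source n e).1

variable [Nonempty Y] [IsProbabilityMeasure ν]

open BratteliDiagram FullyOrderedBratteli

omit [MeasurableConstVAdd ℤ Y] in
lemma pathWeight_edgeWeight (W : ℝ) (ξ : T.diagram.PathSpace) (n : ℕ) :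
    pathWeight (B := T.diagram.toBratteliDiagram) (fun _ => W) T.edgeWeight ξ n =
      W * T.cellMass n (T.source n (ξ.edge n)).1 := by
  induction n with
  | zero => simp [pathWeight, T.cellMass_zero]
  | succ n ih =>
    have h : T.range n (ξ.edge n) = T.source (n + 1) (ξ.edge (n + 1)) := ξ.2 n
    have h' : pathWeight (B := T.diagram.toBratteliDiagram) (fun _ => W) T.edgeWeight ξ (n + 1) =
        pathWeight (B := T.diagram.toBratteliDiagram) (fun _ => W) T.edgeWeight ξ n *
          T.edgeWeight n (ξ.edge n) := by
      simp only [pathWeight, Finset.prod_range_succ, mul_assoc]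
    have := (T.cellMass_pos (T.source n (ξ.edge n))).ne'
    rw [h', ih, ← h]
    unfold edgeWeight
    field_simp

variable [VAddInvariantMeasure ℤ Y ν]

/-- The weight function of the diagram of the towers, of total mass `W`. -/
def weight (W : ℝ) (hW : 0 < W) : T.diagram.WeightFunction where
  wV _ := W
  wE := T.edgeWeight
  wV_pos _ := hW
  wE_pos n e := div_pos (T.cellMass_pos _) (T.cellMass_pos _)
  weight_eq n ξ η h := by
    have h : T.range n (ξ.edge n) = T.range n (η.edge n) := h
    have h1 : T.range n (ξ.edge n) = T.source (n + 1) (ξ.edge (n + 1)) := ξ.2 n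
    have h2 : T.range n (η.edge n) = T.source (n + 1) (η.edge (n + 1)) := η.2 n
    refine (T.pathWeight_edgeWeight W ξ (n + 1)).trans
      (Eq.trans ?_ (T.pathWeight_edgeWeight W η (n + 1)).symm)
    rw [← h1, ← h2, h]
  sum_eq_one n v := by
    classical
    have h := @sum_cellMass Y _ _ ν T _ _ _ n (T.diagram.fintypeE n) v
      (fun _ => Classical.propDecidable _)
    have h' := (Finset.sum_div _ _ _).symm.trans ((congrArg (· / T.cellMass n v.1) h).trans
      (div_self (T.cellMass_pos v).ne'))
    refine Eq.trans (Finset.sum_congr rfl fun e he => ?_) h'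
    have he : T.source n e = v := (Finset.mem_filter.1 he).2
    unfold edgeWeight
    rw [he]
  tendsto_zero ξ _ := by
    refine squeeze_zero (g := fun n : ℕ => W * (1 / ((n : ℝ) + 1))) (fun n => ?_) (fun n => ?_) ?_
    · exact (mul_nonneg hW.le (T.cellMass_pos _).le).trans_eq (T.pathWeight_edgeWeight W ξ n).symm
    · exact (T.pathWeight_edgeWeight W ξ n).trans_le
        (mul_le_mul_of_nonneg_left (T.cellMass_le _ _) hW.le)
    · simpa using tendsto_one_div_add_atTop_nhds_zero_nat.const_mul W

lemma pathWeight_eq (W : ℝ) (hW : 0 < W) (ξ : T.diagram.PathSpace) (n : ℕ) :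
    pathWeight (T.weight W hW).wV (T.weight W hW).wE ξ n =
      W * T.cellMass n (T.source n (ξ.edge n)).1 := T.pathWeight_edgeWeight W ξ n

/-! ### The adic coding of the points -/

/-- The path that records the passages of a point through the towers. -/
def path (y : Y) : T.diagram.PathSpace :=
  ⟨fun n => T.edgeOf n (T.root n y) (T.root_mem n y), fun n => by
    refine (T.range_edgeOf _).trans (Eq.trans ?_ (T.source_edgeOf _).symm)
    exact Subtype.ext (congrArg (T.code (n + 1)) (T.root_succ_root n y))⟩

end RefiningTowers

namespace RefiningTowers

open BratteliDiagram FullyOrderedBratteli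

variable {Y : Type*} [MeasurableSpace Y] [AddAction ℤ Y] {ν : Measure Y} (T : RefiningTowers Y ν)

/-- The passage recorded by an edge occurs in all towers with the stage `n + 1` code of its
range. -/
lemma passage {n : ℕ} {y b : Y} (hb : b ∈ T.base n)
    (hc : T.code (n + 1) (T.root (n + 1) b) = T.code (n + 1) (T.root (n + 1) y)) :
    (T.age (n + 1) b : ℤ) +ᵥ T.root (n + 1) y ∈ T.base n ∧
      ∀ j : ℕ, 0 < j → j ≤ T.age (n + 1) b → (j : ℤ) +ᵥ T.root (n + 1) y ∉ T.base (n + 1) := by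
  have hlt := T.age_lt_gap (n + 1) b
  refine ⟨?_, fun j hj hle hmem => ?_⟩
  · have := (T.code_spec n _ _ hc _ hlt).2.1
    rw [T.age_vadd_root] at this
    exact this.1 hb
  · have h := (T.code_spec n _ _ hc j (by omega)).2.2.1.2 hmem
    obtain ⟨i, hi⟩ := Nat.exists_eq_add_of_le hle
    have h2 := T.sub_age_vadd_root (n := n + 1) (y := b) (k := i) (by omega)
    rw [show T.age (n + 1) b - i = j by omega] at h2
    rw [h2] at h
    have := T.age_le h
    omega

/-- A passage that starts below or at `y`, in the stage `n + 1` tower of `y`, starts below or at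
`root n y`. -/
lemma passage_le {n : ℕ} {y b : Y} (hb : b ∈ T.base n)
    (hc : T.code (n + 1) (T.root (n + 1) b) = T.code (n + 1) (T.root (n + 1) y))
    (hle : T.age (n + 1) b ≤ T.age (n + 1) y) :
    T.age (n + 1) b ≤ T.age (n + 1) (T.root n y) := by
  have h := (T.passage hb hc).1
  obtain ⟨i, hi⟩ := Nat.exists_eq_add_of_le hle
  have h2 := T.sub_age_vadd_root (n := n + 1) (y := y) (k := i) (by omega)
  rw [show T.age (n + 1) y - i = T.age (n + 1) b by omega] at h2
  rw [h2] at h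
  have := T.age_le h
  have := T.age_succ_root n y
  omega

lemma age_root_one_vadd {n : ℕ} {y : Y} (h : (1 : ℤ) +ᵥ y ∉ T.base n) :
    T.age n ((1 : ℤ) +ᵥ y) = T.age n y + 1 ∧ T.root n ((1 : ℤ) +ᵥ y) = T.root n y := by
  have e : ∀ j : ℕ, -((j + 1 : ℕ) : ℤ) +ᵥ (1 : ℤ) +ᵥ y = -(j : ℤ) +ᵥ y := fun j => by
    rw [vadd_vadd]
    congr 1
    push_cast; ring
  have ha : T.age n ((1 : ℤ) +ᵥ y) = T.age n y + 1 := by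
    refine T.age_eq (by rw [e]; exact T.root_mem n y) fun j hj => ?_
    cases j with
    | zero => simpa using h
    | succ j =>
      rw [e]
      intro hmem
      have := T.age_le hmem
      omega
  refine ⟨ha, ?_⟩
  rw [root, ha, e]
  rfl

variable [Nonempty Y]

lemma path_edge_eq_iff {n : ℕ} {y z : Y} : (T.path z).edge n = (T.path y).edge n ↔
    T.edgeData n (T.root n z) = T.edgeData n (T.root n y) := by
  constructor
  · exact fun h => congrArg Subtype.val h
  · exact fun h => Subtype.ext h

/-- The first `n` edges of the path of a point record its stage `n` tower and its height there. -/
lemma path_agree_iff {n : ℕ} {y z : Y} : (∀ k < n, (T.path z).edge k = (T.path y).edge k) ↔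
    T.age n z = T.age n y ∧ T.code n (T.root n z) = T.code n (T.root n y) := by
  induction n with
  | zero =>
    have h0 : ∀ z, T.age 0 z = 0 := fun z => T.age_of_mem (by simp [T.base_zero])
    simp [h0, T.code_zero (T.root 0 z) (T.root 0 y)]
  | succ n ih =>
    have : (∀ k < n + 1, (T.path z).edge k = (T.path y).edge k) ↔
        (∀ k < n, (T.path z).edge k = (T.path y).edge k) ∧
          (T.path z).edge n = (T.path y).edge n := by
      constructor
      · exact fun h => ⟨fun k hk => h k (by omega), h n (by omega)⟩
      · rintro ⟨h, h'⟩ k hk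
        rcases Nat.lt_succ_iff_lt_or_eq.1 hk with hk | rfl
        exacts [h k hk, h']
    rw [this, ih, path_edge_eq_iff, edgeData_eq_iff, T.root_succ_root, T.root_succ_root]
    constructor
    · rintro ⟨⟨h1, h2⟩, h3, h4⟩
      exact ⟨by rw [T.age_succ_root n z, T.age_succ_root n y, h1, h3], h4⟩
    · rintro ⟨h1, h2⟩
      have h := T.age_code_of_succ h1 h2
      refine ⟨h, ?_, h2⟩
      have e1 := T.age_succ_root n z
      have e2 := T.age_succ_root n y
      omega

lemma path_injective : Function.Injective T.path := by
  intro y z h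
  have key : ∀ n, T.age n y = T.age n z ∧ T.code n (T.root n y) = T.code n (T.root n z) :=
    fun n => T.path_agree_iff.1 fun k _ => by rw [h]
  refine T.separates y z fun n => ?_
  obtain ⟨ha, hc⟩ := key (n + 1)
  have := (T.code_spec n _ _ hc _ (T.age_lt_gap (n + 1) y)).2.2.2
  rwa [T.age_vadd_root, ha, T.age_vadd_root] at this

lemma source_path (n : ℕ) (y : Y) :
    T.source n ((T.path y).edge n) = T.vertexOf n (T.root n y) (T.root_mem n y) :=
  T.source_edgeOf _

/-! ### The successor of a path is the path of the image point -/

lemma isMaxEdge_path {n : ℕ} {y : Y} (h : (1 : ℤ) +ᵥ y ∈ T.base (n + 1)) :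
    T.diagram.IsMaxEdge n ((T.path y).edge n) := by
  rintro ⟨_, b, hb, rfl⟩ ⟨h1, h2⟩
  have h1 : T.code (n + 1) (T.root (n + 1) (T.root n y)) = T.code (n + 1) (T.root (n + 1) b) := h1
  have h2 : T.age (n + 1) (T.root n y) ≤ T.age (n + 1) b := h2
  rw [T.root_succ_root] at h1
  refine Subtype.ext (T.edgeData_eq_iff.2 ⟨le_antisymm ?_ h2, ?_⟩)
  · refine T.passage_le hb h1.symm (not_lt.1 fun hlt => ?_)
    refine (T.passage hb h1.symm).2 (T.age (n + 1) y + 1) (Nat.succ_pos _) hlt ?_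
    convert h using 1
    rw [root, vadd_vadd]
    congr 1
    push_cast; ring
  · rw [T.root_succ_root]; exact h1.symm

lemma isMinEdge_path {n : ℕ} {y : Y} (h : y ∈ T.base (n + 1)) :
    T.diagram.IsMinEdge n ((T.path y).edge n) := by
  rintro ⟨_, b, hb, rfl⟩ ⟨h1, h2⟩
  have h1 : T.code (n + 1) (T.root (n + 1) b) = T.code (n + 1) (T.root (n + 1) (T.root n y)) := h1
  have h2 : T.age (n + 1) b ≤ T.age (n + 1) (T.root n y) := h2
  have h3 : T.age (n + 1) (T.root n y) = 0 := by
    rw [T.root_of_mem (T.base_succ_subset n h), T.age_of_mem h]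
  exact Subtype.ext (T.edgeData_eq_iff.2 ⟨by omega, h1⟩)

/-- The coding `path` conjugates the bijection to the adic transformation: passages of the stage
`n + 1` towers through stage `n` towers are ordered by height, and `1 +ᵥ y` starts the passage that
follows the one of `y`, where `n` is the last stage with `1 +ᵥ y` in its base. -/
lemma exists_isSuccessorAt (y : Y) :
    ∃ n, T.diagram.IsSuccessorAt n (T.path y) (T.path ((1 : ℤ) +ᵥ y)) := by
  classical
  -- `n + 1` is the first stage whose base does not contain the image point
  obtain ⟨n, hn, hmin⟩ : ∃ n, (1 : ℤ) +ᵥ y ∉ T.base (n + 1) ∧ (1 : ℤ) +ᵥ y ∈ T.base n := by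
    have h := T.escapes ((1 : ℤ) +ᵥ y)
    have h0 : Nat.find h ≠ 0 := fun h0 => by
      have := Nat.find_spec h
      rw [h0, T.base_zero] at this
      exact this (Set.mem_univ _)
    obtain ⟨m, hm⟩ := Nat.exists_eq_succ_of_ne_zero h0
    exact ⟨m, by rw [← Nat.succ_eq_add_one, ← hm]; exact Nat.find_spec h,
      not_not.1 (Nat.find_min h (by omega))⟩
  refine ⟨n, fun k hk => ⟨T.isMaxEdge_path (T.base_anti hk hmin),
    T.isMinEdge_path (T.base_anti hk hmin)⟩, ?_, fun k hk => ?_⟩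
  · obtain ⟨ha, hr⟩ := T.age_root_one_vadd hn
    have hroot : T.root n ((1 : ℤ) +ᵥ y) = (1 : ℤ) +ᵥ y := T.root_of_mem hmin
    have hlt : T.age (n + 1) (T.root n y) < T.age (n + 1) (T.root n ((1 : ℤ) +ᵥ y)) := by
      rw [hroot, ha, T.age_succ_root n y]
      omega
    have hcode : T.code (n + 1) (T.root (n + 1) (T.root n y)) =
        T.code (n + 1) (T.root (n + 1) (T.root n ((1 : ℤ) +ᵥ y))) := by
      rw [T.root_succ_root, T.root_succ_root, hr]
    refine ⟨⟨hcode, hlt.le⟩, fun h => hlt.ne ?_, ?_⟩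
    · exact congrArg (fun e : T.Edge n => e.1.2) h
    · rintro ⟨_, b, hb, rfl⟩ ⟨h1, h2⟩ ⟨_, h4⟩
      have h1 : T.code (n + 1) (T.root (n + 1) (T.root n y)) =
        T.code (n + 1) (T.root (n + 1) b) := h1
      have h2 : T.age (n + 1) (T.root n y) ≤ T.age (n + 1) b := h2
      have h4 : T.age (n + 1) b ≤ T.age (n + 1) (T.root n ((1 : ℤ) +ᵥ y)) := h4
      rcases h4.lt_or_eq with h4 | h4
      · left
        refine Subtype.ext (T.edgeData_eq_iff.2 ⟨le_antisymm ?_ h2, h1.symm⟩)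
        rw [T.root_succ_root] at h1
        refine T.passage_le hb h1.symm ?_
        rw [hroot, ha] at h4
        omega
      · exact Or.inr (Subtype.ext (T.edgeData_eq_iff.2 ⟨h4, h1.symm.trans hcode⟩))
  · refine (T.path_edge_eq_iff (z := y) (y := (1 : ℤ) +ᵥ y)).2 ?_
    rw [(T.age_root_one_vadd fun h => hn (T.base_anti hk h)).2]

/-! ### The distribution of the points of the interval -/

variable [MeasurableConstVAdd ℤ Y]

lemma measurable_comp_path_edge (n : ℕ) (g : T.diagram.E n → ℝ) :
    Measurable fun y => g ((T.path y).edge n) := by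
  classical
  let f : ℕ × ℕ → ℝ := fun p => if h : ∃ y ∈ T.base n, T.edgeData n y = p then g ⟨p, h⟩ else 0
  have : (fun y => g ((T.path y).edge n)) = f ∘ T.edgeData n ∘ T.root n := by
    funext y
    have h : ∃ z ∈ T.base n, T.edgeData n z = T.edgeData n (T.root n y) :=
      ⟨_, T.root_mem n y, rfl⟩
    simp only [f, Function.comp_apply, dif_pos h]
    rfl
  rw [this]
  exact (measurable_of_countable f).comp ((T.measurable_edgeData n).comp (T.measurable_root n))

variable [VAddInvariantMeasure ℤ Y ν] [IsProbabilityMeasure ν] {W : ℝ} (hW : 0 < W)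

/-- The point of the interval `(0, W)` that corresponds to a point of `Y`. -/
def toInterval (y : Y) : ℝ := T.diagram.position (T.weight W hW) (T.path y)

lemma vertexLeft_eq_zero (v : T.diagram.V 0) : T.diagram.vertexLeft (T.weight W hW) v = 0 := by
  unfold vertexLeft
  refine Finset.sum_eq_zero fun u hu => ?_
  rw [Subsingleton.elim u v] at hu
  simp at hu

lemma measurable_pathWeight (n : ℕ) :
    Measurable fun y => pathWeight (T.weight W hW).wV (T.weight W hW).wE (T.path y) n := by
  unfold pathWeight
  exact (T.measurable_comp_path_edge 0 fun e => (T.weight W hW).wV (T.diagram.src 0 e)).mul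
    (Finset.measurable_fun_prod _ fun k _ => T.measurable_comp_path_edge k ((T.weight W hW).wE k))

lemma measurable_levelLeft (n : ℕ) :
    Measurable fun y => T.diagram.levelLeft (T.weight W hW) (T.path y) n := by
  unfold levelLeft
  simp only [vertexLeft_eq_zero, zero_add]
  exact Finset.measurable_fun_sum _ fun k _ => (T.measurable_pathWeight hW k).mul
    (T.measurable_comp_path_edge k (T.diagram.edgeOffset (T.weight W hW) k))

lemma measurable_toInterval : Measurable (T.toInterval hW) :=
  Measurable.iSup fun n => T.measurable_levelLeft hW n

lemma measureReal_cylinder (n : ℕ) (y : Y) :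
    W * ν.real {z | ∀ k < n, (T.path z).edge k = (T.path y).edge k} =
      pathWeight (T.weight W hW).wV (T.weight W hW).wE (T.path y) n := by
  simp only [path_agree_iff]
  rw [measureReal_tower, pathWeight_eq, source_path]
  rfl

lemma pathWeight_le (n : ℕ) (y : Y) :
    pathWeight (T.weight W hW).wV (T.weight W hW).wE (T.path y) n ≤ W / (n + 1) := by
  rw [pathWeight_eq, div_eq_mul_one_div]
  exact mul_le_mul_of_nonneg_left (T.cellMass_le _ _) hW.le

lemma measurableSet_isInterior :
    MeasurableSet {y | T.diagram.IsInterior (T.weight W hW) (T.path y)} := by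
  unfold IsInterior
  simp only [Set.ofPred_forall]
  refine MeasurableSet.iInter fun n => ?_
  exact (measurableSet_lt (T.measurable_levelLeft hW n) (T.measurable_toInterval hW)).inter
    (measurableSet_lt (T.measurable_toInterval hW)
      ((T.measurable_levelLeft hW n).add (T.measurable_pathWeight hW n)))

end RefiningTowers

namespace RefiningTowers

open BratteliDiagram FullyOrderedBratteli

variable {Y : Type*} [MeasurableSpace Y] [AddAction ℤ Y] {ν : Measure Y} (T : RefiningTowers Y ν)
  [Nonempty Y] [MeasurableConstVAdd ℤ Y] [VAddInvariantMeasure ℤ Y ν] [IsProbabilityMeasure ν]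
  {W : ℝ} (hW : 0 < W)

lemma level_zero (ξ : T.diagram.PathSpace) :
    T.diagram.level (T.weight W hW) ξ 0 = Set.Ioo 0 W := by
  rw [level, levelLeft, T.vertexLeft_eq_zero hW]
  simp [pathWeight, weight]

lemma abs_toInterval_sub_le {n : ℕ} {y : Y} {x : ℝ}
    (hx : x ∈ T.diagram.level (T.weight W hW) (T.path y) n) :
    |T.toInterval hW y - x| ≤ W / (n + 1) := by
  have h1 := levelLeft_le_position (w := T.weight W hW) (T.path y) n
  have h2 := position_le_levelRight (w := T.weight W hW) (T.path y) n
  have h3 := T.pathWeight_le hW n y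
  unfold levelRight at h2
  rw [abs_le]
  unfold toInterval
  constructor <;> linarith [hx.1, hx.2]

/-- The finitely many stage `n` levels exhaust the interval, each has the measure of the
corresponding set of points of `Y`, and these points are mapped close to the level. -/
lemma volume_le_measure_near (n : ℕ) (G : Set ℝ) :
    (volume.restrict (Set.Ioo 0 W)).real G ≤
      W * ν.real {y | ∃ x ∈ G, |T.toInterval hW y - x| ≤ W / (n + 1)} := by
  classical
  let tr : Y → ∀ k : Fin n, T.diagram.E k := fun y k => (T.path y).edge k
  have htr : ∀ y z, tr z = tr y ↔ ∀ k < n, (T.path z).edge k = (T.path y).edge k := fun y z =>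
    ⟨fun h k hk => congrFun h ⟨k, hk⟩, fun h => funext fun k => h k k.2⟩
  let Q := Set.range tr
  let _ : Fintype Q := Fintype.ofFinite Q
  let rep : Q → Y := fun q => q.2.choose
  have hrep : ∀ q : Q, tr (rep q) = q := fun q => q.2.choose_spec
  let c : Q → Set Y := fun q => {z | tr z = q}
  let I : Q → Set ℝ := fun q => T.diagram.level (T.weight W hW) (T.path (rep q)) n
  have hc : ∀ q, c q = {z | ∀ k < n, (T.path z).edge k = (T.path (rep q)).edge k} := fun q =>
    Set.ext fun z => by
      change tr z = q ↔ _
      rw [← hrep q]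
      exact htr _ _
  have hcm : ∀ q, MeasurableSet (c q) := fun q => by
    rw [hc]
    simp only [path_agree_iff]
    exact (T.measurable_age n (measurableSet_singleton _)).inter
      (((T.measurable_code n).comp (T.measurable_root n)) (measurableSet_singleton _))
  have hcd : Pairwise (Function.onFun Disjoint c) := fun q q' hne =>
    Set.disjoint_left.2 fun z h h' => hne (Subtype.ext ((h : tr z = q).symm.trans h'))
  have hId : Pairwise (Function.onFun Disjoint I) := fun q q' hne =>
    Set.disjoint_left.2 fun x h h' => hne (Subtype.ext (by
      rw [← hrep q, ← hrep q']
      exact (htr _ _).2 (edge_eq_of_mem_level h h')))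
  have hIsub : ∀ q, I q ⊆ Set.Ioo 0 W := fun q => by
    rw [← T.level_zero hW (T.path (rep q))]
    exact level_anti _ n.zero_le
  have hIm : ∀ q, MeasurableSet (I q) := fun q => measurableSet_Ioo
  have hI : ∀ q, (volume.restrict (Set.Ioo 0 W)).real (I q) = W * ν.real (c q) := fun q => by
    rw [measureReal_restrict_apply (hIm q), Set.inter_eq_left.2 (hIsub q), hc,
      T.measureReal_cylinder hW n (rep q)]
    simp only [I, level, Real.volume_real_Ioo, add_sub_cancel_left]
    exact max_eq_left (pathWeight_pos _ _).le
  have hunion : ∀ F : Finset Q, (volume.restrict (Set.Ioo 0 W)).real (⋃ q ∈ F, I q) =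
      W * ν.real (⋃ q ∈ F, c q) := fun F => by
    rw [measureReal_biUnion_finset (fun q _ q' _ h => hId h) fun q _ => hIm q,
      measureReal_biUnion_finset (fun q _ q' _ h => hcd h) fun q _ => hcm q, Finset.mul_sum]
    exact Finset.sum_congr rfl fun q _ => hI q
  have hmI : ∀ F : Finset Q, MeasurableSet (⋃ q ∈ F, I q) := fun F =>
    Finset.measurableSet_biUnion F fun q _ => hIm q
  -- the levels exhaust the interval up to a null set
  have hnull : (volume.restrict (Set.Ioo 0 W)).real (⋃ q ∈ (Finset.univ : Finset Q), I q)ᶜ = 0 := by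
    rw [measureReal_compl (hmI _), hunion]
    have : (⋃ q ∈ (Finset.univ : Finset Q), c q) = Set.univ :=
      Set.eq_univ_of_forall fun z =>
        Set.mem_biUnion (Finset.mem_univ (⟨tr z, z, rfl⟩ : Q)) (rfl : tr z = tr z)
    rw [this, probReal_univ (μ := ν), measureReal_restrict_apply MeasurableSet.univ,
      Set.univ_inter, Real.volume_real_Ioo, sub_zero, max_eq_left hW.le]
    ring
  let F : Finset Q := Finset.univ.filter fun q => (I q ∩ G).Nonempty
  have hsub : G ⊆ (⋃ q ∈ F, I q) ∪ (⋃ q ∈ (Finset.univ : Finset Q), I q)ᶜ := by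
    intro x hx
    by_cases h : x ∈ ⋃ q ∈ (Finset.univ : Finset Q), I q
    · left
      obtain ⟨q, _, hq⟩ := Set.mem_iUnion₂.1 h
      exact Set.mem_biUnion (Finset.mem_filter.2 ⟨Finset.mem_univ q, x, hq, hx⟩) hq
    · exact Or.inr h
  calc (volume.restrict (Set.Ioo 0 W)).real G
      ≤ (volume.restrict (Set.Ioo 0 W)).real (⋃ q ∈ F, I q) + 0 := by
        exact ((measureReal_mono hsub).trans (measureReal_union_le _ _)).trans_eq
          (congrArg _ hnull)
    _ = W * ν.real (⋃ q ∈ F, c q) := by rw [add_zero, hunion]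
    _ ≤ _ := by
        refine mul_le_mul_of_nonneg_left (measureReal_mono ?_) hW.le
        intro z hz
        obtain ⟨q, hq, hz⟩ := Set.mem_iUnion₂.1 hz
        obtain ⟨x, hxI, hxG⟩ := (Finset.mem_filter.1 hq).2
        refine ⟨x, hxG, T.abs_toInterval_sub_le hW ?_⟩
        have hz : ∀ k < n, (T.path z).edge k = (T.path (rep q)).edge k :=
          (htr _ _).1 ((hz : tr z = q).trans (hrep q).symm)
        simp only [I, level] at hxI ⊢
        rwa [levelLeft_congr hz, pathWeight_congr hz]

/-- The distribution is uniform: a half-line and its complement have at least the mass that uniformity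
predicts, by `volume_le_measure_near` for slightly smaller half-lines, and the total masses agree. -/
lemma map_toInterval :
    ν.map (T.toInterval hW) = ENNReal.ofReal W⁻¹ • volume.restrict (Set.Ioo 0 W) := by
  have hm := T.measurable_toInterval hW
  have hδ : Tendsto (fun n : ℕ => W / ((n : ℝ) + 1)) atTop (𝓝 0) := by
    simpa [div_eq_mul_one_div W] using tendsto_one_div_add_atTop_nhds_zero_nat.const_mul W
  have hsplit : ∀ a b : ℝ, (volume.restrict (Set.Ioo 0 W)).real (Set.Icc a b) ≤ max (b - a) 0 :=
    fun a b => by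
      rw [← Real.volume_real_Icc, measureReal_restrict_apply measurableSet_Icc]
      exact measureReal_mono Set.inter_subset_left measure_Icc_lt_top.ne
  have hle : ∀ a, (volume.restrict (Set.Ioo 0 W)).real (Set.Iic a) ≤
      W * ν.real (T.toInterval hW ⁻¹' Set.Iic a) := by
    intro a
    have : Tendsto (fun n : ℕ => W * ν.real (T.toInterval hW ⁻¹' Set.Iic a) + W / ((n : ℝ) + 1))
        atTop (𝓝 (W * ν.real (T.toInterval hW ⁻¹' Set.Iic a) + 0)) := hδ.const_add _
    rw [add_zero] at this
    refine ge_of_tendsto' this fun n => ?_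
    have hpos : 0 < W / ((n : ℝ) + 1) := by positivity
    have h1 := T.volume_le_measure_near hW n (Set.Iic (a - W / ((n : ℝ) + 1)))
    have h2 : ν.real {y | ∃ x ∈ Set.Iic (a - W / ((n : ℝ) + 1)),
        |T.toInterval hW y - x| ≤ W / (n + 1)} ≤ ν.real (T.toInterval hW ⁻¹' Set.Iic a) := by
      refine measureReal_mono ?_
      rintro y ⟨x, hx, hy⟩
      have hx : x ≤ a - W / ((n : ℝ) + 1) := hx
      change T.toInterval hW y ≤ a
      linarith [(abs_le.1 hy).2]
    have h3 : (volume.restrict (Set.Ioo 0 W)).real (Set.Iic a) ≤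
        (volume.restrict (Set.Ioo 0 W)).real (Set.Iic (a - W / ((n : ℝ) + 1))) +
        (volume.restrict (Set.Ioo 0 W)).real (Set.Icc (a - W / ((n : ℝ) + 1)) a) := by
      refine (measureReal_mono ?_).trans (measureReal_union_le _ _)
      intro x hx
      rcases le_total x (a - W / ((n : ℝ) + 1)) with h | h
      · exact Or.inl h
      · exact Or.inr ⟨h, hx⟩
    have h4 := hsplit (a - W / ((n : ℝ) + 1)) a
    rw [sub_sub_cancel, max_eq_left hpos.le] at h4
    have h5 := mul_le_mul_of_nonneg_left h2 hW.le
    linarith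
  have hge : ∀ a, (volume.restrict (Set.Ioo 0 W)).real (Set.Iic a)ᶜ ≤
      W * ν.real (T.toInterval hW ⁻¹' Set.Iic a)ᶜ := by
    intro a
    have : Tendsto (fun n : ℕ => W * ν.real (T.toInterval hW ⁻¹' Set.Iic a)ᶜ +
        2 * (W / ((n : ℝ) + 1)))
        atTop (𝓝 (W * ν.real (T.toInterval hW ⁻¹' Set.Iic a)ᶜ + 2 * 0)) :=
      (hδ.const_mul 2).const_add _
    rw [mul_zero, add_zero] at this
    refine ge_of_tendsto' this fun n => ?_
    have hpos : 0 < W / ((n : ℝ) + 1) := by positivity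
    have h1 := T.volume_le_measure_near hW n (Set.Ici (a + 2 * (W / ((n : ℝ) + 1))))
    have h2 : ν.real {y | ∃ x ∈ Set.Ici (a + 2 * (W / ((n : ℝ) + 1))),
        |T.toInterval hW y - x| ≤ W / (n + 1)} ≤ ν.real (T.toInterval hW ⁻¹' Set.Iic a)ᶜ := by
      refine measureReal_mono ?_
      rintro y ⟨x, hx, hy⟩
      have hx : a + 2 * (W / ((n : ℝ) + 1)) ≤ x := hx
      change ¬ T.toInterval hW y ≤ a
      linarith [(abs_le.1 hy).1]
    have h3 : (volume.restrict (Set.Ioo 0 W)).real (Set.Iic a)ᶜ ≤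
        (volume.restrict (Set.Ioo 0 W)).real (Set.Ici (a + 2 * (W / ((n : ℝ) + 1)))) +
        (volume.restrict (Set.Ioo 0 W)).real (Set.Icc a (a + 2 * (W / ((n : ℝ) + 1)))) := by
      refine (measureReal_mono ?_).trans (measureReal_union_le _ _)
      intro x hx
      rcases le_total (a + 2 * (W / ((n : ℝ) + 1))) x with h | h
      · exact Or.inl h
      · exact Or.inr ⟨(not_le.1 (show ¬ x ≤ a from hx)).le, h⟩
    have h4 := hsplit a (a + 2 * (W / ((n : ℝ) + 1)))
    rw [add_sub_cancel_left, max_eq_left (by positivity)] at h4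
    have h5 := mul_le_mul_of_nonneg_left h2 hW.le
    linarith
  have heq : ∀ a, (volume.restrict (Set.Ioo 0 W)).real (Set.Iic a) =
      W * ν.real (T.toInterval hW ⁻¹' Set.Iic a) := by
    intro a
    refine le_antisymm (hle a) ?_
    have h := hge a
    rw [measureReal_compl measurableSet_Iic, probReal_compl_eq_one_sub (hm measurableSet_Iic),
      measureReal_restrict_apply MeasurableSet.univ, Set.univ_inter,
      Real.volume_real_Ioo, sub_zero, max_eq_left hW.le] at h
    linarith
  refine Measure.ext_of_Iic _ _ fun a => ?_
  rw [Measure.map_apply hm measurableSet_Iic, Measure.smul_apply, smul_eq_mul,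
    ← ofReal_measureReal (μ := ν), ← ofReal_measureReal (μ := volume.restrict (Set.Ioo 0 W)),
    heq, ← ENNReal.ofReal_mul (by positivity), inv_mul_cancel_left₀ hW.ne']

omit [MeasurableConstVAdd ℤ Y] [VAddInvariantMeasure ℤ Y ν] [IsProbabilityMeasure ν] in
lemma finite_range_of_agree {n : ℕ} {f : Y → ℝ}
    (hf : ∀ y z, (∀ k < n, (T.path y).edge k = (T.path z).edge k) → f y = f z) :
    (Set.range f).Finite := by
  let tr : Y → ∀ k : Fin n, T.diagram.E k := fun y k => (T.path y).edge k
  refine (Set.finite_range fun q : Set.range tr => f q.2.choose).subset ?_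
  rintro _ ⟨y, rfl⟩
  have hy : tr y ∈ Set.range tr := ⟨y, rfl⟩
  exact ⟨⟨tr y, hy⟩, hf _ _ fun k hk => congrFun hy.choose_spec ⟨k, hk⟩⟩

/-- Almost every point of `Y` is mapped to an interior point of all levels of its path, because the
levels have countably many endpoints. -/
lemma ae_isInterior : ∀ᵐ y ∂ν, T.diagram.IsInterior (T.weight W hW) (T.path y) := by
  have hfin : ∀ s : Set ℝ, s.Finite → ∀ᵐ y ∂ν, T.toInterval hW y ∉ s := by
    intro s hs
    have h : ∀ᵐ x ∂ν.map (T.toInterval hW), x ∉ s := by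
      rw [map_toInterval]
      exact Measure.ae_smul_measure (ae_restrict_of_ae (measure_eq_zero_iff_ae_notMem.1
        (hs.measure_zero volume))) _
    exact ae_of_ae_map (T.measurable_toInterval hW).aemeasurable h
  have hL : ∀ᵐ y ∂ν, ∀ n, T.toInterval hW y ∉
      Set.range fun y => T.diagram.levelLeft (T.weight W hW) (T.path y) n :=
    ae_all_iff.2 fun n => hfin _ (T.finite_range_of_agree fun y z h => levelLeft_congr h)
  have hR : ∀ᵐ y ∂ν, ∀ n, T.toInterval hW y ∉
      Set.range fun y => T.diagram.levelRight (T.weight W hW) (T.path y) n :=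
    ae_all_iff.2 fun n => hfin _ (T.finite_range_of_agree (n := n) fun y z h => by
      rw [levelRight, levelRight, levelLeft_congr h, pathWeight_congr h])
  filter_upwards [hL, hR] with y hl hr n
  refine ⟨(levelLeft_le_position _ n).lt_of_ne fun h => hl n ⟨y, h⟩,
    (position_le_levelRight _ n).lt_of_ne fun h => hr n ⟨y, h.symm⟩⟩

end RefiningTowers

/-! ### Realization of a measure-preserving bijection by cutting and stacking -/

open FullyOrderedBratteli in
/-- A realization of the bijection `y ↦ 1 +ᵥ y` of a probability space as the cutting and stacking
map of a weighted, fully ordered diagram with one vertex of level `0` and weight `W`. On the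
invariant conull set `good`, the bijection corresponds to the map near interior points of exchanged
intervals. -/
structure IntervalModel (Y : Type*) [MeasurableSpace Y] [AddAction ℤ Y] (ν : Measure Y) (W : ℝ)
    where
  diagram : FullyOrderedBratteli
  weight : diagram.WeightFunction
  subsingleton : Subsingleton (diagram.V 0)
  weight_vertex : ∀ v, weight.wV v = W
  toInterval : Y → ℝ
  good : Set Y
  measurable_toInterval : Measurable toInterval
  measurableSet_good : MeasurableSet good
  ae_good : ∀ᵐ y ∂ν, y ∈ good
  vadd_mem : ∀ (k : ℤ), ∀ y ∈ good, k +ᵥ y ∈ good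
  injOn : Set.InjOn toInterval good
  mem_Ioo : ∀ y ∈ good, toInterval y ∈ Set.Ioo 0 W
  map_eq : ν.map toInterval = ENNReal.ofReal W⁻¹ • volume.restrict (Set.Ioo 0 W)
  exchanges : ∀ y ∈ good, diagram.Exchanges weight (toInterval y) (toInterval ((1 : ℤ) +ᵥ y))
  eq_of_left : ∀ y ∈ good, ∀ u, diagram.StackMap weight (toInterval y) u →
    u = toInterval ((1 : ℤ) +ᵥ y)
  eq_of_right : ∀ y ∈ good, ∀ u, diagram.StackMap weight u (toInterval y) →
    u = toInterval ((-1 : ℤ) +ᵥ y)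

namespace RefiningTowers

open BratteliDiagram FullyOrderedBratteli

variable {Y : Type*} [MeasurableSpace Y] [AddAction ℤ Y] {ν : Measure Y} (T : RefiningTowers Y ν)
  [Nonempty Y] [MeasurableConstVAdd ℤ Y] [VAddInvariantMeasure ℤ Y ν] [IsProbabilityMeasure ν]
  {W : ℝ} (hW : 0 < W)

/-- Refining towers yield a realization by cutting and stacking. -/
def intervalModel : IntervalModel Y ν W where
  diagram := T.diagram
  weight := T.weight W hW
  subsingleton := inferInstance
  weight_vertex _ := rfl
  toInterval := T.toInterval hW
  good := {y | ∀ k : ℤ, T.diagram.IsInterior (T.weight W hW) (T.path (k +ᵥ y))}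
  measurable_toInterval := T.measurable_toInterval hW
  measurableSet_good := by
    simp only [Set.ofPred_forall]
    exact MeasurableSet.iInter fun k => measurable_const_vadd k (T.measurableSet_isInterior hW)
  ae_good := ae_all_iff.2 fun k =>
    (measurePreserving_vadd k ν).quasiMeasurePreserving.ae (T.ae_isInterior hW)
  vadd_mem k y hy j := by rw [vadd_vadd]; exact hy (j + k)
  injOn y hy z hz h := T.path_injective <| IsInterior.ext (by simpa using hy 0)
    (by simpa using hz 0) h
  mem_Ioo y hy := by
    have h := hy 0 0
    rwa [zero_vadd, T.level_zero hW] at h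
  map_eq := T.map_toInterval hW
  exchanges y hy := by
    obtain ⟨n, hn⟩ := T.exists_isSuccessorAt y
    exact hn.exchanges (by simpa using hy 0)
  eq_of_left y hy u hu := by
    obtain ⟨n, hn⟩ := T.exists_isSuccessorAt y
    exact StackMap.eq_position_of_left hn (by simpa using hy 0) rfl hu
  eq_of_right y hy u hu := by
    obtain ⟨n, hn⟩ := T.exists_isSuccessorAt ((-1 : ℤ) +ᵥ y)
    rw [vadd_vadd, add_neg_cancel, zero_vadd] at hn
    exact StackMap.eq_position_of_right hn (by simpa using hy 0) rfl hu

end RefiningTowers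

/-! ### Restriction to an invariant conull set -/

section restriction

variable {G Y : Type*} [AddGroup G] [MeasurableSpace Y] [AddAction G Y] {ν : Measure Y}
  {p : SubAddAction G Y}

instance SubAddAction.measurableConstVAdd [MeasurableConstVAdd G Y] : MeasurableConstVAdd G p :=
  ⟨fun k => ((measurable_const_vadd k).comp measurable_subtype_coe).subtype_mk⟩

lemma SubAddAction.vaddInvariantMeasure_comap [MeasurableConstVAdd G Y]
    [VAddInvariantMeasure G Y ν] (hp : MeasurableSet (p : Set Y)) :
    VAddInvariantMeasure G p (ν.comap (↑)) := by
  have he : MeasurableEmbedding ((↑) : p → Y) := MeasurableEmbedding.subtype_coe hp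
  refine ⟨fun k s hs => ?_⟩
  rw [he.comap_apply, he.comap_apply, ← measure_preimage_vadd ν k (((↑) : p → Y) '' s)]
  congr 1
  ext y
  constructor
  · rintro ⟨z, hz, rfl⟩
    exact ⟨k +ᵥ z, hz, rfl⟩
  · rintro ⟨z, hz, hzy⟩
    have hzy : (z : Y) = k +ᵥ y := hzy
    refine ⟨-k +ᵥ z, ?_, ?_⟩
    · change k +ᵥ -k +ᵥ z ∈ s
      rwa [vadd_vadd, add_neg_cancel, zero_vadd]
    · rw [SubAddAction.val_vadd, hzy, vadd_vadd, neg_add_cancel, zero_vadd]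

lemma SubAddAction.map_comap_coe (hp : MeasurableSet (p : Set Y)) (hν : ∀ᵐ y ∂ν, y ∈ p) :
    (ν.comap ((↑) : p → Y)).map (↑) = ν := by
  have he : MeasurableEmbedding ((↑) : p → Y) := MeasurableEmbedding.subtype_coe hp
  rw [he.map_comap]
  refine Measure.restrict_eq_self_of_ae_mem ?_
  filter_upwards [hν] with y hy
  exact ⟨⟨y, hy⟩, rfl⟩

lemma SubAddAction.ae_of_ae_comap (hp : MeasurableSet (p : Set Y)) (hν : ∀ᵐ y ∂ν, y ∈ p)
    {s : Set Y} (h : ∀ᵐ y : p ∂ν.comap (↑), (y : Y) ∈ s) : ∀ᵐ y ∂ν, y ∈ s := by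
  have he : MeasurableEmbedding ((↑) : p → Y) := MeasurableEmbedding.subtype_coe hp
  rw [← SubAddAction.map_comap_coe hp hν, he.ae_map_iff]
  exact h

lemma SubAddAction.map_eq_map_comap (hp : MeasurableSet (p : Set Y)) (hν : ∀ᵐ y ∂ν, y ∈ p)
    {g : Y → ℝ} (hg : Measurable g) : ν.map g = (ν.comap ((↑) : p → Y)).map fun y : p => g y := by
  conv_lhs => rw [← SubAddAction.map_comap_coe hp hν]
  rw [Measure.map_map hg measurable_subtype_coe]
  rfl

end restriction

section restriction

variable {Y : Type*} [MeasurableSpace Y] [AddAction ℤ Y] {ν : Measure Y}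

/-- A realization on an invariant conull set is one on the whole space. -/
def IntervalModel.extend {p : SubAddAction ℤ Y} {W : ℝ} (hp : MeasurableSet (p : Set Y))
    (hν : ∀ᵐ y ∂ν, y ∈ p) (M : IntervalModel p (ν.comap (↑)) W) : IntervalModel Y ν W :=
  have he : MeasurableEmbedding ((↑) : p → Y) := MeasurableEmbedding.subtype_coe hp
  have hex := he.exists_measurable_extend M.measurable_toInterval fun _ => ⟨0⟩
  have hf : ∀ y : p, hex.choose y = M.toInterval y := fun y => congrFun hex.choose_spec.2 y
  { diagram := M.diagram
    weight := M.weight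
    subsingleton := M.subsingleton
    weight_vertex := M.weight_vertex
    toInterval := hex.choose
    good := (↑) '' M.good
    measurable_toInterval := hex.choose_spec.1
    measurableSet_good := he.measurableSet_image.2 M.measurableSet_good
    ae_good := by
      refine SubAddAction.ae_of_ae_comap hp hν ?_
      filter_upwards [M.ae_good] with y hy
      exact ⟨y, hy, rfl⟩
    vadd_mem := by
      rintro k _ ⟨y, hy, rfl⟩
      exact ⟨k +ᵥ y, M.vadd_mem k y hy, rfl⟩
    injOn := by
      rintro _ ⟨y, hy, rfl⟩ _ ⟨z, hz, rfl⟩ h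
      rw [hf, hf] at h
      rw [M.injOn hy hz h]
    mem_Ioo := by
      rintro _ ⟨y, hy, rfl⟩
      rw [hf]
      exact M.mem_Ioo y hy
    map_eq := by
      rw [← M.map_eq, SubAddAction.map_eq_map_comap hp hν hex.choose_spec.1]
      exact congrArg (Measure.map · _) (funext hf)
    exchanges := by
      rintro _ ⟨y, hy, rfl⟩
      rw [← SubAddAction.val_vadd, hf, hf]
      exact M.exchanges y hy
    eq_of_left := by
      rintro _ ⟨y, hy, rfl⟩
      rw [← SubAddAction.val_vadd, hf, hf]
      exact M.eq_of_left y hy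
    eq_of_right := by
      rintro _ ⟨y, hy, rfl⟩
      rw [← SubAddAction.val_vadd, hf, hf]
      exact M.eq_of_right y hy }

namespace TowerSystem

variable (T : TowerSystem Y ν)

/-- The points whose orbits meet no null tower and leave the bases. -/
def core : SubAddAction ℤ Y where
  carrier := {y | ∀ k : ℤ, (∀ n, k +ᵥ y ∈ T.base n →
    0 < ν {z | z ∈ T.base n ∧ T.code n z = T.code n (k +ᵥ y)}) ∧ ∃ n, k +ᵥ y ∉ T.base n}
  vadd_mem' k y hy j := by rw [vadd_vadd]; exact hy (j + k)

lemma measurableSet_core [MeasurableConstVAdd ℤ Y] : MeasurableSet (T.core : Set Y) := by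
  have : (T.core : Set Y) = ⋂ k : ℤ, (fun y => k +ᵥ y) ⁻¹'
      ((⋂ n, (T.base n)ᶜ ∪ T.code n ⁻¹' {v | 0 < ν {z | z ∈ T.base n ∧ T.code n z = v}}) ∩
        ⋃ n, (T.base n)ᶜ) := by
    ext y
    simp only [Set.mem_iInter, Set.mem_preimage, Set.mem_inter_iff, Set.mem_union, Set.mem_iUnion,
      Set.mem_compl_iff, ← imp_iff_not_or]
    rfl
  rw [this]
  exact MeasurableSet.iInter fun k => measurable_const_vadd k <|
    (MeasurableSet.iInter fun n => (T.measurableSet_base n).compl.union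
      (T.measurable_code n (.of_discrete))).inter
    (MeasurableSet.iUnion fun n => (T.measurableSet_base n).compl)

lemma ae_mem_core [MeasurableConstVAdd ℤ Y] [VAddInvariantMeasure ℤ Y ν] [IsFiniteMeasure ν] :
    ∀ᵐ y ∂ν, y ∈ T.core := by
  refine ae_all_iff.2 fun k =>
    (measurePreserving_vadd k ν).quasiMeasurePreserving.ae (p := fun y => (∀ n, y ∈ T.base n →
      0 < ν {z | z ∈ T.base n ∧ T.code n z = T.code n y}) ∧ ∃ n, y ∉ T.base n) ?_
  refine Filter.Eventually.and (ae_all_iff.2 fun n => ?_) ?_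
  · have : ∀ v, ∀ᵐ y ∂ν, ν {z | z ∈ T.base n ∧ T.code n z = v} = 0 →
        y ∉ {z | z ∈ T.base n ∧ T.code n z = v} := fun v => by
      by_cases h : ν {z | z ∈ T.base n ∧ T.code n z = v} = 0
      · filter_upwards [measure_eq_zero_iff_ae_notMem.1 h] with y hy _ using hy
      · exact .of_forall fun y h' => absurd h' h
    filter_upwards [ae_all_iff.2 this] with y hy hmem
    exact pos_iff_ne_zero.2 fun h0 => hy _ h0 ⟨hmem, rfl⟩
  · have h0 : ν.real (⋂ n, T.base n) = 0 := by
      refine le_antisymm (ge_of_tendsto' tendsto_one_div_add_atTop_nhds_zero_nat fun n => ?_)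
        measureReal_nonneg
      exact (measureReal_mono (Set.iInter_subset _ n)).trans (T.measure_base_le n)
    rw [measureReal_eq_zero_iff] at h0
    filter_upwards [measure_eq_zero_iff_ae_notMem.1 h0] with y hy
    simpa using hy

/-- A tower system has refining towers on its core. -/
def refiningTowers [MeasurableConstVAdd ℤ Y] [VAddInvariantMeasure ℤ Y ν] [IsFiniteMeasure ν] :
    RefiningTowers T.core (ν.comap (↑)) where
  base n := {y | (y : Y) ∈ T.base n}
  gap := T.gap
  code n y := T.code n y
  sep n := {y | (y : Y) ∈ T.sep n}
  measurableSet_base n := measurable_subtype_coe (T.measurableSet_base n)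
  measurable_code n := (T.measurable_code n).comp measurable_subtype_coe
  finite_range_code n := (T.finite_range_code n).subset (by rintro _ ⟨y, rfl⟩; exact ⟨y, rfl⟩)
  base_zero := by simp [T.base_zero]
  code_zero _ _ := T.code_zero _ _
  base_succ_subset n _ hy := T.base_succ_subset n hy
  exists_mem_base n y := T.exists_mem_base n (y : Y)
  code_spec n y y' h := T.code_spec n y y' h
  separates y y' h := Subtype.ext (T.separates _ _ h)
  measure_base_le n := by
    have he : MeasurableEmbedding ((↑) : T.core → Y) :=
      MeasurableEmbedding.subtype_coe T.measurableSet_core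
    refine le_trans ?_ (T.measure_base_le n)
    rw [measureReal_def, he.comap_apply]
    exact measureReal_mono (Set.image_preimage_subset _ _)
  escapes y := by simpa using (y.2 0).2
  cell_pos n y hy := by
    have he : MeasurableEmbedding ((↑) : T.core → Y) :=
      MeasurableEmbedding.subtype_coe T.measurableSet_core
    have h := (y.2 0).1 n (by simpa using hy)
    rw [he.comap_apply]
    refine h.trans_eq (measure_congr ?_)
    filter_upwards [T.ae_mem_core] with z hz
    refine propext ⟨fun h' => ?_, ?_⟩
    · have h' : z ∈ T.base n ∧ T.code n z = T.code n ((0 : ℤ) +ᵥ (y : Y)) := h'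
      rw [zero_vadd] at h'
      exact ⟨⟨z, hz⟩, h', rfl⟩
    · rintro ⟨z, hz, rfl⟩
      change (z : Y) ∈ T.base n ∧ T.code n z = T.code n ((0 : ℤ) +ᵥ (y : Y))
      rwa [zero_vadd]

end TowerSystem

end restriction

/-! ### Markers for aperiodic bijections -/

section markers

variable {Y : Type*} [MeasurableSpace Y] [AddAction ℤ Y] [MeasurableConstVAdd ℤ Y]

/-- Every measurable set `S` contains a maximal measurable set of points that are at distance at
least `N` from each other along their orbits. Candidates are taken from countably many measurable
sets, each of which meets every orbit only at such distances, one set at a time. -/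
lemma exists_marker [StandardBorelSpace Y] (hfree : ∀ (k : ℤ) (y : Y), k ≠ 0 → k +ᵥ y ≠ y)
    {S : Set Y} (hS : MeasurableSet S) (N : ℤ) (hN : 0 < N) :
    ∃ C ⊆ S, MeasurableSet C ∧ (∀ x ∈ C, ∀ k : ℤ, 0 < k → k < N → k +ᵥ x ∉ C) ∧
      ∀ x ∈ S, ∃ k : ℤ, |k| < N ∧ k +ᵥ x ∈ C := by
  obtain ⟨κ, hκ⟩ := exists_measurableEmbedding_real Y
  obtain ⟨f, hf⟩ := exists_surjective_nat (ℚ × ℚ)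
  let V : ℕ → Set Y := fun i => {x | κ x ∈ Set.Ioo ((f i).1 : ℝ) (f i).2 ∧
    ∀ k : ℤ, k ∈ Set.Ioo 0 N → κ (k +ᵥ x) ∉ Set.Ioo ((f i).1 : ℝ) (f i).2}
  have hVm : ∀ i, MeasurableSet (V i) := fun i => by
    have : V i = κ ⁻¹' Set.Ioo ((f i).1 : ℝ) (f i).2 ∩ ⋂ k ∈ Set.Ioo 0 N,
        (fun x : Y => k +ᵥ x) ⁻¹' (κ ⁻¹' Set.Ioo ((f i).1 : ℝ) (f i).2)ᶜ := by
      ext x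
      simp only [Set.mem_inter_iff, Set.mem_iInter]
      rfl
    rw [this]
    exact (hκ.measurable measurableSet_Ioo).inter (MeasurableSet.biInter (Set.to_countable _)
      fun k _ => measurable_const_vadd k (hκ.measurable measurableSet_Ioo).compl)
  have hVcover : ∀ x, ∃ i, x ∈ V i := by
    intro x
    have hfin : ((fun k : ℤ => κ (k +ᵥ x)) '' Set.Ioo 0 N).Finite := (Set.finite_Ioo 0 N).image _
    have hx : κ x ∈ ((fun k : ℤ => κ (k +ᵥ x)) '' Set.Ioo 0 N)ᶜ := by
      rintro ⟨k, hk, h⟩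
      exact hfree k x hk.1.ne' (hκ.injective h)
    obtain ⟨u, hu, hxu, hsub⟩ := Real.isTopologicalBasis_Ioo_rat.exists_subset_of_mem_open hx
      hfin.isClosed.isOpen_compl
    simp only [Set.mem_iUnion, Set.mem_singleton_iff] at hu
    obtain ⟨a, b, _, rfl⟩ := hu
    obtain ⟨i, hi⟩ := hf (a, b)
    refine ⟨i, ?_, fun k hk hmem => ?_⟩
    · rw [hi]; exact hxu
    · rw [hi] at hmem
      exact hsub hmem ⟨k, hk, rfl⟩
  let C : ℕ → Set Y := fun i => Nat.rec ∅
    (fun i C => C ∪ {x | (x ∈ S ∧ x ∈ V i) ∧ ∀ k : ℤ, k ∈ Set.Ioo (-N) N → k +ᵥ x ∉ C}) i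
  have hC : ∀ i, C (i + 1) = C i ∪
      {x | (x ∈ S ∧ x ∈ V i) ∧ ∀ k : ℤ, k ∈ Set.Ioo (-N) N → k +ᵥ x ∉ C i} := fun i => rfl
  have hmono : Monotone C := monotone_nat_of_le_succ fun i => by
    rw [hC]; exact Set.subset_union_left
  have hCm : ∀ i, MeasurableSet (C i) := fun i => by
    induction i with
    | zero => exact MeasurableSet.empty
    | succ i ih =>
      have : {x | (x ∈ S ∧ x ∈ V i) ∧ ∀ k : ℤ, k ∈ Set.Ioo (-N) N → k +ᵥ x ∉ C i} =
          (S ∩ V i) ∩ ⋂ k ∈ Set.Ioo (-N) N, (fun x : Y => k +ᵥ x) ⁻¹' (C i)ᶜ := by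
        ext x
        simp only [Set.mem_inter_iff, Set.mem_iInter]
        rfl
      rw [hC, this]
      exact ih.union ((hS.inter (hVm i)).inter (MeasurableSet.biInter (Set.to_countable _)
        fun k _ => measurable_const_vadd k ih.compl))
  have hCS : ∀ i, C i ⊆ S := fun i => by
    induction i with
    | zero => exact Set.empty_subset S
    | succ i ih =>
      rw [hC]
      exact Set.union_subset ih fun x hx => hx.1.1
  have hind : ∀ i, ∀ x ∈ C i, ∀ k : ℤ, 0 < k → k < N → k +ᵥ x ∉ C i := fun i => by
    induction i with
    | zero => exact fun x hx => hx.elim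
    | succ i ih =>
      rw [hC]
      rintro x (hx | ⟨⟨_, hxV⟩, hx⟩) k hk0 hkN (hy | ⟨⟨_, hyV⟩, hy⟩)
      · exact ih x hx k hk0 hkN hy
      · refine hy (-k) ⟨by omega, by omega⟩ ?_
        rwa [vadd_vadd, neg_add_cancel, zero_vadd]
      · exact hx k ⟨by omega, hkN⟩ hy
      · exact hxV.2 k ⟨hk0, hkN⟩ hyV.1
  refine ⟨⋃ i, C i, Set.iUnion_subset hCS, MeasurableSet.iUnion hCm, ?_, fun x hx => ?_⟩
  · intro x hx k hk0 hkN hy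
    obtain ⟨i, hi⟩ := Set.mem_iUnion.1 hx
    obtain ⟨j, hj⟩ := Set.mem_iUnion.1 hy
    exact hind (max i j) x (hmono (le_max_left i j) hi) k hk0 hkN (hmono (le_max_right i j) hj)
  · obtain ⟨i, hi⟩ := hVcover x
    rcases Classical.em (∀ k : ℤ, k ∈ Set.Ioo (-N) N → k +ᵥ x ∉ C i) with h | h
    · refine ⟨0, by simpa using hN, Set.mem_iUnion.2 ⟨i + 1, ?_⟩⟩
      rw [zero_vadd, hC]
      exact Or.inr ⟨⟨hx, hi⟩, h⟩
    · push Not at h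
      obtain ⟨k, hk, hmem⟩ := h
      exact ⟨k, abs_lt.2 hk, Set.mem_iUnion.2 ⟨i, hmem⟩⟩

/-- A decreasing sequence of sets of points with bounded gaps along the orbits, such that points of
the `n`-th set are at distance at least `n + 1` from each other. -/
lemma exists_bases [StandardBorelSpace Y] (hfree : ∀ (k : ℤ) (y : Y), k ≠ 0 → k +ᵥ y ≠ y) :
    ∃ (base : ℕ → Set Y) (gap : ℕ → ℕ), (∀ n, MeasurableSet (base n)) ∧ base 0 = Set.univ ∧
      (∀ n, base (n + 1) ⊆ base n) ∧
      (∀ n y, ∃ k : ℕ, k < gap n ∧ -(k : ℤ) +ᵥ y ∈ base n) ∧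
      ∀ n, ∀ x ∈ base n, ∀ k : ℤ, 0 < k → k < n + 1 → k +ᵥ x ∉ base n := by
  have hstep : ∀ (n : ℕ) (S : {S : Set Y // MeasurableSet S}), ∃ C : {S : Set Y // MeasurableSet S},
      C.1 ⊆ S.1 ∧ (∀ x ∈ C.1, ∀ k : ℤ, 0 < k → k < n + 2 → k +ᵥ x ∉ C.1) ∧
        ∀ x ∈ S.1, ∃ k : ℤ, |k| < n + 2 ∧ k +ᵥ x ∈ C.1 := fun n S =>
    let ⟨C, h1, h2, h3⟩ := exists_marker hfree S.2 (n + 2) (by omega)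
    ⟨⟨C, h2⟩, h1, h3⟩
  choose F hF using hstep
  let G : ℕ → {S : Set Y // MeasurableSet S} := fun n =>
    Nat.rec ⟨Set.univ, MeasurableSet.univ⟩ (fun n S => F n S) n
  have hgap : ∀ n, ∃ h : ℕ, ∀ y, ∃ k : ℕ, k < h ∧ -(k : ℤ) +ᵥ y ∈ (G n).1 := fun n => by
    induction n with
    | zero => exact ⟨1, fun y => ⟨0, one_pos, Set.mem_univ _⟩⟩
    | succ n ih =>
      obtain ⟨h, hh⟩ := ih
      refine ⟨h + 2 * (n + 2), fun y => ?_⟩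
      -- the shift by `n + 2` makes up for the unknown sign of the distance to the next marker
      obtain ⟨k, hk, hmem⟩ := hh (-((n + 2 : ℕ) : ℤ) +ᵥ y)
      obtain ⟨j, hj, hmem'⟩ := (hF n (G n)).2.2 _ hmem
      rw [abs_lt] at hj
      refine ⟨(k + (n + 2) - j).toNat, by omega, ?_⟩
      rw [vadd_vadd, vadd_vadd] at hmem'
      convert hmem' using 2
      rw [Int.toNat_of_nonneg (by omega)]
      push_cast; ring
  choose gap hgap using hgap
  refine ⟨fun n => (G n).1, gap, fun n => (G n).2, rfl, fun n => (hF n (G n)).1, hgap, fun n => ?_⟩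
  cases n with
  | zero => intro x _ k h0 h1; omega
  | succ n =>
    intro x hx k h0 h1
    exact (hF n (G n)).2.1 x hx k h0 (by push_cast at h1; omega)

lemma measureReal_le_of_pairwise_far {ν : Measure Y} [VAddInvariantMeasure ℤ Y ν]
    [IsProbabilityMeasure ν] {S : Set Y} (hS : MeasurableSet S) {n : ℕ}
    (hfar : ∀ x ∈ S, ∀ k : ℤ, 0 < k → k < n + 1 → k +ᵥ x ∉ S) : ν.real S ≤ 1 / (n + 1) := by
  have hd : Set.PairwiseDisjoint (Finset.range (n + 1) : Set ℕ)
      fun k : ℕ => (fun x : Y => -(k : ℤ) +ᵥ x) ⁻¹' S := by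
    have aux : ∀ i j : ℕ, i < n + 1 → i < j → j < n + 1 →
        Disjoint ((fun x : Y => -(i : ℤ) +ᵥ x) ⁻¹' S) ((fun x : Y => -(j : ℤ) +ᵥ x) ⁻¹' S) := by
      intro i j hi hij hj
      refine Set.disjoint_left.2 fun x hx hx' => ?_
      refine hfar _ hx' (j - i) (by omega) (by omega) ?_
      rw [vadd_vadd, show (j - i + -j : ℤ) = -i by ring]
      exact hx
    intro i hi j hj hne
    simp only [Finset.coe_range, Set.mem_Iio] at hi hj
    rcases lt_or_gt_of_ne hne with h | h
    · exact aux i j hi h hj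
    · exact (aux j i hj h hi).symm
  have h := measureReal_biUnion_finset (μ := ν) hd fun k _ =>
    measurable_const_vadd (-(k : ℤ)) hS
  have hk : ∀ k ∈ Finset.range (n + 1), ν.real ((fun x : Y => -(k : ℤ) +ᵥ x) ⁻¹' S) = ν.real S :=
    fun k _ => by rw [measureReal_def, measure_preimage_vadd, measureReal_def]
  rw [Finset.sum_congr rfl hk, Finset.sum_const, Finset.card_range, nsmul_eq_mul] at h
  rw [le_div_iff₀ (by positivity), mul_comm]
  push_cast at h
  rw [← h]
  exact measureReal_le_one

/-! ### Existence of tower systems -/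

/-- The visits of an orbit segment to the first members of a sequence of sets. -/
def itinerary (S : ℕ → Set Y) (N : ℕ) (y : Y) : Fin N × Fin N → Prop :=
  fun p => ((p.1 : ℕ) : ℤ) +ᵥ y ∈ S p.2

/-- The itinerary, as a natural number. -/
def itineraryCode (S : ℕ → Set Y) (N : ℕ) (y : Y) : ℕ :=
  (Finite.equivFin (Fin N × Fin N → Prop) (itinerary S N y) : ℕ)

omit [MeasurableSpace Y] [MeasurableConstVAdd ℤ Y] in
lemma itineraryCode_eq_iff {S : ℕ → Set Y} {N : ℕ} {y y' : Y} :
    itineraryCode S N y = itineraryCode S N y' ↔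
      ∀ k < N, ∀ j < N, (k : ℤ) +ᵥ y ∈ S j ↔ (k : ℤ) +ᵥ y' ∈ S j := by
  rw [itineraryCode, itineraryCode, Fin.val_inj, (Finite.equivFin _).injective.eq_iff]
  constructor
  · exact fun h k hk j hj => iff_of_eq (congrFun h (⟨k, hk⟩, ⟨j, hj⟩))
  · exact fun h => funext fun p => propext (h p.1 p.1.2 p.2 p.2.2)

lemma measurable_itineraryCode {S : ℕ → Set Y} (hS : ∀ j, MeasurableSet (S j)) (N : ℕ) :
    Measurable (itineraryCode S N) := by
  have h1 : Measurable (itinerary S N) := measurable_pi_iff.2 fun p =>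
    (measurable_const_vadd _ (hS p.2)).mem
  exact (measurable_of_countable fun v : Fin N × Fin N → Prop =>
    ((Finite.equivFin (Fin N × Fin N → Prop) v : ℕ))).comp h1

/-- The stage `n` code of a point is its itinerary, in a window that grows with `n`, through the
marker sets and through countably many sets that separate the points. -/
lemma exists_towerSystem [StandardBorelSpace Y]
    (hfree : ∀ (k : ℤ) (y : Y), k ≠ 0 → k +ᵥ y ≠ y) (ν : Measure Y) [VAddInvariantMeasure ℤ Y ν]
    [IsProbabilityMeasure ν] : Nonempty (TowerSystem Y ν) := by
  obtain ⟨base, gap, hm, h0, hanti, hgap, hfar⟩ := exists_bases hfree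
  obtain ⟨κ, hκ⟩ := exists_measurableEmbedding_real Y
  obtain ⟨q, hq⟩ := exists_surjective_nat ℚ
  let sep : ℕ → Set Y := fun n => κ ⁻¹' Set.Iio (q n : ℝ)
  -- the family of all sets of interest: the separating sets interlaced with the bases
  let S : ℕ → Set Y := fun j => if j % 2 = 0 then sep (j / 2) else base (j / 2)
  have hSm : ∀ j, MeasurableSet (S j) := fun j => by
    simp only [S]
    split_ifs
    · exact hκ.measurable measurableSet_Iio
    · exact hm _
  have hSsep : ∀ n, S (2 * n) = sep n := fun n => by simp [S]
  have hSbase : ∀ n, S (2 * n + 1) = base n := fun n => by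
    simp only [S]
    rw [if_neg (by omega), show (2 * n + 1) / 2 = n by omega]
  -- the window of stage `n + 1` contains all translates by less than `gap (n + 1)` of the window of
  -- stage `n`, and the indices `2 * n`, `2 * n + 1` and `2 * n + 3` of the sets in `code_spec`
  let N : ℕ → ℕ := fun n => ∑ k ∈ Finset.range n, (gap (k + 1) + 2 * (k + 2))
  have hN : ∀ n, N (n + 1) = N n + (gap (n + 1) + 2 * (n + 2)) := fun n => Finset.sum_range_succ _ n
  refine ⟨{
    base := base
    gap := gap
    code := fun n => itineraryCode S (N n)
    sep := sep
    measurableSet_base := hm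
    measurable_code := fun n => measurable_itineraryCode hSm _
    finite_range_code := fun n => (Set.finite_Iio (Nat.card (Fin (N n) × Fin (N n) → Prop))).subset
      (by rintro _ ⟨y, rfl⟩; exact Fin.is_lt _)
    base_zero := h0
    code_zero := fun y y' => itineraryCode_eq_iff.2 fun k hk => absurd hk (by simp [N])
    base_succ_subset := hanti
    exists_mem_base := hgap
    code_spec := ?_
    separates := ?_
    measure_base_le := fun n => measureReal_le_of_pairwise_far (hm n) (hfar n) }⟩
  · intro n y y' h o ho
    rw [itineraryCode_eq_iff] at h
    have hn := hN n
    refine ⟨itineraryCode_eq_iff.2 fun k hk j hj => ?_, ?_, ?_, ?_⟩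
    · rw [vadd_vadd, vadd_vadd, ← Nat.cast_add]
      exact h _ (by omega) _ (by omega)
    · rw [← hSbase]; exact h _ (by omega) _ (by omega)
    · rw [← hSbase]; exact h _ (by omega) _ (by omega)
    · rw [← hSsep]; exact h _ (by omega) _ (by omega)
  · intro y y' h
    have aux : ∀ y y', (∀ n, y ∈ sep n ↔ y' ∈ sep n) → ¬ κ y < κ y' := by
      intro y y' h hlt
      obtain ⟨r, hr, hr'⟩ := exists_rat_btwn hlt
      obtain ⟨n, rfl⟩ := hq r
      exact lt_asymm hr' ((h n).1 hr)
    exact hκ.injective (le_antisymm (not_lt.1 (aux y' y fun n => (h n).symm))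
      (not_lt.1 (aux y y' h)))

/-- Every aperiodic measure-preserving bijection of a standard Borel probability space is realized
by cutting and stacking. -/
theorem exists_intervalModel [StandardBorelSpace Y]
    (hfree : ∀ (k : ℤ) (y : Y), k ≠ 0 → k +ᵥ y ≠ y) (ν : Measure Y) [VAddInvariantMeasure ℤ Y ν]
    [IsProbabilityMeasure ν] {W : ℝ} (hW : 0 < W) : Nonempty (IntervalModel Y ν W) := by
  obtain ⟨T⟩ := exists_towerSystem hfree ν
  have hm := T.measurableSet_core
  have hae := T.ae_mem_core
  have := SubAddAction.vaddInvariantMeasure_comap (ν := ν) hm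
  have hmap := SubAddAction.map_comap_coe (ν := ν) hm hae
  have : IsProbabilityMeasure ((ν.comap ((↑) : T.core → Y)).map ((↑) : T.core → Y)) := by
    rw [hmap]
    infer_instance
  have : IsProbabilityMeasure (ν.comap ((↑) : T.core → Y)) :=
    (Measure.isProbabilityMeasure_map_iff measurable_subtype_coe.aemeasurable).1 this
  have : Nonempty T.core := nonempty_of_isProbabilityMeasure (ν.comap ((↑) : T.core → Y))
  exact ⟨IntervalModel.extend hm hae (T.refiningTowers.intervalModel hW)⟩

end markers

/-! ### From an eigenfunction to a cross-section with constant return time -/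

section eigenfunction

variable {X : Type*} [MeasurableSpace X] [AddAction ℝ X] [MeasurableVAdd₂ ℝ X]
  {μ : Measure X} [IsProbabilityMeasure μ]

/-- An eigenfunction can be modified on a null set in such a way that it becomes strictly
equivariant and, by ergodicity, nowhere zero on an invariant conull measurable set. The values of
the modification are averages of `exp (-iλs) f (s +ᵥ x)` along the orbit of `x`. -/
lemma exists_equivariant [ErgodicVAdd ℝ X μ] {lam : ℝ} {f : X → ℂ} (hf : Measurable f)
    (hne : ¬ f =ᵐ[μ] 0)
    (heq : ∀ t : ℝ, ∀ᵐ x ∂μ, f (t +ᵥ x) = Complex.exp (Complex.I * lam * t) * f x) :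
    ∃ (p : SubAddAction ℝ X) (F : X → ℂ), MeasurableSet (p : Set X) ∧ (∀ᵐ x ∂μ, x ∈ p) ∧
      Measurable F ∧ ∀ x ∈ p, F x ≠ 0 ∧
        ∀ t : ℝ, F (t +ᵥ x) = Complex.exp (Complex.I * lam * t) * F x := by
  let g : X → ℝ → ℂ := fun x s => Complex.exp (-(Complex.I * lam * s)) * f (s +ᵥ x)
  have hg : Measurable (Function.uncurry g) :=
    (by fun_prop : Measurable fun q : X × ℝ => Complex.exp (-(Complex.I * lam * q.2))).mul
      (hf.comp (measurable_snd.vadd measurable_fst))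
  let F : X → ℂ := fun x => ∫ s in Set.Icc (0 : ℝ) 1, g x s
  have hF : Measurable F :=
    (StronglyMeasurable.integral_prod_right (ν := volume.restrict (Set.Icc (0 : ℝ) 1))
      hg.stronglyMeasurable).measurable
  have hconst : ∀ x c, (∀ᵐ s, g x s = c) → F x = c := fun x c h => by
    have : F x = ∫ _ in Set.Icc (0 : ℝ) 1, c := integral_congr_ae (ae_restrict_of_ae h)
    rw [this]
    simp
  have hshift : ∀ x c (t : ℝ), (∀ᵐ s, g x s = c) →
      ∀ᵐ s, g (t +ᵥ x) s = Complex.exp (Complex.I * lam * t) * c := fun x c t h => by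
    have h' := (measurePreserving_add_right volume t).quasiMeasurePreserving.ae h
    filter_upwards [h'] with s hs
    simp only [g] at hs ⊢
    rw [vadd_vadd, ← hs, ← mul_assoc, ← Complex.exp_add]
    congr 2
    push_cast; ring
  have hset : MeasurableSet {q : X × ℝ | g q.1 q.2 = F q.1} :=
    measurableSet_eq_fun hg (hF.comp measurable_fst)
  have hinv : ∀ x (t : ℝ), (∀ᵐ s, g x s = F x) →
      F (t +ᵥ x) = Complex.exp (Complex.I * lam * t) * F x ∧ ∀ᵐ s, g (t +ᵥ x) s = F (t +ᵥ x) :=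
    fun x t h => by
      have h1 := hshift x _ t h
      have h2 := hconst _ _ h1
      exact ⟨h2, by rw [h2]; exact h1⟩
  let p : SubAddAction ℝ X :=
    { carrier := {x | (∀ᵐ s, g x s = F x) ∧ F x ≠ 0}
      vadd_mem' := fun t x hx => by
        obtain ⟨h1, h2⟩ := hinv x t hx.1
        refine ⟨h2, ?_⟩
        rw [h1]
        exact mul_ne_zero (Complex.exp_ne_zero _) hx.2 }
  have hpm : MeasurableSet (p : Set X) := by
    refine MeasurableSet.inter ?_ (hF (measurableSet_singleton 0).compl)
    have := measurable_measure_prodMk_left (ν := (volume : Measure ℝ)) hset.compl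
    exact this (measurableSet_singleton 0)
  have hFf : ∀ᵐ x ∂μ, (∀ᵐ s, g x s = F x) ∧ F x = f x := by
    have h1 : ∀ᵐ x ∂μ, ∀ᵐ s : ℝ, g x s = f x := by
      have hm : MeasurableSet {q : X × ℝ | g q.1 q.2 = f q.1} :=
        measurableSet_eq_fun hg (hf.comp measurable_fst)
      refine (Measure.ae_ae_comm (p := fun x s => g x s = f x) hm).2 (.of_forall fun s => ?_)
      filter_upwards [heq s] with x hx
      simp only [g]
      rw [hx, ← mul_assoc, ← Complex.exp_add, neg_add_cancel, Complex.exp_zero, one_mul]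
    filter_upwards [h1] with x hx
    have h2 := hconst _ _ hx
    exact ⟨by rw [h2]; exact hx, h2⟩
  refine ⟨p, F, hpm, ?_, hF, fun x hx => ⟨hx.2, fun t => (hinv x t hx.1).1⟩⟩
  have herg : EventuallyConst (p : Set X) (ae μ) := by
    refine ErgodicVAdd.aeconst_of_forall_preimage_vadd_ae_eq (G := ℝ) hpm fun t => ?_
    refine Eventually.of_forall fun x => propext ?_
    refine ⟨fun hx => ?_, fun hx => p.vadd_mem t hx⟩
    have h := p.vadd_mem (-t) hx
    rwa [vadd_vadd, neg_add_cancel, zero_vadd] at h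
  rcases eventuallyConst_set'.1 herg with h | h
  · refine absurd ?_ hne
    filter_upwards [h, hFf] with x hx hx'
    by_contra h0
    have h1 : x ∈ (p : Set X) := ⟨hx'.1, by rw [hx'.2]; exact h0⟩
    exact (iff_of_eq hx).1 h1
  · filter_upwards [h] with x hx
    exact (iff_of_eq hx).2 trivial

end eigenfunction

/-- A cross-section of a flow with constant return time: on the invariant conull set `domain`, the
flow is free, and `height x` is the time that has passed since the last visit of `x` to the
section `{height = 0}`, which is visited with the period `period`. -/
structure FlowSection (X : Type*) [MeasurableSpace X] [AddAction ℝ X] (μ : Measure X) where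
  period : ℝ
  period_pos : 0 < period
  domain : SubAddAction ℝ X
  measurableSet_domain : MeasurableSet (domain : Set X)
  ae_domain : ∀ᵐ x ∂μ, x ∈ domain
  height : X → ℝ
  measurable_height : Measurable height
  height_mem : ∀ x, height x ∈ Set.Ico 0 period
  height_vadd : ∀ x ∈ domain, ∀ t : ℝ,
    height (t +ᵥ x) = period * Int.fract ((height x + t) / period)
  free : ∀ x ∈ domain, ∀ t : ℝ, t ≠ 0 → t +ᵥ x ≠ x

lemma Int.fract_add_eq_of_fract_eq {a b c : ℝ} (h : Int.fract a = Int.fract b) :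
    Int.fract (a + c) = Int.fract (b + c) := by
  obtain ⟨z, hz⟩ := Int.fract_eq_fract.1 h
  exact Int.fract_eq_fract.2 ⟨z, by rw [← hz]; ring⟩

section

variable {X : Type*} [MeasurableSpace X] [StandardBorelSpace X] [AddAction ℝ X]
  [MeasurableVAdd₂ ℝ X] {μ : Measure X}

/-- The argument of a strictly equivariant function, in units of the period, is the height over
a section. -/
lemma exists_flowSection_of_equivariant (hap : IsAperiodicFlow μ) {lam : ℝ} (hlam : 0 < lam)
    {p : SubAddAction ℝ X} {F : X → ℂ} (hp : MeasurableSet (p : Set X)) (hpae : ∀ᵐ x ∂μ, x ∈ p)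
    (hF : Measurable F) (hne : ∀ x ∈ p, F x ≠ 0)
    (heq : ∀ x ∈ p, ∀ t : ℝ, F (t +ᵥ x) = Complex.exp (Complex.I * lam * t) * F x) :
    Nonempty (FlowSection X μ) := by
  set H : ℝ := 2 * Real.pi / lam with hH
  have hpi := Real.pi_pos
  have hHpos : 0 < H := by positivity
  let h : X → ℝ := fun x => H * Int.fract ((F x).arg / (2 * Real.pi))
  have hvadd : ∀ x ∈ p, ∀ t : ℝ, h (t +ᵥ x) = H * Int.fract ((h x + t) / H) := by
    intro x hx t
    have e1 : Int.fract ((h x + t) / H) = Int.fract ((F x).arg / (2 * Real.pi) + t / H) := by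
      rw [add_div, mul_div_cancel_left₀ _ hHpos.ne']
      exact Int.fract_add_eq_of_fract_eq (Int.fract_fract _)
    rw [e1]
    simp only [h]
    congr 1
    have hn : ‖F (t +ᵥ x)‖ = ‖F x‖ := by
      rw [heq x hx, norm_mul, show Complex.I * lam * t = ((lam * t : ℝ) : ℂ) * Complex.I by
        push_cast; ring, Complex.norm_exp_ofReal_mul_I, one_mul]
    have h1 : Complex.exp ((F (t +ᵥ x)).arg * Complex.I) =
        Complex.exp (Complex.I * lam * t + (F x).arg * Complex.I) := by
      have hx0 : (‖F x‖ : ℂ) ≠ 0 := by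
        rw [Complex.ofReal_ne_zero, norm_ne_zero_iff]
        exact hne x hx
      refine mul_left_cancel₀ hx0 ?_
      conv_lhs => rw [← hn, Complex.norm_mul_exp_arg_mul_I, heq x hx]
      rw [Complex.exp_add, mul_left_comm, Complex.norm_mul_exp_arg_mul_I]
    obtain ⟨n, hn⟩ := Complex.exp_eq_exp_iff_exists_int.1 h1
    have h2 : (F (t +ᵥ x)).arg = lam * t + (F x).arg + n * (2 * Real.pi) := by
      have h3 : (((F (t +ᵥ x)).arg : ℝ) : ℂ) * Complex.I =
          ((lam * t + (F x).arg + n * (2 * Real.pi) : ℝ) : ℂ) * Complex.I := by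
        rw [hn]; push_cast; ring
      exact_mod_cast mul_right_cancel₀ Complex.I_ne_zero h3
    refine Int.fract_eq_fract.2 ⟨n, ?_⟩
    rw [h2, hH]
    field_simp
    ring
  let q : SubAddAction ℝ X :=
    { carrier := {x | x ∈ p ∧ ∀ k : ℤ, k ≠ 0 → (k * H : ℝ) +ᵥ x ≠ x}
      vadd_mem' := fun t x hx => ⟨p.vadd_mem t hx.1, fun k hk he => hx.2 k hk (by
        rw [vadd_vadd, add_comm, ← vadd_vadd] at he
        exact vadd_left_cancel t he)⟩ }
  refine ⟨{
    period := H
    period_pos := hHpos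
    domain := q
    measurableSet_domain := ?_
    ae_domain := ?_
    height := h
    measurable_height := ?_
    height_mem := fun x => ⟨mul_nonneg hHpos.le (Int.fract_nonneg _), ?_⟩
    height_vadd := fun x hx => hvadd x hx.1
    free := ?_ }⟩
  · have : (q : Set X) = (p : Set X) ∩ ⋂ k : ℤ, ⋂ _ : k ≠ 0, {x | (k * H : ℝ) +ᵥ x = x}ᶜ := by
      ext x
      simp only [Set.mem_inter_iff, Set.mem_iInter]
      rfl
    rw [this]
    exact hp.inter (MeasurableSet.iInter fun k => MeasurableSet.iInter fun _ =>
      (measurableSet_eq_fun (measurable_const_vadd _) measurable_id).compl)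
  · filter_upwards [hpae, hap] with x hx hx'
    exact ⟨hx, fun k hk => hx' _ (mul_ne_zero (Int.cast_ne_zero.2 hk) hHpos.ne')⟩
  · exact measurable_const.mul (measurable_fract.comp
      ((Complex.measurable_arg.comp hF).div_const _))
  · exact mul_lt_of_lt_one_right hHpos (Int.fract_lt_one _)
  · intro x hx t ht he
    -- a period of `x` is a multiple of `H`, because it leaves the height unchanged
    have h1 := hvadd x hx.1 t
    rw [he] at h1
    have h2 : (h x + t) / H - ⌊(h x + t) / H⌋ = h x / H := by
      rw [← Int.fract, eq_div_iff hHpos.ne', mul_comm]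
      exact h1.symm
    have h3 : t = (⌊(h x + t) / H⌋ : ℤ) * H := by
      field_simp at h2
      linarith
    refine hx.2 ⌊(h x + t) / H⌋ (fun h0 => ht ?_) (by rw [← h3]; exact he)
    rw [h3, h0]; simp

lemma exists_flowSection [IsProbabilityMeasure μ] [ErgodicVAdd ℝ X μ] (hap : IsAperiodicFlow μ)
    (h : HasEigenfunctionWithNonzeroEigenvalue μ) : Nonempty (FlowSection X μ) := by
  obtain ⟨lam, f, hlam, hf, heq⟩ := h
  obtain ⟨p, F, hp, hpae, hF, hFp⟩ := exists_equivariant (μ := μ) (lam := lam) (f := f)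
    (Lp.stronglyMeasurable f).measurable (fun h0 => hf ((Lp.eq_zero_iff_ae_eq_zero).2 h0))
    fun t => by
      have h1 := Lp.coeFn_compMeasurePreserving f (measurePreserving_vadd t μ)
      have h2 := Lp.coeFn_smul (Complex.exp (Complex.I * lam * t)) f
      rw [← heq t] at h2
      filter_upwards [h1, h2] with x h1 h2
      exact h1.symm.trans h2
  rcases hlam.lt_or_gt with hneg | hpos
  -- conjugation reverses the sign of the eigenvalue
  · refine exists_flowSection_of_equivariant hap (neg_pos.2 hneg) hp hpae
      (F := fun x => (starRingEnd ℂ) (F x)) (Complex.continuous_conj.measurable.comp hF)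
      (fun x hx => (map_ne_zero _).2 (hFp x hx).1) fun x hx t => ?_
    rw [(hFp x hx).2 t, map_mul, ← Complex.exp_conj]
    congr 2
    simp
  · exact exists_flowSection_of_equivariant hap hpos hp hpae hF (fun x hx => (hFp x hx).1)
      fun x hx => (hFp x hx).2

end

/-! ### The section map and the product structure of a flow with a section -/

namespace FlowSection

variable {X : Type*} [MeasurableSpace X] [AddAction ℝ X] {μ : Measure X} (S : FlowSection X μ)

/-- The section `{height = 0}`. -/
def Section : Type _ := {x : X // x ∈ S.domain ∧ S.height x = 0}

instance : MeasurableSpace S.Section :=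
  inferInstanceAs (MeasurableSpace {x : X // x ∈ S.domain ∧ S.height x = 0})

instance [StandardBorelSpace X] : StandardBorelSpace S.Section :=
  (S.measurableSet_domain.inter
    (S.measurable_height (measurableSet_singleton 0))).standardBorel

lemma height_foot_vadd {x : X} (hx : x ∈ S.domain) {t : ℝ} {k : ℤ}
    (h1 : k * S.period ≤ S.height x + t) (h2 : S.height x + t < (k + 1) * S.period) :
    S.height (t +ᵥ x) = S.height x + t - k * S.period := by
  have hp := S.period_pos
  have hfl : ⌊(S.height x + t) / S.period⌋ = k := by
    rw [Int.floor_eq_iff, le_div_iff₀ hp, div_lt_iff₀ hp]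
    exact ⟨h1, h2⟩
  rw [S.height_vadd x hx, Int.fract, hfl]
  field_simp

lemma height_zsmul_vadd {x : X} (hx : x ∈ S.domain) (k : ℤ) :
    S.height ((k * S.period : ℝ) +ᵥ x) = S.height x := by
  have h := S.height_mem x
  rw [S.height_foot_vadd hx (k := k) (by linarith [h.1]) (by linarith [h.2])]
  ring

/-- The return map of the section, and its iterates. -/
instance : AddAction ℤ S.Section where
  vadd k y := ⟨(k * S.period : ℝ) +ᵥ y.1, S.domain.vadd_mem _ y.2.1,
    (S.height_zsmul_vadd y.2.1 k).trans y.2.2⟩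
  zero_vadd y := Subtype.ext (by
    change ((0 : ℤ) * S.period : ℝ) +ᵥ y.1 = y.1
    simp)
  add_vadd j k y := Subtype.ext (by
    change ((j + k : ℤ) * S.period : ℝ) +ᵥ y.1 = (j * S.period : ℝ) +ᵥ (k * S.period : ℝ) +ᵥ y.1
    rw [vadd_vadd]
    congr 1
    push_cast; ring)

lemma coe_vadd (k : ℤ) (y : S.Section) : (k +ᵥ y).1 = (k * S.period : ℝ) +ᵥ y.1 := rfl

lemma vadd_ne (k : ℤ) (y : S.Section) (hk : k ≠ 0) : k +ᵥ y ≠ y := fun h =>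
  S.free y.1 y.2.1 _ (mul_ne_zero (Int.cast_ne_zero.2 hk) S.period_pos.ne')
    (congrArg Subtype.val h)

/-- The last visit of a point to the section. -/
def foot (x : S.domain) : S.Section := ⟨(-S.height x) +ᵥ (x : X), S.domain.vadd_mem _ x.2, by
  rw [S.height_foot_vadd x.2 (k := 0) (by simp) (by simpa using S.period_pos)]
  simp⟩

lemma height_vadd_foot (x : S.domain) : S.height x +ᵥ (S.foot x).1 = x := by
  change S.height x +ᵥ (-S.height x) +ᵥ (x : X) = x
  rw [vadd_vadd, add_neg_cancel, zero_vadd]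

lemma foot_vadd {x : S.domain} {t : ℝ} {k : ℤ}
    (h1 : k * S.period ≤ S.height x + t) (h2 : S.height x + t < (k + 1) * S.period) :
    S.foot (t +ᵥ x) = k +ᵥ S.foot x := by
  refine Subtype.ext ?_
  change (-S.height (t +ᵥ (x : X))) +ᵥ t +ᵥ (x : X) =
    (k * S.period : ℝ) +ᵥ (-S.height x) +ᵥ (x : X)
  rw [S.height_foot_vadd x.2 h1 h2, vadd_vadd, vadd_vadd]
  congr 1
  ring

lemma exists_floor (x : X) (t : ℝ) : ∃ k : ℤ, k * S.period ≤ S.height x + t ∧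
    S.height x + t < (k + 1) * S.period := by
  refine ⟨⌊(S.height x + t) / S.period⌋, ?_, ?_⟩
  · rw [← le_div_iff₀ S.period_pos]; exact Int.floor_le _
  · rw [← div_lt_iff₀ S.period_pos]; exact Int.lt_floor_add_one _

/-- The restriction of the measure to the domain of the section. -/
def domainMeasure : Measure S.domain := μ.comap (↑)

lemma map_domainMeasure : S.domainMeasure.map (↑) = μ :=
  SubAddAction.map_comap_coe S.measurableSet_domain S.ae_domain

instance [IsProbabilityMeasure μ] : IsProbabilityMeasure S.domainMeasure := by
  have : IsProbabilityMeasure (S.domainMeasure.map ((↑) : S.domain → X)) := by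
    rw [map_domainMeasure]
    infer_instance
  exact (Measure.isProbabilityMeasure_map_iff measurable_subtype_coe.aemeasurable).1 this

variable [MeasurableVAdd₂ ℝ X]

instance : MeasurableConstVAdd ℤ S.Section :=
  ⟨fun k => ((measurable_const_vadd (k * S.period : ℝ)).comp measurable_subtype_coe).subtype_mk⟩

lemma measurable_foot : Measurable S.foot :=
  ((S.measurable_height.neg.comp measurable_subtype_coe).vadd measurable_subtype_coe).subtype_mk

/-- The invariant measure of the return map. -/
def sectionMeasure : Measure S.Section := S.domainMeasure.map S.foot

instance [IsProbabilityMeasure μ] : IsProbabilityMeasure S.sectionMeasure :=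
  Measure.isProbabilityMeasure_map S.measurable_foot.aemeasurable

variable [VAddInvariantMeasure ℝ X μ]

instance : VAddInvariantMeasure ℝ S.domain S.domainMeasure :=
  SubAddAction.vaddInvariantMeasure_comap S.measurableSet_domain

instance : VAddInvariantMeasure ℤ S.Section S.sectionMeasure := by
  refine ⟨fun k s hs => ?_⟩
  rw [sectionMeasure, Measure.map_apply S.measurable_foot (measurable_const_vadd k hs),
    Measure.map_apply S.measurable_foot hs,
    ← measure_preimage_vadd S.domainMeasure (k * S.period : ℝ) (S.foot ⁻¹' s)]
  congr 1
  ext x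
  have h := S.height_mem (x : X)
  change k +ᵥ S.foot x ∈ s ↔ S.foot ((k * S.period : ℝ) +ᵥ x) ∈ s
  rw [S.foot_vadd (k := k) (by linarith [h.1]) (by linarith [h.2])]

/-- Rotating the height within the fibres of the section map preserves the measure, although the
flow moves some of the points to another fibre. -/
lemma measure_rotate {s : Set S.Section} {E : Set ℝ} {τ : ℝ} (hτ : τ ∈ Set.Ico 0 S.period) :
    S.domainMeasure {x | S.foot x ∈ s ∧ S.height (τ +ᵥ (x : X)) ∈ E} =
      S.domainMeasure {x | S.foot x ∈ s ∧ S.height x ∈ E} := by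
  have hp := S.period_pos
  have hmh : Measurable fun x : S.domain => S.height x :=
    S.measurable_height.comp measurable_subtype_coe
  have hA : MeasurableSet {x : S.domain | S.height x < S.period - τ} :=
    measurableSet_lt hmh measurable_const
  have hB : MeasurableSet {x : S.domain | τ ≤ S.height x} := measurableSet_le measurable_const hmh
  -- below and above the height `period - τ`
  have low : ∀ x : S.domain, S.height x < S.period - τ → S.foot (τ +ᵥ x) = S.foot x ∧
      S.height (τ +ᵥ (x : X)) = S.height x + τ ∧ S.foot ((τ - S.period) +ᵥ x) = -1 +ᵥ S.foot x ∧
      S.height ((τ - S.period) +ᵥ (x : X)) = S.height x + τ := by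
    intro x hx
    have h0 := (S.height_mem (x : X)).1
    refine ⟨?_, ?_, ?_, ?_⟩
    · rw [S.foot_vadd (k := 0) (by push_cast; linarith [hτ.1]) (by push_cast; linarith), zero_vadd]
    · rw [S.height_foot_vadd x.2 (k := 0) (by push_cast; linarith [hτ.1]) (by push_cast; linarith)]
      simp
    · exact S.foot_vadd (by push_cast; linarith [hτ.1]) (by push_cast; linarith)
    · rw [S.height_foot_vadd x.2 (k := -1) (by push_cast; linarith [hτ.1])
        (by push_cast; linarith)]
      push_cast; ring
  have high : ∀ x : S.domain, S.period - τ ≤ S.height x →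
      S.height (τ +ᵥ (x : X)) = S.height x + τ - S.period ∧
      S.foot ((τ - S.period) +ᵥ x) = S.foot x ∧
      S.height ((τ - S.period) +ᵥ (x : X)) = S.height x + τ - S.period := by
    intro x hx
    have h0 := (S.height_mem (x : X)).2
    refine ⟨?_, ?_, ?_⟩
    · rw [S.height_foot_vadd x.2 (k := 1) (by push_cast; linarith)
        (by push_cast; linarith [hτ.2])]
      simp
    · rw [S.foot_vadd (k := 0) (by push_cast; linarith) (by push_cast; linarith [hτ.2]), zero_vadd]
    · rw [S.height_foot_vadd x.2 (k := 0) (by push_cast; linarith)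
        (by push_cast; linarith [hτ.2])]
      push_cast; ring
  rw [← measure_inter_add_sdiff {x : S.domain | S.foot x ∈ s ∧ S.height (τ +ᵥ (x : X)) ∈ E} hA,
    ← measure_inter_add_sdiff {x : S.domain | S.foot x ∈ s ∧ S.height x ∈ E} hB,
    ← measure_preimage_vadd S.domainMeasure τ ({x : S.domain | S.foot x ∈ s ∧ S.height x ∈ E} ∩ _),
    ← measure_preimage_vadd S.domainMeasure (τ - S.period)
      ({x : S.domain | S.foot x ∈ s ∧ S.height x ∈ E} \ _)]
  congr 2
  · ext x
    change (S.foot x ∈ s ∧ S.height (τ +ᵥ (x : X)) ∈ E) ∧ S.height x < S.period - τ ↔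
      (S.foot (τ +ᵥ x) ∈ s ∧ S.height (τ +ᵥ (x : X)) ∈ E) ∧ τ ≤ S.height (τ +ᵥ (x : X))
    rcases lt_or_ge (S.height x) (S.period - τ) with h | h
    · have h0 := (S.height_mem (x : X)).1
      obtain ⟨e1, e2, -⟩ := low x h
      rw [e1, e2]
      simp [h, h0]
    · have h0 := (S.height_mem (x : X)).2
      obtain ⟨e1, -⟩ := high x h
      rw [e1]
      simp only [not_lt.2 h, and_false, false_iff, not_and, not_le]
      intro _
      linarith
  · ext x
    change (S.foot x ∈ s ∧ S.height (τ +ᵥ (x : X)) ∈ E) ∧ ¬ S.height x < S.period - τ ↔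
      (S.foot ((τ - S.period) +ᵥ x) ∈ s ∧ S.height ((τ - S.period) +ᵥ (x : X)) ∈ E) ∧
        ¬ τ ≤ S.height ((τ - S.period) +ᵥ (x : X))
    rcases lt_or_ge (S.height x) (S.period - τ) with h | h
    · have h0 := (S.height_mem (x : X)).1
      obtain ⟨-, -, -, e2⟩ := low x h
      rw [e2]
      simp [h, h0]
    · have h0 := (S.height_mem (x : X)).2
      obtain ⟨e1, e2, e3⟩ := high x h
      rw [e1, e2, e3]
      simp only [not_lt.2 h, not_false_eq_true, and_true, not_le, iff_self_and]
      intro _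
      linarith

/-- Rotations preserve the length. -/
lemma volume_rotate {H : ℝ} (hH : 0 < H) {h : ℝ} (hh : h ∈ Set.Ico 0 H) {E : Set ℝ} :
    volume {τ | τ ∈ Set.Ico 0 H ∧ H * Int.fract ((h + τ) / H) ∈ E} =
      volume (E ∩ Set.Ico 0 H) := by
  have fr : ∀ (k : ℤ) (τ : ℝ), k * H ≤ h + τ → h + τ < (k + 1) * H →
      H * Int.fract ((h + τ) / H) = h + τ - k * H := by
    intro k τ h1 h2
    have hfl : ⌊(h + τ) / H⌋ = k := by
      rw [Int.floor_eq_iff, le_div_iff₀ hH, div_lt_iff₀ hH]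
      exact ⟨h1, h2⟩
    rw [Int.fract, hfl]
    field_simp
  rw [← measure_inter_add_sdiff {τ | τ ∈ Set.Ico 0 H ∧ H * Int.fract ((h + τ) / H) ∈ E}
      (measurableSet_Iio (a := H - h)),
    ← measure_inter_add_sdiff (E ∩ Set.Ico 0 H) (measurableSet_Ici (a := h)),
    ← measure_preimage_add volume h (E ∩ Set.Ico 0 H ∩ _),
    ← measure_preimage_add volume (h - H) ((E ∩ Set.Ico 0 H) \ _)]
  congr 2
  · ext τ
    simp only [Set.mem_inter_iff, Set.mem_ofPred_eq, Set.mem_Ico, Set.mem_Iio, Set.mem_preimage,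
      Set.mem_Ici]
    constructor
    · rintro ⟨⟨⟨h1, h2⟩, h3⟩, h4⟩
      rw [fr 0 τ (by push_cast; linarith [hh.1]) (by push_cast; linarith)] at h3
      simp only [Int.cast_zero, zero_mul, sub_zero] at h3
      exact ⟨⟨h3, by linarith [hh.1], by linarith⟩, by linarith⟩
    · rintro ⟨⟨h1, h2, h3⟩, h4⟩
      refine ⟨⟨⟨by linarith, by linarith [hh.1]⟩, ?_⟩, by linarith⟩
      rw [fr 0 τ (by push_cast; linarith) (by push_cast; linarith)]
      simpa using h1
  · ext τ
    simp only [Set.mem_sdiff, Set.mem_inter_iff, Set.mem_ofPred_eq, Set.mem_Ico, Set.mem_Iio,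
      Set.mem_preimage, Set.mem_Ici, not_lt, not_le]
    constructor
    · rintro ⟨⟨⟨h1, h2⟩, h3⟩, h4⟩
      rw [fr 1 τ (by push_cast; linarith) (by push_cast; linarith [hh.2])] at h3
      refine ⟨⟨?_, by linarith, by linarith [hh.2]⟩, by linarith⟩
      convert h3 using 1
      push_cast; ring
    · rintro ⟨⟨h1, h2, h3⟩, h4⟩
      refine ⟨⟨⟨by linarith [hh.2], by linarith⟩, ?_⟩, by linarith⟩
      rw [fr 1 τ (by push_cast; linarith) (by push_cast; linarith)]
      convert h1 using 1
      push_cast; ring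

/-- The section map and the height are independent, and the height is uniformly distributed:
average the rotation invariance over all rotations. -/
lemma map_foot_height [IsProbabilityMeasure μ] :
    S.domainMeasure.map (fun x => (S.foot x, S.height x)) =
      S.sectionMeasure.prod
        (ENNReal.ofReal S.period⁻¹ • volume.restrict (Set.Ico 0 S.period)) := by
  have hp := S.period_pos
  have hmh : Measurable fun x : S.domain => S.height x :=
    S.measurable_height.comp measurable_subtype_coe
  have : IsFiniteMeasure (ENNReal.ofReal S.period⁻¹ • volume.restrict (Set.Ico 0 S.period)) :=
    Measure.smul_finite _ ENNReal.ofReal_ne_top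
  refine (Measure.prod_eq fun s E hs hE => ?_).symm
  rw [Measure.map_apply (S.measurable_foot.prodMk hmh) (hs.prod hE), Measure.smul_apply,
    smul_eq_mul, Measure.restrict_apply hE, sectionMeasure,
    Measure.map_apply S.measurable_foot hs]
  have hset : MeasurableSet {q : ℝ × S.domain | S.foot q.2 ∈ s ∧
      S.height (q.1 +ᵥ (q.2 : X)) ∈ E} :=
    (S.measurable_foot.comp measurable_snd hs).inter
      (S.measurable_height.comp (measurable_fst.vadd
        (measurable_subtype_coe.comp measurable_snd)) hE)
  have h1 := Measure.prod_apply (μ := volume.restrict (Set.Ico 0 S.period))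
    (ν := S.domainMeasure) hset
  have h2 := Measure.prod_apply_symm (μ := volume.restrict (Set.Ico 0 S.period))
    (ν := S.domainMeasure) hset
  rw [h1] at h2
  have e1 : ∫⁻ τ in Set.Ico 0 S.period, S.domainMeasure (Prod.mk τ ⁻¹'
      {q : ℝ × S.domain | S.foot q.2 ∈ s ∧ S.height (q.1 +ᵥ (q.2 : X)) ∈ E}) =
      ENNReal.ofReal S.period *
        S.domainMeasure ((fun x : S.domain => (S.foot x, S.height x)) ⁻¹' s ×ˢ E) := by
    refine (setLIntegral_congr_fun (g := fun _ => S.domainMeasure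
      ((fun x : S.domain => (S.foot x, S.height x)) ⁻¹' s ×ˢ E)) measurableSet_Ico
      fun τ hτ => S.measure_rotate hτ).trans ?_
    simp [mul_comm]
  have e2 : ∫⁻ x, (volume.restrict (Set.Ico 0 S.period)) ((fun τ => (τ, x)) ⁻¹'
      {q : ℝ × S.domain | S.foot q.2 ∈ s ∧ S.height (q.1 +ᵥ (q.2 : X)) ∈ E}) ∂S.domainMeasure =
      S.domainMeasure (S.foot ⁻¹' s) * volume (E ∩ Set.Ico 0 S.period) := by
    have : ∀ x : S.domain, (volume.restrict (Set.Ico 0 S.period)) ((fun τ => (τ, x)) ⁻¹'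
      {q : ℝ × S.domain | S.foot q.2 ∈ s ∧ S.height (q.1 +ᵥ (q.2 : X)) ∈ E}) =
        (S.foot ⁻¹' s).indicator (fun _ => volume (E ∩ Set.Ico 0 S.period)) x := by
      intro x
      rw [Measure.restrict_apply (measurable_prodMk_right hset)]
      by_cases hx : S.foot x ∈ s
      · rw [Set.indicator_of_mem (show x ∈ S.foot ⁻¹' s from hx)]
        refine Eq.trans ?_ (volume_rotate hp (S.height_mem (x : X)))
        congr 1
        ext τ
        change (S.foot x ∈ s ∧ S.height (τ +ᵥ (x : X)) ∈ E) ∧ τ ∈ Set.Ico 0 S.period ↔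
          τ ∈ Set.Ico 0 S.period ∧ S.period * Int.fract ((S.height x + τ) / S.period) ∈ E
        rw [S.height_vadd x x.2]
        tauto
      · rw [Set.indicator_of_notMem (show x ∉ S.foot ⁻¹' s from hx)]
        have : (fun τ : ℝ => (τ, x)) ⁻¹' {q : ℝ × S.domain | S.foot q.2 ∈ s ∧
            S.height (q.1 +ᵥ (q.2 : X)) ∈ E} = ∅ :=
          Set.eq_empty_of_forall_notMem fun τ h => hx h.1
        rw [this, Set.empty_inter, measure_empty]
    simp_rw [this]
    rw [lintegral_indicator_const (S.measurable_foot hs), mul_comm]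
  rw [e1, e2] at h2
  rw [mul_left_comm, ← h2, ← mul_assoc, ← ENNReal.ofReal_mul (by positivity),
    inv_mul_cancel₀ hp.ne', ENNReal.ofReal_one, one_mul]

end FlowSection

/-! ### Surfaces consisting of one rectangle -/

namespace FiniteWeightedDiagram

variable (D : FiniteWeightedDiagram)

/-- The width `w⁺(v)` of the rectangle of `v`. -/
def width (v : D.V₀) : ℝ := D.wPos.wV v

/-- The height `w⁻(v)` of the rectangle of `v`. -/
def height (v : D.V₀) : ℝ := D.wNeg.wV (D.weld v)

lemma height_pos (v : D.V₀) : 0 < D.height v := D.wNeg.wV_pos _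

lemma measurable_toSurface : Measurable D.toSurface := fun _ hs => hs

variable [Subsingleton D.V₀]

lemma left_eq (u : D.V₀) : D.left u = 0 :=
  Finset.sum_eq_zero (f := fun u => D.wPos.wV u) fun u' hu => by
    rw [Subsingleton.elim u' u] at hu
    exact absurd (Finset.mem_filter.1 hu).2 (lt_irrefl u)

lemma right_eq (v u : D.V₀) : D.right u = D.width v := by
  rw [Subsingleton.elim v u]
  change D.left u + D.width u = _
  rw [left_eq, zero_add]

lemma bottom_eq (u : D.V₀) : D.bottom u = 0 :=
  Finset.sum_eq_zero (f := fun u => D.wNeg.wV u) fun u' hu => by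
    have := D.weld.symm.injective.subsingleton
    rw [Subsingleton.elim u' (D.weld u)] at hu
    exact absurd (Finset.mem_filter.1 hu).2 (lt_irrefl (D.weld u))

lemma top_eq (v u : D.V₀) : D.top u = D.height v := by
  rw [Subsingleton.elim v u]
  change D.bottom u + D.height u = _
  rw [bottom_eq, zero_add]

lemma rectInterior_eq (v u : D.V₀) :
    D.rectInterior u = Set.Ioo 0 (D.width v) ×ˢ Set.Ioo 0 (D.height v) := by
  rw [rectInterior, left_eq, D.right_eq v, bottom_eq, D.top_eq v]

variable {D}

lemma Glue.cases_of_subsingleton (v : D.V₀) {p q : ℝ × ℝ} (h : D.Glue p q) :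
    (p.1 ∈ Set.Ioo 0 (D.width v) ∧ q.1 ∈ Set.Ioo 0 (D.width v) ∧ p.2 = D.height v ∧ q.2 = 0 ∧
      D.pos.Exchanges D.wPos p.1 q.1) ∨ (p.1 = D.width v ∧ q.1 = 0) := by
  cases h with
  | topBottom u u' x x' hx hx' h =>
    rw [left_eq, D.right_eq v] at hx hx'
    exact Or.inl ⟨hx, hx', D.top_eq v u, D.bottom_eq u', h⟩
  | rightLeft u u' y y' hy hy' h => exact Or.inr ⟨D.right_eq v u, D.left_eq u'⟩

variable (D)

lemma mem_carrier_of_interior (v : D.V₀) {p : ℝ × ℝ}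
    (hp : p ∈ Set.Ioo 0 (D.width v) ×ˢ Set.Ioo 0 (D.height v)) : p ∈ D.carrier :=
  Or.inl ⟨v, by rwa [D.rectInterior_eq v]⟩

lemma carrier_cases (v : D.V₀) {p : ℝ × ℝ} (hp : p ∈ D.carrier) :
    (p.1 ∈ Set.Ioo 0 (D.width v) ∧
      (p.2 ∈ Set.Ioo 0 (D.height v) ∨ p.2 = 0 ∨ p.2 = D.height v)) ∨
      p.1 = 0 ∨ p.1 = D.width v := by
  rcases hp with ⟨u, hu⟩ | ⟨q, h | h⟩
  · rw [D.rectInterior_eq v] at hu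
    exact Or.inl ⟨hu.1, Or.inl hu.2⟩
  · rcases h.cases_of_subsingleton v with h | h
    · exact Or.inl ⟨h.1, Or.inr (Or.inr h.2.2.1)⟩
    · exact Or.inr (Or.inr h.1)
  · rcases h.cases_of_subsingleton v with h | h
    · exact Or.inl ⟨h.2.1, Or.inr (Or.inl h.2.2.2.1)⟩
    · exact Or.inr (Or.inl h.2)

/-- Up to a null set, the carrier is the open rectangle. -/
lemma carrier_ae_eq (v : D.V₀) :
    D.carrier =ᵐ[volume] (Set.Ioo 0 (D.width v) ×ˢ Set.Ioo 0 (D.height v) : Set (ℝ × ℝ)) := by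
  have h1 : ∀ a : ℝ, ∀ᵐ p : ℝ × ℝ, p.1 ≠ a := fun a =>
    Measure.quasiMeasurePreserving_fst.ae (measure_eq_zero_iff_ae_notMem.1
      (measure_singleton (μ := (volume : Measure ℝ)) a))
  have h2 : ∀ a : ℝ, ∀ᵐ p : ℝ × ℝ, p.2 ≠ a := fun a =>
    Measure.quasiMeasurePreserving_snd.ae (measure_eq_zero_iff_ae_notMem.1
      (measure_singleton (μ := (volume : Measure ℝ)) a))
  filter_upwards [h1 0, h1 (D.width v), h2 0, h2 (D.height v)] with p a b c d
  refine propext ⟨fun h => ?_, D.mem_carrier_of_interior v⟩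
  rcases D.carrier_cases v h with ⟨h1, h2 | h2 | h2⟩ | h1 | h1
  exacts [⟨h1, h2⟩, absurd h2 c, absurd h2 d, absurd h1 a, absurd h1 b]

lemma area_apply [Nonempty D.V₀] {s : Set D.Surface} (hs : MeasurableSet s) :
    D.area s = volume ((↑) '' (D.toSurface ⁻¹' s) : Set (ℝ × ℝ)) := by
  have hc : NullMeasurableSet D.carrier volume :=
    ((measurableSet_Ioo.prod measurableSet_Ioo).nullMeasurableSet).congr
      (D.carrier_ae_eq (Classical.arbitrary _)).symm
  rw [area, Measure.map_apply D.measurable_toSurface hs]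
  refine Measure.comap_apply₀ _ _ Subtype.val_injective ?_
    (D.measurable_toSurface hs).nullMeasurableSet
  rintro _ ⟨t, ht, rfl⟩
  rw [Subtype.image_preimage_coe]
  exact hc.inter ht.nullMeasurableSet

/-- The area of a set of points of the surface that is given in the coordinates of the rectangle. -/
lemma area_eq_volume (v : D.V₀) {s : Set D.Surface} (hs : MeasurableSet s) (S : Set (ℝ × ℝ))
    (h : ∀ p : D.carrier, p.1 ∈ Set.Ioo 0 (D.width v) ×ˢ Set.Ioo 0 (D.height v) →
      (D.toSurface p ∈ s ↔ p.1 ∈ S)) :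
    D.area s = volume (S ∩ Set.Ioo 0 (D.width v) ×ˢ Set.Ioo 0 (D.height v)) := by
  rw [D.area_apply hs]
  refine measure_congr ?_
  filter_upwards [D.carrier_ae_eq v] with p hp
  have hp : (p ∈ D.carrier) = (p ∈ Set.Ioo 0 (D.width v) ×ˢ Set.Ioo 0 (D.height v)) := hp
  refine propext ⟨?_, fun ⟨h1, h2⟩ => ?_⟩
  · rintro ⟨p, hps, rfl⟩
    have h2 := hp ▸ p.2
    exact ⟨(h p h2).1 hps, h2⟩
  · exact ⟨⟨p, hp ▸ h2⟩, (h ⟨p, hp ▸ h2⟩ h2).2 h1, rfl⟩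

end FiniteWeightedDiagram

/-! ### The surface over an interval model -/

/-- The diagram with one vertex in each level and one edge between consecutive levels. -/
def trivialDiagram : FullyOrderedBratteli where
  V _ := Unit
  E _ := Unit
  fintypeV _ := inferInstance
  fintypeE _ := inferInstance
  nonemptyV _ := inferInstance
  src _ _ := ()
  rng _ _ := ()
  src_surjective _ _ := ⟨(), rfl⟩
  rng_surjective _ _ := ⟨(), rfl⟩
  linearOrderV := inferInstanceAs (LinearOrder Unit)
  leR _ _ _ := True
  leS _ _ _ := True
  isPartialOrder_leR _ := { refl := fun _ => trivial, trans := fun _ _ _ _ _ => trivial,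
                            antisymm := fun _ _ _ _ => rfl }
  isPartialOrder_leS _ := { refl := fun _ => trivial, trans := fun _ _ _ _ _ => trivial,
                            antisymm := fun _ _ _ _ => rfl }
  comparable_leR _ _ _ := by simp
  comparable_leS _ _ _ := by simp

instance : Unique (trivialDiagram.V 0) := inferInstanceAs (Unique Unit)

/-- The weight function of total mass `H` on the trivial diagram. -/
def trivialWeight (H : ℝ) (hH : 0 < H) : trivialDiagram.WeightFunction where
  wV _ := H
  wE _ _ := 1
  wV_pos _ := hH
  wE_pos _ _ := one_pos
  weight_eq _ _ _ _ := rfl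
  sum_eq_one n v := by
    have h : ∀ e : trivialDiagram.E n, trivialDiagram.src n e = v := fun _ => rfl
    simp only [h, Finset.filter_true, Finset.sum_const, nsmul_eq_mul, mul_one]
    exact Nat.cast_one
  tendsto_zero ξ h := by
    have : Subsingleton trivialDiagram.PathSpace := ⟨fun ξ η => Subtype.ext (funext fun _ => Subsingleton.elim (α := Unit) _ _)⟩
    exact absurd (Set.toFinite _) h

namespace IntervalModel

variable {Y : Type*} [MeasurableSpace Y] [AddAction ℤ Y] {ν : Measure Y} {H : ℝ} (hH : 0 < H)
  (M : IntervalModel Y ν H⁻¹)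

instance : Subsingleton (M.diagram.V 0) := M.subsingleton

instance : Unique (M.diagram.V 0) := uniqueOfSubsingleton (Classical.arbitrary _)

/-- The diagram whose positive half is the interval model and whose negative half is trivial: the
right side of its rectangle is glued to the left side by the identity. -/
def suspension : FiniteWeightedDiagram where
  pos := M.diagram
  neg := trivialDiagram
  weld := OrderIso.ofUnique _ _
  wPos := M.weight
  wNeg := trivialWeight H hH
  area_eq_one := by
    rw [Fintype.sum_unique, M.weight_vertex]
    exact inv_mul_cancel₀ hH.ne'

instance : Subsingleton (M.suspension hH).V₀ := M.subsingleton

instance : Nonempty (M.suspension hH).V₀ := inferInstanceAs (Nonempty (M.diagram.V 0))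

/-- The vertex of the rectangle. -/
def vertex : (M.suspension hH).V₀ := (default : M.diagram.V 0)

lemma width_eq (v : (M.suspension hH).V₀) : (M.suspension hH).width v = H⁻¹ :=
  M.weight_vertex v

lemma height_eq (v : (M.suspension hH).V₀) : (M.suspension hH).height v = H := rfl

lemma glue_cases {p q : ℝ × ℝ} (h : (M.suspension hH).Glue p q) :
    (p.1 ∈ Set.Ioo 0 H⁻¹ ∧ q.1 ∈ Set.Ioo 0 H⁻¹ ∧ p.2 = H ∧ q.2 = 0 ∧
      M.diagram.Exchanges M.weight p.1 q.1) ∨ (p.1 = H⁻¹ ∧ q.1 = 0) := by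
  have := h.cases_of_subsingleton (M.vertex hH)
  rwa [width_eq, height_eq] at this

/-! ### The orbits of the vertical flow over good points -/

lemma glue {y : Y} (hy : y ∈ M.good) :
    (M.suspension hH).Glue (M.toInterval y, H) (M.toInterval ((1 : ℤ) +ᵥ y), 0) := by
  have h := FiniteWeightedDiagram.Glue.topBottom (D := M.suspension hH) (M.vertex hH) (M.vertex hH)
    (M.toInterval y) (M.toInterval ((1 : ℤ) +ᵥ y))
    (by
      rw [FiniteWeightedDiagram.left_eq, FiniteWeightedDiagram.right_eq _ (M.vertex hH), width_eq]
      exact M.mem_Ioo y hy)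
    (by
      rw [FiniteWeightedDiagram.left_eq, FiniteWeightedDiagram.right_eq _ (M.vertex hH), width_eq]
      exact M.mem_Ioo _ (M.vadd_mem 1 y hy)) (M.exchanges y hy)
  rwa [FiniteWeightedDiagram.top_eq _ (M.vertex hH), height_eq,
    FiniteWeightedDiagram.bottom_eq] at h

lemma mem_carrier {y : Y} (hy : y ∈ M.good) {v : ℝ} (hv : v ∈ Set.Icc 0 H) :
    (M.toInterval y, v) ∈ (M.suspension hH).carrier := by
  rcases eq_or_lt_of_le hv.1 with rfl | h0
  · refine Or.inr ⟨(M.toInterval ((-1 : ℤ) +ᵥ y), H), Or.inr ?_⟩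
    have h := M.glue hH (M.vadd_mem (-1) y hy)
    rwa [vadd_vadd, add_neg_cancel, zero_vadd] at h
  rcases eq_or_lt_of_le hv.2 with rfl | h1
  · exact Or.inr ⟨_, Or.inl (M.glue hH hy)⟩
  · refine FiniteWeightedDiagram.mem_carrier_of_interior _ (M.vertex hH) ?_
    rw [width_eq, height_eq]
    exact ⟨M.mem_Ioo y hy, h0, h1⟩

/-- The point of the surface at height `v` over the good point `y`. -/
def surfacePoint (y : Y) (hy : y ∈ M.good) (v : ℝ) (hv : v ∈ Set.Icc 0 H) :
    (M.suspension hH).Surface :=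
  (M.suspension hH).toSurface ⟨(M.toInterval y, v), M.mem_carrier hH hy hv⟩

lemma surfacePoint_top {y : Y} (hy : y ∈ M.good) :
    M.surfacePoint hH y hy H ⟨hH.le, le_rfl⟩ =
      M.surfacePoint hH ((1 : ℤ) +ᵥ y) (M.vadd_mem 1 y hy) 0 ⟨le_rfl, hH.le⟩ :=
  Quot.sound (M.glue hH hy)

lemma flowsUp_segment {y : Y} (hy : y ∈ M.good) {a b : ℝ} (ha : 0 ≤ a) (hab : a ≤ b) (hb : b ≤ H) :
    (M.suspension hH).FlowsUp (b - a) (M.surfacePoint hH y hy a ⟨ha, hab.trans hb⟩)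
      (M.surfacePoint hH y hy b ⟨ha.trans hab, hb⟩) := by
  have h := FiniteWeightedDiagram.FlowsUp.segment (D := M.suspension hH) (M.toInterval y) a (b - a)
    (by linarith)
    (fun s hs => M.mem_carrier hH hy ⟨by linarith [hs.1], by linarith [hs.2]⟩)
    (M.mem_carrier hH hy ⟨ha, hab.trans hb⟩)
    (M.mem_carrier hH hy ⟨by linarith, by linarith⟩)
  have e : a + (b - a) = b := by ring
  simp only [e] at h
  exact h

/-- The upward flow over good points is the suspension of the bijection, here for `k` crossings of
the top side. -/
lemma flowsUp (k : ℕ) : ∀ {y : Y} (hy : y ∈ M.good) {a b : ℝ} (ha : a ∈ Set.Icc 0 H)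
    (hb : b ∈ Set.Icc 0 H) {t : ℝ}, 0 ≤ t → a + t = b + k * H →
    (M.suspension hH).FlowsUp t (M.surfacePoint hH y hy a ha)
      (M.surfacePoint hH ((k : ℤ) +ᵥ y) (M.vadd_mem k y hy) b hb) := by
  induction k with
  | zero =>
    intro y hy a b ha hb t ht hab
    have h := M.flowsUp_segment hH hy ha.1 (show a ≤ b by simp at hab; linarith) hb.2
    obtain rfl : t = b - a := by simp at hab; linarith
    simpa using h
  | succ k ih =>
    intro y hy a b ha hb t ht hab
    have h1 := M.flowsUp_segment hH hy ha.1 ha.2 le_rfl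
    rw [surfacePoint_top] at h1
    have hk : 0 ≤ (k : ℝ) * H := by positivity
    push_cast at hab
    have h2 := ih (M.vadd_mem 1 y hy) (a := 0) ⟨le_rfl, hH.le⟩ hb (t := t - (H - a))
      (by linarith [hb.1]) (by linarith)
    have h3 := FiniteWeightedDiagram.FlowsUp.trans _ _ _ _ _ h1 h2
    rw [add_sub_cancel] at h3
    simp only [vadd_vadd] at h3
    exact_mod_cast h3

/-! ### Recognizing the points of the surface over good points -/

/-- Good points are glued only to good points: the cutting and stacking map is single-valued and
injective at them, and the vertical sides do not contain any. -/
lemma mem_image_good_iff_of_glue {p q : ℝ × ℝ} (h : (M.suspension hH).Glue p q) :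
    p.1 ∈ M.toInterval '' M.good ↔ q.1 ∈ M.toInterval '' M.good := by
  have hsub : ∀ x ∈ M.toInterval '' M.good, x ∈ Set.Ioo 0 H⁻¹ := by
    rintro _ ⟨y, hy, rfl⟩
    exact M.mem_Ioo y hy
  rcases M.glue_cases hH h with ⟨_, _, _, _, ε, hε, hex⟩ | ⟨hp, hq⟩
  · have hst := hex 0 (by simpa using hε)
    rw [add_zero, add_zero] at hst
    constructor
    · rintro ⟨y, hy, hyp⟩
      rw [← hyp] at hst
      exact ⟨_, M.vadd_mem 1 y hy, (M.eq_of_left y hy _ hst).symm⟩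
    · rintro ⟨y, hy, hyq⟩
      rw [← hyq] at hst
      exact ⟨_, M.vadd_mem (-1) y hy, (M.eq_of_right y hy _ hst).symm⟩
  · refine iff_of_false (fun h => ?_) fun h => ?_
    · exact (hsub _ h).2.ne hp
    · exact (hsub _ h).1.ne' hq

lemma glue_good {y : Y} (hy : y ∈ M.good) {p q : ℝ × ℝ} (hp : p.1 = M.toInterval y)
    (h : (M.suspension hH).Glue p q) :
    p.2 = H ∧ q.2 = 0 ∧ q.1 = M.toInterval ((1 : ℤ) +ᵥ y) := by
  rcases M.glue_cases hH h with ⟨_, _, h1, h2, ε, hε, hex⟩ | ⟨hp', _⟩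
  · have hst := hex 0 (by simpa using hε)
    rw [add_zero, add_zero, hp] at hst
    exact ⟨h1, h2, M.eq_of_left y hy _ hst⟩
  · exact absurd (hp.symm.trans hp') (M.mem_Ioo y hy).2.ne

/-- The points of the surface over good points. -/
def goodSurface : Set (M.suspension hH).Surface :=
  {s | Quot.lift (fun p : (M.suspension hH).carrier => p.1.1 ∈ M.toInterval '' M.good)
    (fun _ _ h => propext (M.mem_image_good_iff_of_glue hH h)) s}

lemma exists_surfacePoint {s : (M.suspension hH).Surface} (hs : s ∈ M.goodSurface hH) :
    ∃ y, ∃ hy : y ∈ M.good, ∃ v, ∃ hv : v ∈ Set.Icc 0 H, s = M.surfacePoint hH y hy v hv := by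
  obtain ⟨⟨⟨x, v⟩, hp⟩, rfl⟩ := Quot.exists_rep s
  obtain ⟨y, hy, hyx⟩ := hs
  have hyx : M.toInterval y = x := hyx
  subst hyx
  refine ⟨y, hy, v, ?_, rfl⟩
  have hc := FiniteWeightedDiagram.carrier_cases _ (M.vertex hH) hp
  rw [width_eq, height_eq] at hc
  rcases hc with ⟨_, h | h | h⟩ | h | h
  · exact ⟨h.1.le, h.2.le⟩
  · exact ⟨h.ge, h.trans_le hH.le⟩
  · exact ⟨hH.le.trans_eq h.symm, h.le⟩
  · exact absurd h (M.mem_Ioo y hy).1.ne'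
  · exact absurd h (M.mem_Ioo y hy).2.ne

variable [StandardBorelSpace Y]

lemma measurableSet_image_good : MeasurableSet (M.toInterval '' M.good) :=
  M.measurableSet_good.image_of_measurable_injOn M.measurable_toInterval M.injOn

lemma measurableSet_goodSurface : MeasurableSet (M.goodSurface hH) :=
  (measurable_fst.comp measurable_subtype_coe) M.measurableSet_image_good

lemma exists_leftInverse [Nonempty Y] :
    ∃ g : ℝ → Y, Measurable g ∧ ∀ y ∈ M.good, g (M.toInterval y) = y := by
  have := M.measurableSet_good.standardBorel
  have he : MeasurableEmbedding (M.good.domRestrict M.toInterval) :=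
    Measurable.measurableEmbedding (M.measurable_toInterval.comp measurable_subtype_coe)
      (Set.injOn_iff_injective.1 M.injOn)
  obtain ⟨g, hg, h⟩ := he.exists_measurable_extend measurable_subtype_coe fun _ => inferInstance
  exact ⟨g, hg, fun y hy => congrFun h ⟨y, hy⟩⟩

lemma area_compl_goodSurface : (M.suspension hH).area (M.goodSurface hH)ᶜ = 0 := by
  have h0 : (volume.restrict (Set.Ioo 0 H⁻¹)) (M.toInterval '' M.good)ᶜ = 0 := by
    have h : ν.map M.toInterval (M.toInterval '' M.good)ᶜ = 0 := by
      rw [Measure.map_apply M.measurable_toInterval M.measurableSet_image_good.compl]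
      refine measure_mono_null (fun y hy hg => hy ⟨y, hg, rfl⟩) (ae_iff.1 M.ae_good)
    rw [M.map_eq, Measure.smul_apply, smul_eq_mul, mul_eq_zero] at h
    refine h.resolve_left ?_
    rw [inv_inv, ENNReal.ofReal_eq_zero, not_le]
    exact hH
  rw [Measure.restrict_apply M.measurableSet_image_good.compl] at h0
  have h1 := Measure.quasiMeasurePreserving_fst.preimage_null h0 (μb := volume)
    (μa := (volume : Measure ℝ).prod (volume : Measure ℝ))
  rw [FiniteWeightedDiagram.area_eq_volume _ (M.vertex hH)
    (M.measurableSet_goodSurface hH).compl (Prod.fst ⁻¹' (M.toInterval '' M.good)ᶜ)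
    fun p _ => Iff.rfl, width_eq]
  exact measure_mono_null (fun p hp => And.intro hp.1 hp.2.1) h1

end IntervalModel

/-! ### Realizing a flow with a section on a surface -/

lemma IntervalModel.surfacePoint_congr {Y : Type*} [MeasurableSpace Y] [AddAction ℤ Y]
    {ν : Measure Y} {H : ℝ} (hH : 0 < H) (M : IntervalModel Y ν H⁻¹) {y z : Y} (h : y = z) {u v : ℝ}
    (huv : u = v) (hy : y ∈ M.good) (hz : z ∈ M.good) (hu : u ∈ Set.Icc 0 H)
    (hv : v ∈ Set.Icc 0 H) : M.surfacePoint hH y hy u hu = M.surfacePoint hH z hz v hv := by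
  subst h; subst huv; rfl

namespace FlowSection

variable {X : Type*} [MeasurableSpace X] [AddAction ℝ X] {μ : Measure X} (S : FlowSection X μ)

lemma height_section (y : S.Section) : S.height y.1 = 0 := y.2.2

lemma foot_section (y : S.Section) : S.foot ⟨y.1, y.2.1⟩ = y := by
  refine Subtype.ext ?_
  change (-S.height y.1) +ᵥ y.1 = y.1
  rw [height_section, neg_zero, zero_vadd]

lemma measure_eq_domainMeasure {s : Set X} (hs : MeasurableSet s) :
    μ s = S.domainMeasure ((↑) ⁻¹' s) := by
  rw [← Measure.map_apply measurable_subtype_coe hs, map_domainMeasure]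

lemma height_mem_Icc (x : X) : S.height x ∈ Set.Icc 0 S.period :=
  Set.Ico_subset_Icc_self (S.height_mem x)

variable (M : IntervalModel S.Section S.sectionMeasure S.period⁻¹)

/-- The points of `X` over good points of the section. -/
def goodSet : Set X := {x | ∃ hx : x ∈ S.domain, S.foot ⟨x, hx⟩ ∈ M.good}

lemma vadd_mem_goodSet (t : ℝ) (x : X) (hx : x ∈ S.goodSet M) : t +ᵥ x ∈ S.goodSet M := by
  obtain ⟨hx, hg⟩ := hx
  obtain ⟨k, h1, h2⟩ := S.exists_floor x t
  refine ⟨S.domain.vadd_mem t hx, ?_⟩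
  have h : S.foot ⟨t +ᵥ x, S.domain.vadd_mem t hx⟩ = k +ᵥ S.foot ⟨x, hx⟩ :=
    S.foot_vadd (x := ⟨x, hx⟩) h1 h2
  rw [h]
  exact M.vadd_mem k _ hg

lemma goodSet_eq_image : S.goodSet M = (↑) '' (S.foot ⁻¹' M.good) := by
  ext x
  constructor
  · rintro ⟨hx, h⟩
    exact ⟨⟨x, hx⟩, h, rfl⟩
  · rintro ⟨x, h, rfl⟩
    exact ⟨x.2, h⟩

/-- The point of the surface that corresponds to a point of `X`. -/
def toSurface (x : S.goodSet M) : (M.suspension S.period_pos).Surface :=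
  M.surfacePoint S.period_pos (S.foot ⟨x, x.2.1⟩) x.2.2 (S.height x) (S.height_mem_Icc x)

lemma toSurface_eq (x : S.goodSet M) {y : S.Section} (hy : y ∈ M.good) {v : ℝ}
    (hv : v ∈ Set.Icc 0 S.period) (h : (x : X) = v +ᵥ y.1) :
    S.toSurface M x = M.surfacePoint S.period_pos y hy v hv := by
  obtain ⟨x, hx⟩ := x
  have h : x = v +ᵥ y.1 := h
  subst h
  rcases hv.2.lt_or_eq with hlt | rfl
  · have h1 : ((0 : ℤ) : ℝ) * S.period ≤ S.height y.1 + v := by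
      rw [height_section]; simpa using hv.1
    have h2 : S.height y.1 + v < ((0 : ℤ) + 1) * S.period := by
      rw [height_section]; simpa using hlt
    refine M.surfacePoint_congr _ ?_ ?_ _ _ _ _
    · refine (S.foot_vadd (x := ⟨y.1, y.2.1⟩) h1 h2).trans ?_
      rw [foot_section, zero_vadd]
    · refine (S.height_foot_vadd y.2.1 h1 h2).trans ?_
      rw [height_section]
      simp
  · have hp := S.period_pos
    have h1 : ((1 : ℤ) : ℝ) * S.period ≤ S.height y.1 + S.period := by
      rw [height_section]; simp
    have h2 : S.height y.1 + S.period < ((1 : ℤ) + 1) * S.period := by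
      rw [height_section]; push_cast; linarith
    rw [M.surfacePoint_top]
    refine M.surfacePoint_congr _ ?_ ?_ _ _ _ _
    · refine (S.foot_vadd (x := ⟨y.1, y.2.1⟩) h1 h2).trans ?_
      rw [foot_section]
    · refine (S.height_foot_vadd y.2.1 h1 h2).trans ?_
      rw [height_section]
      simp

lemma toSurface_mem (x : S.goodSet M) : S.toSurface M x ∈ M.goodSurface S.period_pos :=
  ⟨_, x.2.2, rfl⟩

lemma flowsUp_toSurface {t : ℝ} (ht : 0 ≤ t) (x : S.goodSet M) :
    (M.suspension S.period_pos).FlowsUp t (S.toSurface M x)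
      (S.toSurface M ⟨t +ᵥ (x : X), S.vadd_mem_goodSet M t x x.2⟩) := by
  obtain ⟨k, h1, h2⟩ := S.exists_floor x t
  have hk : 0 ≤ k := by
    by_contra! hk
    have hk' : (k : ℝ) + 1 ≤ 0 := by exact_mod_cast hk
    have := mul_nonpos_of_nonpos_of_nonneg hk' S.period_pos.le
    linarith [(S.height_mem x).1]
  lift k to ℕ using hk
  have hb : S.height x + t - (k : ℤ) * S.period ∈ Set.Icc 0 S.period :=
    ⟨by linarith, by linarith⟩
  have h := M.flowsUp S.period_pos k x.2.2 (S.height_mem_Icc x) hb ht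
    (by push_cast; ring)
  refine (congrArg (FiniteWeightedDiagram.FlowsUp _ t _) ?_).mp h
  exact M.surfacePoint_congr _ (S.foot_vadd (x := ⟨x, x.2.1⟩) h1 h2).symm
    (S.height_foot_vadd x.2.1 h1 h2).symm _ _ _ _

lemma verticalFlow_toSurface (t : ℝ) (x : S.goodSet M) :
    (M.suspension S.period_pos).VerticalFlow t (S.toSurface M x)
      (S.toSurface M ⟨t +ᵥ (x : X), S.vadd_mem_goodSet M t x x.2⟩) := by
  rcases le_total 0 t with ht | ht
  · exact Or.inl ⟨ht, S.flowsUp_toSurface M ht x⟩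
  · refine Or.inr ⟨ht, ?_⟩
    have h := S.flowsUp_toSurface M (neg_nonneg.2 ht)
      ⟨t +ᵥ (x : X), S.vadd_mem_goodSet M t x x.2⟩
    simpa [vadd_vadd] using h

variable [MeasurableVAdd₂ ℝ X]

lemma measurableSet_goodSet : MeasurableSet (S.goodSet M) := by
  rw [goodSet_eq_image]
  exact S.measurableSet_domain.subtype_image (S.measurable_foot M.measurableSet_good)

lemma ae_foot_mem_good : ∀ᵐ x ∂S.domainMeasure, S.foot x ∈ M.good :=
  ae_of_ae_map S.measurable_foot.aemeasurable M.ae_good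

lemma compl_goodSet : μ (S.goodSet M)ᶜ = 0 := by
  rw [S.measure_eq_domainMeasure (S.measurableSet_goodSet M).compl]
  exact measure_mono_null (fun x hx hg => hx ⟨x.2, hg⟩) (ae_iff.1 (S.ae_foot_mem_good M))

lemma measurable_toSurface : Measurable (S.toSurface M) := by
  have h : Measurable fun x : S.goodSet M => (⟨x, x.2.1⟩ : S.domain) :=
    measurable_subtype_coe.subtype_mk
  exact (FiniteWeightedDiagram.measurable_toSurface _).comp
    (((M.measurable_toInterval.comp (S.measurable_foot.comp h)).prodMk
      (S.measurable_height.comp measurable_subtype_coe)).subtype_mk)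

/-- The inverse of `toSurface`, extended to the whole surface. -/
lemma exists_inverse [StandardBorelSpace X] [IsProbabilityMeasure μ] :
    ∃ Ψ : (M.suspension S.period_pos).Surface → X, Measurable Ψ ∧
      ∀ y (hy : y ∈ M.good) v hv, Ψ (M.surfacePoint S.period_pos y hy v hv) = v +ᵥ y.1 := by
  classical
  have : Nonempty S.Section := nonempty_of_isProbabilityMeasure S.sectionMeasure
  obtain ⟨g, hg, hgi⟩ := M.exists_leftInverse
  let x₀ : X := (Classical.arbitrary S.Section).1
  let r : (M.suspension S.period_pos).carrier → X := fun p =>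
    if p.1.1 ∈ M.toInterval '' M.good then p.1.2 +ᵥ (g p.1.1).1 else x₀
  have hr : Measurable r := by
    have h1 : Measurable fun p : (M.suspension S.period_pos).carrier => p.1.1 :=
      measurable_fst.comp measurable_subtype_coe
    have h2 : Measurable fun p : (M.suspension S.period_pos).carrier => p.1.2 :=
      measurable_snd.comp measurable_subtype_coe
    exact Measurable.ite (h1 M.measurableSet_image_good)
      (h2.vadd (measurable_subtype_coe.comp (hg.comp h1))) measurable_const
  have hglue : ∀ p q : (M.suspension S.period_pos).carrier,
      (M.suspension S.period_pos).Glue p q → r p = r q := by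
    intro p q h
    have hiff := M.mem_image_good_iff_of_glue _ h
    by_cases hp : p.1.1 ∈ M.toInterval '' M.good
    · simp only [r, if_pos hp, if_pos (hiff.1 hp)]
      obtain ⟨y, hy, hyp⟩ := hp
      obtain ⟨h1, h2, h3⟩ := M.glue_good _ hy hyp.symm h
      rw [h1, h2, h3, ← hyp, hgi y hy, hgi _ (M.vadd_mem 1 y hy), coe_vadd, zero_vadd]
      simp
    · simp only [r, if_neg hp, if_neg (mt hiff.2 hp)]
  refine ⟨Quot.lift r hglue, fun s hs => hr hs, fun y hy v hv => ?_⟩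
  change r ⟨(M.toInterval y, v), _⟩ = _
  simp only [r, if_pos (Set.mem_image_of_mem M.toInterval hy), hgi y hy]

/-- The flow over good points is measurably equivalent to its image in the surface. -/
lemma exists_measurableEquiv [StandardBorelSpace X] [IsProbabilityMeasure μ] :
    ∃ e : S.goodSet M ≃ᵐ M.goodSurface S.period_pos, ∀ x, (e x).1 = S.toSurface M x := by
  obtain ⟨Ψ, hΨ, hΨs⟩ := S.exists_inverse M
  have hmem : ∀ s ∈ M.goodSurface S.period_pos, Ψ s ∈ S.goodSet M := by
    intro s hs
    obtain ⟨y, hy, v, hv, rfl⟩ := M.exists_surfacePoint _ hs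
    rw [hΨs]
    refine S.vadd_mem_goodSet M v _ ⟨y.2.1, ?_⟩
    rwa [foot_section]
  refine ⟨{ toFun := fun x => ⟨S.toSurface M x, S.toSurface_mem M x⟩
            invFun := fun s => ⟨Ψ s, hmem s s.2⟩
            left_inv := fun x => Subtype.ext ?_
            right_inv := fun s => Subtype.ext ?_
            measurable_toFun := (S.measurable_toSurface M).subtype_mk
            measurable_invFun := (hΨ.comp measurable_subtype_coe).subtype_mk }, fun x => rfl⟩
  · exact (hΨs _ x.2.2 _ (S.height_mem_Icc x)).trans (S.height_vadd_foot ⟨x, x.2.1⟩)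
  · obtain ⟨s, hs⟩ := s
    obtain ⟨y, hy, v, hv, rfl⟩ := M.exists_surfacePoint _ hs
    exact S.toSurface_eq M _ hy hv (hΨs y hy v hv)

/-! ### The realization preserves the measure -/

/-- In the coordinates of the rectangle the invariant measure is the area. -/
lemma map_coordinates [VAddInvariantMeasure ℝ X μ] [IsProbabilityMeasure μ] :
    S.domainMeasure.map (fun x => (M.toInterval (S.foot x), S.height x)) =
      volume.restrict (Set.Ioo 0 S.period⁻¹ ×ˢ Set.Ioo 0 S.period) := by
  have hp := S.period_pos
  have h : (fun x : S.domain => (M.toInterval (S.foot x), S.height x)) =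
      Prod.map M.toInterval id ∘ fun x : S.domain => (S.foot x, S.height (x : X)) := rfl
  have hc : Measurable fun x : S.domain => (S.foot x, S.height (x : X)) :=
    S.measurable_foot.prodMk (S.measurable_height.comp measurable_subtype_coe)
  rw [h, ← Measure.map_map (M.measurable_toInterval.prodMap measurable_id)
    hc, map_foot_height, ← Measure.map_prod_map _ _ M.measurable_toInterval measurable_id,
    Measure.map_id, M.map_eq, Measure.prod_smul_left, Measure.prod_smul_right, smul_smul,
    inv_inv, ← ENNReal.ofReal_mul hp.le, mul_inv_cancel₀ hp.ne', ENNReal.ofReal_one, one_smul,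
    Measure.prod_restrict, ← Measure.volume_eq_prod]
  refine Measure.restrict_congr_set ?_
  exact Measure.set_prod_ae_eq ae_eq_rfl Ioo_ae_eq_Ico.symm

lemma measure_preimage_toSurface [StandardBorelSpace X] [VAddInvariantMeasure ℝ X μ]
    [IsProbabilityMeasure μ] {s : Set (M.suspension S.period_pos).Surface}
    (hs : MeasurableSet s) :
    μ ((↑) '' (S.toSurface M ⁻¹' s)) = (M.suspension S.period_pos).area s := by
  obtain ⟨T, hT, hTs⟩ := (FiniteWeightedDiagram.measurable_toSurface _ hs : MeasurableSet
    ((M.suspension S.period_pos).toSurface ⁻¹' s))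
  have hTs : ∀ p : (M.suspension S.period_pos).carrier,
      (M.suspension S.period_pos).toSurface p ∈ s ↔ p.1 ∈ T := fun p =>
    (Set.ext_iff.1 hTs p).symm
  have hmeas : MeasurableSet ((↑) '' (S.toSurface M ⁻¹' s) : Set X) :=
    (S.measurableSet_goodSet M).subtype_image (S.measurable_toSurface M hs)
  have hc : Measurable fun x : S.domain => (M.toInterval (S.foot x), S.height (x : X)) :=
    (M.measurable_toInterval.comp S.measurable_foot).prodMk
      (S.measurable_height.comp measurable_subtype_coe)
  rw [FiniteWeightedDiagram.area_eq_volume _ (M.vertex S.period_pos) hs T fun p _ => hTs p,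
    M.width_eq, M.height_eq, ← Measure.restrict_apply hT, ← S.map_coordinates M,
    Measure.map_apply hc hT, S.measure_eq_domainMeasure hmeas]
  refine measure_congr ?_
  filter_upwards [S.ae_foot_mem_good M] with x hx
  refine propext ⟨?_, fun h => ?_⟩
  · rintro ⟨z, hz, hzx⟩
    obtain ⟨z, hzg⟩ := z
    obtain rfl : z = x := hzx
    exact (hTs _).1 hz
  · exact ⟨⟨x, x.2, hx⟩, (hTs ⟨_, M.mem_carrier _ hx (S.height_mem_Icc x)⟩).2 h, rfl⟩

/-- A flow with a section is isomorphic to the vertical flow of the suspension of any interval model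
of its return map. -/
theorem isIsomorphicToVerticalFlow [StandardBorelSpace X] [VAddInvariantMeasure ℝ X μ]
    [IsProbabilityMeasure μ] : IsIsomorphicToVerticalFlow μ (M.suspension S.period_pos) := by
  obtain ⟨e, he⟩ := S.exists_measurableEquiv M
  have hA := S.measurableSet_goodSet M
  have hA' := M.measurableSet_goodSurface S.period_pos
  refine ⟨S.goodSet M, M.goodSurface S.period_pos, S.vadd_mem_goodSet M, e, hA, hA',
    S.compl_goodSet M, M.area_compl_goodSurface _, ⟨e.measurable, ?_⟩, fun t x => ?_⟩
  · ext E hE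
    rw [Measure.map_apply e.measurable hE,
      comap_subtype_coe_apply hA, comap_subtype_coe_apply hA',
      ← S.measure_preimage_toSurface M (hA'.subtype_image hE)]
    congr 2
    ext x
    simp only [Set.mem_preimage, ← he]
    exact (Subtype.val_injective.mem_set_image).symm
  · rw [he, he]
    exact S.verticalFlow_toSurface M t x

end FlowSection

/-! ### The eigenfunction of a surface consisting of one rectangle -/

namespace FiniteWeightedDiagram

variable (D : FiniteWeightedDiagram) [Subsingleton D.V₀] (v : D.V₀)

open scoped Classical in
/-- The function `exp (2πiy/H)` of the height `y` in the rectangle of height `H`, and `0` on the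
vertical sides. -/
def phase : D.Surface → ℂ :=
  Quot.lift (fun p : D.carrier => if p.1.1 ∈ Set.Ioo 0 (D.width v) then
    Complex.exp (Complex.I * ↑(2 * Real.pi / D.height v) * p.1.2) else 0) fun p q h => by
    rcases h.cases_of_subsingleton v with ⟨h1, h2, h3, h4, _⟩ | ⟨h1, h2⟩
    · have hH : (D.height v : ℂ) ≠ 0 := Complex.ofReal_ne_zero.2 (D.height_pos v).ne'
      rw [if_pos h1, if_pos h2, h3, h4]
      have e : Complex.I * ↑(2 * Real.pi / D.height v) * (D.height v : ℂ) =
          2 * Real.pi * Complex.I := by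
        push_cast
        field_simp
      rw [e, Complex.exp_two_pi_mul_I]
      simp
    · rw [if_neg fun h => h.2.ne h1, if_neg fun h => h.1.ne' h2]

variable {D}

/-- The horizontal coordinate is constant along vertical segments, and the top and the bottom of the
rectangle have the same phase. -/
lemma FlowsUp.phase_eq {t : ℝ} {a b : D.Surface} (h : D.FlowsUp t a b) :
    D.phase v b =
      Complex.exp (Complex.I * ↑(2 * Real.pi / D.height v) * t) * D.phase v a := by
  induction h with
  | segment x y t ht h h₀ h₁ =>
    simp only [phase, toSurface]
    split_ifs
    · rw [← Complex.exp_add]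
      congr 1
      push_cast
      ring
    · rw [mul_zero]
  | trans s t a b c hab hbc ih1 ih2 =>
    rw [ih2, ih1, ← mul_assoc, ← Complex.exp_add]
    congr 2
    push_cast
    ring

lemma VerticalFlow.phase_eq {t : ℝ} {a b : D.Surface} (h : D.VerticalFlow t a b) :
    D.phase v b =
      Complex.exp (Complex.I * ↑(2 * Real.pi / D.height v) * t) * D.phase v a := by
  rcases h with ⟨_, h⟩ | ⟨_, h⟩
  · exact h.phase_eq v
  · rw [h.phase_eq v, ← mul_assoc, ← Complex.exp_add]
    simp

variable (D)

lemma measurable_phase : Measurable (D.phase v) := by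
  have h1 : Measurable fun p : D.carrier => p.1.1 := measurable_fst.comp measurable_subtype_coe
  have h2 : Measurable fun p : D.carrier => p.1.2 := measurable_snd.comp measurable_subtype_coe
  have h : Measurable fun p : D.carrier => D.phase v (D.toSurface p) :=
    Measurable.ite (h1 measurableSet_Ioo)
      (Complex.measurable_exp.comp ((Complex.measurable_ofReal.comp h2).const_mul _))
      measurable_const
  exact fun s hs => h hs

lemma norm_phase_le (a : D.Surface) : ‖D.phase v a‖ ≤ 1 := by
  obtain ⟨p, rfl⟩ := Quot.exists_rep a
  simp only [phase]
  split_ifs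
  · rw [mul_assoc, ← Complex.ofReal_mul, mul_comm, Complex.norm_exp_ofReal_mul_I]
  · simp

lemma area_phase_eq_zero : D.area (D.phase v ⁻¹' {0}) = 0 := by
  have : Nonempty D.V₀ := ⟨v⟩
  rw [D.area_eq_volume v (D.measurable_phase v (measurableSet_singleton 0)) ∅, Set.empty_inter,
    measure_empty]
  intro p hp
  refine iff_of_false (fun h => ?_) (Set.notMem_empty _)
  have h : D.phase v (D.toSurface p) = 0 := h
  simp only [phase, toSurface] at h
  rw [if_pos hp.1] at h
  exact Complex.exp_ne_zero _ h

end FiniteWeightedDiagram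

/-- On a surface consisting of one rectangle, the height coordinate modulo the height of the
rectangle yields an eigenfunction. -/
theorem IsIsomorphicToVerticalFlow.hasEigenfunction {X : Type*} [MeasurableSpace X]
    [AddAction ℝ X] [MeasurableVAdd₂ ℝ X] {μ : Measure X} [IsProbabilityMeasure μ]
    [VAddInvariantMeasure ℝ X μ] {D : FiniteWeightedDiagram} (hD : Nat.card D.V₀ = 1)
    (h : IsIsomorphicToVerticalFlow μ D) : HasEigenfunctionWithNonzeroEigenvalue μ := by
  obtain ⟨_, ⟨v⟩⟩ := Nat.card_eq_one_iff_unique.1 hD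
  obtain ⟨A, A', hA, e, hAm, hAm', hA0, -, he, hflow⟩ := h
  let F : X → ℂ := Function.extend Subtype.val (fun x : A => D.phase v (e x)) 0
  have hF : ∀ x : A, F x = D.phase v (e x) := fun x =>
    Subtype.val_injective.extend_apply _ _ x
  have hFm : Measurable F :=
    (MeasurableEmbedding.subtype_coe hAm).measurable_extend
      ((D.measurable_phase v).comp (measurable_subtype_coe.comp e.measurable)) measurable_const
  have hae : ∀ᵐ x ∂μ, x ∈ A := ae_iff.2 hA0
  have hFL : MemLp F 2 μ := by
    refine MemLp.of_bound hFm.aestronglyMeasurable 1 ?_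
    filter_upwards [hae] with x hx
    rw [hF ⟨x, hx⟩]
    exact D.norm_phase_le v _
  have hF0 : ∀ᵐ x ∂μ, F x ≠ 0 := by
    have h0 : μ ((↑) '' (e ⁻¹' ((↑) ⁻¹' (D.phase v ⁻¹' {0})))) = 0 := by
      have hm : MeasurableSet (D.phase v ⁻¹' {0}) :=
        D.measurable_phase v (measurableSet_singleton 0)
      rw [← comap_subtype_coe_apply hAm,
        he.measure_preimage (measurable_subtype_coe hm).nullMeasurableSet,
        comap_subtype_coe_apply hAm']
      exact measure_mono_null (Set.image_preimage_subset _ _) (D.area_phase_eq_zero v)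
    filter_upwards [hae, measure_eq_zero_iff_ae_notMem.1 h0] with x hx hx0 h
    exact hx0 ⟨⟨x, hx⟩, (hF ⟨x, hx⟩).symm.trans h, rfl⟩
  refine ⟨2 * Real.pi / D.height v, hFL.toLp F, ?_, fun h => ?_, fun t => ?_⟩
  · have := D.height_pos v
    positivity
  · have hFz := (hFL.coeFn_toLp).symm.trans ((Lp.eq_zero_iff_ae_eq_zero).1 h)
    obtain ⟨x, h1, h2⟩ := (hF0.and hFz).exists
    exact h1 h2
  · refine Lp.ext ?_
    have h1 := Lp.coeFn_compMeasurePreserving (hFL.toLp F) (measurePreserving_vadd t μ)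
    have h2 := (measurePreserving_vadd t μ).quasiMeasurePreserving.ae_eq_comp hFL.coeFn_toLp
    filter_upwards [h1, h2, hFL.coeFn_toLp, hae,
      Lp.coeFn_smul (Complex.exp (Complex.I * ↑(2 * Real.pi / D.height v) * t)) (hFL.toLp F)]
      with x h1 h2 h3 hx h4
    refine h1.trans (h2.trans ?_)
    rw [h4, Pi.smul_apply, h3, smul_eq_mul, Function.comp_apply, hF ⟨x, hx⟩,
      hF ⟨t +ᵥ x, hA t x hx⟩]
    exact (hflow t ⟨x, hx⟩).phase_eq v

end

theorem mainTheorem11 {X : Type*} [MeasurableSpace X] [StandardBorelSpace X] [AddAction ℝ X]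
    [MeasurableVAdd₂ ℝ X] (μ : Measure X) [IsProbabilityMeasure μ] [VAddInvariantMeasure ℝ X μ] :
    ((∃ D : FiniteWeightedDiagram, Nat.card D.V₀ = 1 ∧ IsIsomorphicToVerticalFlow μ D) →
      HasEigenfunctionWithNonzeroEigenvalue μ) ∧
    (ErgodicVAdd ℝ X μ → IsAperiodicFlow μ →
      ((∃ D : FiniteWeightedDiagram, Nat.card D.V₀ = 1 ∧ IsIsomorphicToVerticalFlow μ D) ↔
        HasEigenfunctionWithNonzeroEigenvalue μ)) := by
  have h : (∃ D : FiniteWeightedDiagram, Nat.card D.V₀ = 1 ∧ IsIsomorphicToVerticalFlow μ D) →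
      HasEigenfunctionWithNonzeroEigenvalue μ := fun ⟨D, hD, h⟩ => h.hasEigenfunction hD
  refine ⟨h, fun herg hap => ⟨h, fun he => ?_⟩⟩
  obtain ⟨S⟩ := exists_flowSection hap he
  obtain ⟨M⟩ := exists_intervalModel (fun k y hk => S.vadd_ne k y hk) S.sectionMeasure
    (inv_pos.2 S.period_pos)
  exact ⟨M.suspension S.period_pos, Nat.card_eq_one_iff_unique.2 ⟨inferInstance, inferInstance⟩,
    S.isIsomorphicToVerticalFlow M⟩
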